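/- **Setting.** The state is $\theta\in\{0,1\}$ and $\mu_0\in(0,1)$ is the prior probability of state $1$; beliefs are identified with the probability $\mu\in[0,1]$ of state $1$. Actions are $a\in\{0,1\}$; the decision maker (DM) has payoff $u(a,\theta)-ct$ from taking action $a$ at time $t\in\mathcal T=\{0,1,2,\dots\}$ in state $\theta$, where $c>0$, $u(0,0)>u(1,0)$ and $u(1,1)>u(0,1)$ (for instance $u(1,0)=u(0,1)=0<u(0,0),u(1,1)$). Let $\bar\mu\in(0,1)$ be the belief at which both actions give her the same expected payoff, and $u^*(\mu)=\max_a\mathbb E_{\theta\sim\mu}[u(a,\theta)]$. A *dynamic information structure* $I$ is a probability law of a path $(\mu_t,m_t)_{t\ge1}$ of beliefs and real-valued messages such that $(\mu_t)_{t\ge 0}$ is a martingale for the filtration $\mathcal F_t=\sigma((\mu_s,m_s):1\le s\le t)$. The DM stops at the time $\tau=\tau(I)$ that maximizes $\mathbb E^I[u^*(\mu_\tau)-c\tau]$ over the stopping times of $(\mathcal F_t)$, indifference being broken in favour of not stopping; she then takes an optimal action $a_\tau$ for the belief $\mu_\tau$, indifference being broken in favour of action $1$. The structure is *extremal and obedient*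 if its messages are $C$ and $S$; every belief at a time $t\ge1$ that comes with the message $S$ lies in $\{0,\bar\mu,1\}$ (the extreme points of the sets of beliefs at which given actions are optimal); the belief at time $t\ge1$ that comes with $C$ is a deterministic $\mu^C_t$; and at every time $t\ge1$ a DM who has waited until then optimally stops at once after $S$ and continues after $C$. Write $p_{\mu,t}=\mathbb P^I(\tau=t,\ \mu_t=\mu)$. A designer has payoff $f(a_\tau,\tau)$, where $f:\{0,1\}\times\mathcal T\to\mathbb R$ satisfies $f(1,t)\ge f(0,t)$ for all $t$, is supermodular, i.e. $f(1,t)+f(0,s)\ge f(1,s)+f(0,t)$ for all $t\ge s$, and is such that $f(a_\tau,\tau)$ is integrable under every dynamic information structure. **Proposition.** There is a dynamic information structure that maximizes $\mathbb E^I[f(a_\tau,\tau)]$ over all dynamic information structures, that is extremal and obedient, and that has one of the following two forms: (i) (*Stopping signals are fully revealing*) $p_{\bar\mu,t}=0$ for all $t\in\mathcal T$; or (ii) (*Pure bad news*) there is a unique terminal time $T$ (the least $T$ with $\mathbb P^I(\tau>T)=0$); for all $t<T$, $p_{\bar\mu,t}=p_{1,t}=0$; and for every $t<T$ with $p_{0,t}>0$,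 the DM who has not stopped by time $t$ is indifferent at time $t$ between stopping and continuing. The same holds when only those structures are compared under which the DM does not stop at time $0$, provided that there is one: among them there is one that maximizes $\mathbb E^I[f(a_\tau,\tau)]$ over them, is extremal and obedient, and has form (i) or (ii). -/

import Mathlib

open MeasureTheory Set

namespace AttentionCapture

/-- Actions and states are both `Fin 2`; a belief is the probability of state `1`.
`expPayoff u a x` is the expected payoff of action `a` under belief `x`. -/
def expPayoff (u : Fin 2 → Fin 2 → ℝ) (a : Fin 2) (x : ℝ) : ℝ :=
  (1 - x) * u a 0 + x * u a 1

/-- The indirect utility `max_a E_x[u(a,θ)]`. -/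
def indirectUtility (u : Fin 2 → Fin 2 → ℝ) (x : ℝ) : ℝ :=
  max (expPayoff u 0 x) (expPayoff u 1 x)

open Classical in
/-- The DM's best response under belief `x`, ties being broken in favour of action `1`. -/
noncomputable def bestAction (u : Fin 2 → Fin 2 → ℝ) (x : ℝ) : Fin 2 :=
  if expPayoff u 0 x ≤ expPayoff u 1 x then 1 else 0

/-- The beliefs at which every action in `A` is optimal. -/
def optimalRegion (u : Fin 2 → Fin 2 → ℝ) (A : Set (Fin 2)) : Set ℝ :=
  {x | x ∈ Icc (0 : ℝ) 1 ∧ ∀ a ∈ A, ∀ b, expPayoff u b x ≤ expPayoff u a x}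

/-- The extremal stopping beliefs: extreme points of the regions `optimalRegion u A`. -/
def extremalBeliefs (u : Fin 2 → Fin 2 → ℝ) : Set ℝ :=
  ⋃ A : Set (Fin 2), extremePoints ℝ (optimalRegion u A)

/-- Paths of (belief, message) pairs at the times `1, 2, 3, …`: the pair at time `t + 1` is `ω t`. -/
abbrev Path : Type := ℕ → unitInterval × ℝ

/-- The belief at time `t`; at time `0` it is the prior. -/
def belief (μ₀ : unitInterval) : ℕ → Path → unitInterval
  | 0, _ => μ₀
  | t + 1, ω => (ω t).1

/-- The message at time `t`; there is none at time `0`, where the value is immaterial. -/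
def message : ℕ → Path → ℝ
  | 0, _ => 0
  | t + 1, ω => (ω t).2

/-- The natural filtration: at time `t` the pairs at the times `1, …, t` are known. -/
def history : Filtration ℕ (inferInstance : MeasurableSpace Path) where
  seq t := ⨆ k : ℕ, ⨆ _ : k < t, MeasurableSpace.comap (fun ω : Path => ω k) inferInstance
  mono' _ _ hst := iSup_mono fun _ => iSup_le fun hk =>
    le_iSup_of_le (lt_of_lt_of_le hk hst) le_rfl
  le' _ := iSup_le fun k => iSup_le fun _ => (measurable_pi_apply k).comap_le

/-- A dynamic information structure with prior `μ₀`: a law of paths of (belief, message) pairs under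
which the beliefs are a martingale for the natural filtration. -/
structure InfoStructure (μ₀ : unitInterval) where
  law : Measure Path
  isProb : IsProbabilityMeasure law
  martingale : Martingale (fun t ω => (belief μ₀ t ω : ℝ)) history law

/-- The stopping time `τ` as a natural number (only used where it is finite). -/
def time (τ : Path → WithTop ℕ) (ω : Path) : ℕ := (τ ω).untopD 0

/-- The belief at which the DM stops. -/
def stopBelief (μ₀ : unitInterval) (τ : Path → WithTop ℕ) (ω : Path) : ℝ :=
  belief μ₀ (time τ ω) ω

/-- The DM's payoff `max_a E[u(a,θ)] - c τ`, with the stopping belief and the stopping time. -/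
def dmPayoff (u : Fin 2 → Fin 2 → ℝ) (c : ℝ) (μ₀ : unitInterval) (τ : Path → WithTop ℕ)
    (ω : Path) : ℝ :=
  indirectUtility u (stopBelief μ₀ τ ω) - c * (time τ ω : ℝ)

/-- The DM's expected payoff from `τ`. -/
noncomputable def dmValue (u : Fin 2 → Fin 2 → ℝ) (c : ℝ) {μ₀ : unitInterval}
    (I : InfoStructure μ₀) (τ : Path → WithTop ℕ) : ℝ :=
  ∫ ω, dmPayoff u c μ₀ τ ω ∂I.law

/-- The stopping times available to a DM who has waited until time `s`. Those with infinite mean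
have expected payoff `-∞` and are left out. -/
structure IsStrategyFrom {μ₀ : unitInterval} (I : InfoStructure μ₀) (s : ℕ)
    (τ : Path → WithTop ℕ) : Prop where
  stopping : IsStoppingTime history τ
  ge : ∀ ω, (s : WithTop ℕ) ≤ τ ω
  finite : ∀ᵐ ω ∂I.law, τ ω ≠ ⊤
  integrable : Integrable (fun ω => (time τ ω : ℝ)) I.law

/-- `τ` is the DM's optimal stopping time from time `s` on, indifferences being broken in favour of
not stopping: it is optimal, and no other optimal stopping time is ever later. -/
structure IsBestResponseFrom (u : Fin 2 → Fin 2 → ℝ) (c : ℝ) {μ₀ : unitInterval}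
    (I : InfoStructure μ₀) (s : ℕ) (τ : Path → WithTop ℕ) : Prop where
  strategy : IsStrategyFrom I s τ
  optimal : ∀ σ, IsStrategyFrom I s σ → dmValue u c I σ ≤ dmValue u c I τ
  latest : ∀ σ, IsStrategyFrom I s σ → dmValue u c I σ = dmValue u c I τ → σ ≤ᵐ[I.law] τ

/-- `τ` is the stopping time `τ(I)` that the structure `I` induces. -/
abbrev Induces (u : Fin 2 → Fin 2 → ℝ) (c : ℝ) {μ₀ : unitInterval}
    (I : InfoStructure μ₀) (τ : Path → WithTop ℕ) : Prop :=
  IsBestResponseFrom u c I 0 τ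

/-- The DM pays attention: she does not stop at time `0`. -/
def PaysAttention {μ₀ : unitInterval} (I : InfoStructure μ₀) (τ : Path → WithTop ℕ) : Prop :=
  ∀ᵐ ω ∂I.law, τ ω ≠ 0

/-- The designer's payoff `f(a_τ, τ)`. -/
noncomputable def designerPayoff (u : Fin 2 → Fin 2 → ℝ) (f : Fin 2 → ℕ → ℝ) (μ₀ : unitInterval)
    (τ : Path → WithTop ℕ) (ω : Path) : ℝ :=
  f (bestAction u (stopBelief μ₀ τ ω)) (time τ ω)

/-- The designer's expected payoff. -/
noncomputable def designerValue (u : Fin 2 → Fin 2 → ℝ) (f : Fin 2 → ℕ → ℝ) {μ₀ : unitInterval}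
    (I : InfoStructure μ₀) (τ : Path → WithTop ℕ) : ℝ :=
  ∫ ω, designerPayoff u f μ₀ τ ω ∂I.law

/-- The message `C` ("continue"). -/
def msgC : ℝ := 0

/-- The message `S` ("stop"). -/
def msgS : ℝ := 1

/-- Extremal and obedient structures: the messages are `C` and `S`; beliefs that come with `S` are
extremal, those that come with `C` follow one deterministic path; and at each time `s ≥ 1` the DM
who has waited until then stops at once after `S` and continues after `C`. -/
structure IsExtremalObedient (u : Fin 2 → Fin 2 → ℝ) (c : ℝ) {μ₀ : unitInterval}
    (I : InfoStructure μ₀) : Prop where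
  extremal : ∃ μC : ℕ → unitInterval, ∀ᵐ ω ∂I.law, ∀ t : ℕ, 1 ≤ t →
    (message t ω = msgS ∧ (belief μ₀ t ω : ℝ) ∈ extremalBeliefs u) ∨
      (message t ω = msgC ∧ belief μ₀ t ω = μC t)
  obedient : ∀ s : ℕ, 1 ≤ s → ∃ σ, IsBestResponseFrom u c I s σ ∧
    ∀ᵐ ω ∂I.law, (message s ω = msgS → σ ω = s) ∧ (message s ω = msgC → (s : WithTop ℕ) < σ ω)

/-- `p_{x,t}`: the probability that the DM stops at time `t` with belief `x`. -/
noncomputable def stopProb {μ₀ : unitInterval} (I : InfoStructure μ₀) (τ : Path → WithTop ℕ)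
    (x : ℝ) (t : ℕ) : ℝ :=
  I.law.real {ω | τ ω = t ∧ (belief μ₀ t ω : ℝ) = x}

/-- `T` is the terminal time: the first time beyond which the DM never waits. -/
def IsTerminalTime {μ₀ : unitInterval} (I : InfoStructure μ₀) (τ : Path → WithTop ℕ)
    (T : ℕ) : Prop :=
  IsLeast {T : ℕ | I.law {ω | (T : WithTop ℕ) < τ ω} = 0} T

/-- The DM who has not stopped by time `t` is indifferent, at time `t`, between stopping and
continuing (optimally, that is, until `τ`). -/
def IndifferentAt (u : Fin 2 → Fin 2 → ℝ) (c : ℝ) {μ₀ : unitInterval}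
    (I : InfoStructure μ₀) (τ : Path → WithTop ℕ) (t : ℕ) : Prop :=
  ∀ᵐ ω ∂I.law, (t : WithTop ℕ) < τ ω →
    (I.law[dmPayoff u c μ₀ τ | history t]) ω = indirectUtility u (belief μ₀ t ω) - c * (t : ℝ)

/-- Stopping signals are fully revealing (`x` is the belief of indifference between actions). -/
def FullyRevealing {μ₀ : unitInterval} (I : InfoStructure μ₀) (τ : Path → WithTop ℕ)
    (x : ℝ) : Prop :=
  ∀ t, stopProb I τ x t = 0

/-- Pure bad news: there is a terminal time, before it the DM stops only with belief `0`, and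
whenever she does so with positive probability, she is indifferent if the bad news does not come. -/
def PureBadNews (u : Fin 2 → Fin 2 → ℝ) (c : ℝ) {μ₀ : unitInterval}
    (I : InfoStructure μ₀) (τ : Path → WithTop ℕ) (x : ℝ) : Prop :=
  ∃! T : ℕ, IsTerminalTime I τ T ∧
    (∀ t < T, stopProb I τ x t = 0 ∧ stopProb I τ 1 t = 0) ∧
    (∀ t < T, 0 < stopProb I τ 0 t → IndifferentAt u c I τ t)

end AttentionCapture

/-! Let `A t` and `Q t` be the probabilities of stopping after time `t` with belief `0`,
respectively with belief `x` or `1`, where `x` is the belief of indifference between the actions.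
These two tails carry the whole problem. A stopping belief below `x` can be split into `0` and `x`,
one above `x` into `x` and `1`. This keeps the mean, and also the DM's expected utility, because
`indirectUtility` is affine on either side of `x`. Action `1` only becomes more frequent, so the
designer does not lose.

Let `D` be the part of `Q` that stops with belief `1`, and `R t` the sum of `A s + Q s` over `s ≥
t`, the expected waiting time beyond `t`. Compared with taking action `1` at once, information pays
only at belief `0`; compared with action `0`, only at belief `1`. So waiting at `t` is worthwhile
iff `R t ≤ α * A t` and `R t ≤ β * D t`, with `α`, `β` the losses from a wrong action divided by
`c`. The mean of the beliefs forces `β * D 0 = α * A 0 + δ`. The designer's payoff involves only `A`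
and `Q`, so `D` may be taken as large as possible, `D t = min (D 0) (Q t)`: belief `1` comes after
belief `x`. What remains are the linear constraints of `TailFeasible`. They are necessary by
`Induces.tailFeasible` and `Induces.designerValue_le`, and sufficient by
`TailFeasible.exists_infoStructure`.

The feasible set is compact, and the payoff is continuous on it by `exists_dominating`. In
`exists_optimal_tailFeasible` a maximizer is chosen that, among the maximizers, stops with the upper
kind as late as possible in a weighted sense, and that is not the midpoint of a feasible segment. If
`A 0 = 1 - μ₀`, then `D = Q`: belief `x` never occurs and stopping is fully revealing. Otherwise `R
0 < β * Q 0`. Then upper stopping at `r + 1` followed by lower stopping needs `R (r + 1) = α * A (r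
+ 1)`, since otherwise the two could be exchanged a little, which supermodularity allows
(`TailFeasible.shift`). But at the first upper stopping a binding constraint lets everything later
be scaled up and down (`TailFeasible.eventually_scale`). Hence the first upper stopping ends the
process. Lower stopping before the end at a slack constraint would again allow a two-sided move
(`TailFeasible.eventually_move`). This is pure bad news.

Without attention the payoff is always `f (bestAction u μ₀) 0`; the unrestricted optimum is found by
comparison with it. -/

namespace AttentionCapture

open Filter Topology

/-! ### Extreme points among lexicographic maximizers -/

/-- Among the points of a compact set that maximize `J₁`, and among these maximize `J₂`, there is one
that is not the midpoint of a segment in the set. -/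
lemma exists_lexMax_extreme {E : Type*} [AddCommGroup E] [Module ℝ E] [TopologicalSpace E]
    [T2Space E] [IsTopologicalAddGroup E] [ContinuousSMul ℝ E] [LocallyConvexSpace ℝ E] {K : Set E}
    (hK : IsCompact K) (hne : K.Nonempty) {J₁ J₂ : E → ℝ} (c₁ : ContinuousOn J₁ K)
    (c₂ : ContinuousOn J₂ K)
    (h₁ : ∀ p v, p ∈ K → p + v ∈ K → p - v ∈ K → J₁ (p + v) + J₁ (p - v) = 2 * J₁ p)
    (h₂ : ∀ p v, p ∈ K → p + v ∈ K → p - v ∈ K → J₂ (p + v) + J₂ (p - v) = 2 * J₂ p) :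
    ∃ p ∈ K, (∀ q ∈ K, J₁ q ≤ J₁ p) ∧ (∀ q ∈ K, J₁ q = J₁ p → J₂ q ≤ J₂ p) ∧
      ∀ v, p + v ∈ K → p - v ∈ K → v = 0 := by
  obtain ⟨a, haK, ha⟩ := hK.exists_isMaxOn hne c₁
  have hK₁ : IsCompact (K ∩ J₁ ⁻¹' {J₁ a}) :=
    hK.of_isClosed_subset (c₁.preimage_isClosed_of_isClosed hK.isClosed isClosed_singleton)
      inter_subset_left
  obtain ⟨b, hbK, hb⟩ := hK₁.exists_isMaxOn ⟨a, haK, rfl⟩ (c₂.mono inter_subset_left)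
  have hK₂ : IsCompact ((K ∩ J₁ ⁻¹' {J₁ a}) ∩ J₂ ⁻¹' {J₂ b}) :=
    hK₁.of_isClosed_subset ((c₂.mono inter_subset_left).preimage_isClosed_of_isClosed
      hK₁.isClosed isClosed_singleton) inter_subset_left
  obtain ⟨p, hp⟩ := hK₂.extremePoints_nonempty ⟨b, hbK, rfl⟩
  obtain ⟨⟨⟨hpK, hp₁⟩, hp₂⟩, hext⟩ := hp
  have hp₁' : J₁ p = J₁ a := hp₁
  have hp₂' : J₂ p = J₂ b := hp₂
  have hmax₁ : ∀ q ∈ K, J₁ q ≤ J₁ p := fun q hq => hp₁'.symm ▸ ha hq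
  have hmax₂ : ∀ q ∈ K, J₁ q = J₁ p → J₂ q ≤ J₂ p := fun q hq h =>
    hp₂'.symm ▸ hb ⟨hq, h.trans hp₁'⟩
  refine ⟨p, hpK, hmax₁, hmax₂, fun v hv hv' => ?_⟩
  have e₁ := h₁ p v hpK hv hv'
  have e₂ := h₂ p v hpK hv hv'
  have a₁ := hmax₁ _ hv
  have a₂ := hmax₁ _ hv'
  -- The values of `J₁` at `p + v` and `p - v` average to the maximum and do not exceed it, so both
  -- equal it. The same argument then applies to `J₂`.
  have b₁ := hmax₂ _ hv (by linarith)
  have b₂ := hmax₂ _ hv' (by linarith)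
  have := @hext (p + v) ⟨⟨hv, show J₁ _ = _ by linarith⟩, show J₂ _ = _ by linarith⟩ (p - v)
    ⟨⟨hv', show J₁ _ = _ by linarith⟩, show J₂ _ = _ by linarith⟩
    ⟨1 / 2, 1 / 2, by norm_num, by norm_num, by norm_num, by
      rw [← smul_add]; rw [show p + v + (p - v) = (2 : ℝ) • p by rw [two_smul]; abel, smul_smul]
      norm_num⟩
  simpa using this

/-! ### Feasible tails: compactness and continuity of the payoff -/

/-- The feasible pairs of tails: `A t` and `Q t` are the probabilities of stopping after time `t`
with a belief of the lower and of the upper kind. The bounds on partial sums say that the expected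
remaining waiting time does not exceed what either kind of stopping is worth. -/
structure TailFeasible (α β δ M : ℝ) (A Q : ℕ → ℝ) : Prop where
  antitone_fst : Antitone A
  antitone_snd : Antitone Q
  nonneg_fst : ∀ t, 0 ≤ A t
  nonneg_snd : ∀ t, 0 ≤ Q t
  total : A 0 + Q 0 = 1
  le : A 0 ≤ M
  sum_le_fst : ∀ t n, ∑ s ∈ Finset.range n, (A (t + s) + Q (t + s)) ≤ α * A t
  sum_le_snd : ∀ t n, ∑ s ∈ Finset.range n, (A (t + s) + Q (t + s)) ≤ β * Q t
  sum_le_prior : ∀ n, ∑ s ∈ Finset.range n, (A s + Q s) ≤ α * A 0 + δ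

/-- `R t` is the sum of `A s + Q s` over `s ≥ t`. -/
structure IsTail (A Q R : ℕ → ℝ) : Prop where
  rec_eq : ∀ t, R t = A t + Q t + R (t + 1)
  tendsto : Tendsto R atTop (𝓝 0)

namespace IsTail

variable {A Q R : ℕ → ℝ}

lemma sum_range_eq (hrec : ∀ t, R t = A t + Q t + R (t + 1)) (t n : ℕ) :
    ∑ s ∈ Finset.range n, (A (t + s) + Q (t + s)) = R t - R (t + n) := by
  induction n with
  | zero => simp
  | succ n ih => rw [Finset.sum_range_succ, ih]; have := hrec (t + n); rw [← add_assoc t n 1]; linarith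

lemma hasSum (h : IsTail A Q R) (hA : ∀ t, 0 ≤ A t) (hQ : ∀ t, 0 ≤ Q t) (t : ℕ) :
    HasSum (fun s => A (t + s) + Q (t + s)) (R t) := by
  rw [hasSum_iff_tendsto_nat_of_nonneg fun s => add_nonneg (hA _) (hQ _)]
  simp_rw [sum_range_eq h.rec_eq]
  have : Tendsto (fun n => R (t + n)) atTop (𝓝 0) :=
    h.tendsto.comp (tendsto_atTop_mono (fun n => Nat.le_add_left n t) tendsto_id)
  simpa using tendsto_const_nhds (x := R t).sub this

lemma nonneg (h : IsTail A Q R) (hA : ∀ t, 0 ≤ A t) (hQ : ∀ t, 0 ≤ Q t) (t : ℕ) : 0 ≤ R t :=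
  (h.hasSum hA hQ t).nonneg fun _ => add_nonneg (hA _) (hQ _)

lemma antitone (h : IsTail A Q R) (hA : ∀ t, 0 ≤ A t) (hQ : ∀ t, 0 ≤ Q t) : Antitone R :=
  antitone_nat_of_succ_le fun t => by linarith [h.rec_eq t, hA t, hQ t]

end IsTail

namespace TailFeasible

variable {α β δ M : ℝ} {A Q : ℕ → ℝ}

/-- Feasibility can be checked by exhibiting a nonnegative solution `R` of the recursion: partial
sums telescope to `R t - R (t + n)`. That `R` tends to `0` is not needed. -/
lemma of_tail {R : ℕ → ℝ} (hA : Antitone A) (hQ : Antitone Q) (hA0 : ∀ t, 0 ≤ A t)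
    (hQ0 : ∀ t, 0 ≤ Q t) (htot : A 0 + Q 0 = 1) (hM : A 0 ≤ M)
    (hrec : ∀ t, R t = A t + Q t + R (t + 1)) (hR : ∀ t, 0 ≤ R t) (hRA : ∀ t, R t ≤ α * A t)
    (hRQ : ∀ t, R t ≤ β * Q t) (hR0 : R 0 ≤ α * A 0 + δ) : TailFeasible α β δ M A Q where
  antitone_fst := hA
  antitone_snd := hQ
  nonneg_fst := hA0
  nonneg_snd := hQ0
  total := htot
  le := hM
  sum_le_fst t n := by rw [IsTail.sum_range_eq hrec]; linarith [hR (t + n), hRA t]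
  sum_le_snd t n := by rw [IsTail.sum_range_eq hrec]; linarith [hR (t + n), hRQ t]
  sum_le_prior n := by
    have := IsTail.sum_range_eq hrec 0 n
    simp only [zero_add] at this
    rw [this]; linarith [hR n]

lemma exists_tail (h : TailFeasible α β δ M A Q) : ∃ R, IsTail A Q R ∧ (∀ t, R t ≤ α * A t) ∧
    (∀ t, R t ≤ β * Q t) ∧ R 0 ≤ α * A 0 + δ := by
  have hnn : ∀ t, 0 ≤ A t + Q t := fun t => add_nonneg (h.nonneg_fst t) (h.nonneg_snd t)
  have hs : Summable fun s => A s + Q s :=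
    summable_of_sum_range_le hnn fun n => h.sum_le_prior n
  have hst : ∀ t, Summable fun s => A (t + s) + Q (t + s) := fun t => by
    have := (summable_nat_add_iff t).2 hs
    simpa only [add_comm] using this
  refine ⟨fun t => ∑' s, (A (t + s) + Q (t + s)), ⟨fun t => ?_, ?_⟩, fun t => ?_, fun t => ?_, ?_⟩
  · rw [(hst t).tsum_eq_zero_add]
    simp only [add_zero]
    congr 1
    exact tsum_congr fun s => by rw [show t + (s + 1) = t + 1 + s by ring]
  · have := tendsto_sum_nat_add fun s => A s + Q s
    simpa only [add_comm] using this
  · exact (hst t).tsum_le_of_sum_range_le (h.sum_le_fst t)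
  · exact (hst t).tsum_le_of_sum_range_le (h.sum_le_snd t)
  · exact (hst 0).tsum_le_of_sum_range_le (by simpa using h.sum_le_prior)

/-- Each condition, the bounds on partial sums included, is a closed condition on finitely many
coordinates; the tails lie in a product of unit intervals. -/
lemma isCompact_set : IsCompact {p : (ℕ → ℝ) × (ℕ → ℝ) | TailFeasible α β δ M p.1 p.2} := by
  have hbox : IsCompact ((univ.pi fun _ : ℕ => Icc (0 : ℝ) 1) ×ˢ (univ.pi fun _ : ℕ => Icc (0 : ℝ) 1)) :=
    (isCompact_univ_pi fun _ => isCompact_Icc).prod (isCompact_univ_pi fun _ => isCompact_Icc)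
  have heq : {p : (ℕ → ℝ) × (ℕ → ℝ) | TailFeasible α β δ M p.1 p.2} =
      {p | ∀ t, p.1 (t + 1) ≤ p.1 t} ∩ {p | ∀ t, p.2 (t + 1) ≤ p.2 t} ∩ {p | ∀ t, 0 ≤ p.1 t} ∩
      {p | ∀ t, 0 ≤ p.2 t} ∩ {p | p.1 0 + p.2 0 = 1} ∩ {p | p.1 0 ≤ M} ∩
      {p | ∀ t n, ∑ s ∈ Finset.range n, (p.1 (t + s) + p.2 (t + s)) ≤ α * p.1 t} ∩
      {p | ∀ t n, ∑ s ∈ Finset.range n, (p.1 (t + s) + p.2 (t + s)) ≤ β * p.2 t} ∩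
      {p | ∀ n, ∑ s ∈ Finset.range n, (p.1 s + p.2 s) ≤ α * p.1 0 + δ} := by
    ext p
    constructor
    · intro h
      exact ⟨⟨⟨⟨⟨⟨⟨⟨fun t => h.antitone_fst t.le_succ, fun t => h.antitone_snd t.le_succ⟩,
        h.nonneg_fst⟩, h.nonneg_snd⟩, h.total⟩, h.le⟩, h.sum_le_fst⟩, h.sum_le_snd⟩, h.sum_le_prior⟩
    · rintro ⟨⟨⟨⟨⟨⟨⟨⟨h1, h2⟩, h3⟩, h4⟩, h5⟩, h6⟩, h7⟩, h8⟩, h9⟩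
      exact ⟨antitone_nat_of_succ_le h1, antitone_nat_of_succ_le h2, h3, h4, h5, h6, h7, h8, h9⟩
  refine hbox.of_isClosed_subset ?_ fun p (h' : TailFeasible α β δ M p.1 p.2) => ?_
  · rw [heq]
    simp only [ofPred_forall]
    refine ((((((((?_ : IsClosed _).inter ?_).inter ?_).inter ?_).inter ?_).inter ?_).inter ?_).inter
      ?_).inter ?_
    · exact isClosed_iInter fun t => isClosed_le (by fun_prop) (by fun_prop)
    · exact isClosed_iInter fun t => isClosed_le (by fun_prop) (by fun_prop)
    · exact isClosed_iInter fun t => isClosed_le (by fun_prop) (by fun_prop)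
    · exact isClosed_iInter fun t => isClosed_le (by fun_prop) (by fun_prop)
    · exact isClosed_eq (by fun_prop) (by fun_prop)
    · exact isClosed_le (by fun_prop) (by fun_prop)
    · exact isClosed_iInter fun t => isClosed_iInter fun n => isClosed_le (by fun_prop) (by fun_prop)
    · exact isClosed_iInter fun t => isClosed_iInter fun n => isClosed_le (by fun_prop) (by fun_prop)
    · exact isClosed_iInter fun n => isClosed_le (by fun_prop) (by fun_prop)
  · have h1 := h'.total
    have h2 := h'.nonneg_fst 0
    have h3 := h'.nonneg_snd 0
    exact ⟨fun t _ => ⟨h'.nonneg_fst t, (h'.antitone_fst t.zero_le).trans (by linarith)⟩,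
      fun t _ => ⟨h'.nonneg_snd t, (h'.antitone_snd t.zero_le).trans (by linarith)⟩⟩

end TailFeasible

/-- The payoff of a pair of tails if stopping at time `t + 1` with a belief of the lower or upper
kind yields `F₀ t` or `F₁ t`. -/
noncomputable def tailPayoff (F₀ F₁ : ℕ → ℝ) (A Q : ℕ → ℝ) : ℝ :=
  ∑' t, ((A t - A (t + 1)) * F₀ t + (Q t - Q (t + 1)) * F₁ t)

section Payoff

variable {α β δ M : ℝ} {F₀ F₁ w : ℕ → ℝ}

lemma TailFeasible.norm_term_le {A Q : ℕ → ℝ} (h : TailFeasible α β δ M A Q)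
    (hw : ∀ t, A t + Q t ≤ w t) (t : ℕ) :
    ‖(A t - A (t + 1)) * F₀ t + (Q t - Q (t + 1)) * F₁ t‖ ≤ w t * |F₀ t| + w t * |F₁ t| := by
  have a1 := h.antitone_fst t.le_succ
  have a2 := h.antitone_snd t.le_succ
  have a3 := h.nonneg_fst (t + 1)
  have a4 := h.nonneg_snd (t + 1)
  have a5 := hw t
  refine (norm_add_le _ _).trans ?_
  rw [norm_mul, norm_mul, Real.norm_eq_abs, Real.norm_eq_abs, Real.norm_eq_abs, Real.norm_eq_abs,
    abs_of_nonneg (sub_nonneg.2 a1), abs_of_nonneg (sub_nonneg.2 a2)]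
  simp only [Nat.succ_eq_add_one] at a1 a2
  gcongr <;> linarith

lemma TailFeasible.summable_term {A Q : ℕ → ℝ} (h : TailFeasible α β δ M A Q)
    (hw : ∀ t, A t + Q t ≤ w t) (h₀ : Summable fun t => w t * |F₀ t|)
    (h₁ : Summable fun t => w t * |F₁ t|) :
    Summable fun t => (A t - A (t + 1)) * F₀ t + (Q t - Q (t + 1)) * F₁ t :=
  Summable.of_norm_bounded (h₀.add h₁) (h.norm_term_le hw)

/-- Weierstrass M-test: the common dominating sequence `w` makes the series converge uniformly on
the feasible set. -/
lemma continuousOn_tailPayoff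
    (hw : ∀ A Q, TailFeasible α β δ M A Q → ∀ t, A t + Q t ≤ w t)
    (h₀ : Summable fun t => w t * |F₀ t|) (h₁ : Summable fun t => w t * |F₁ t|) :
    ContinuousOn (fun p : (ℕ → ℝ) × (ℕ → ℝ) => tailPayoff F₀ F₁ p.1 p.2)
      {p | TailFeasible α β δ M p.1 p.2} :=
  continuousOn_tsum (fun t => by fun_prop) (h₀.add h₁)
    fun t p hp => TailFeasible.norm_term_le hp (hw _ _ hp) t

lemma tailPayoff_add_sub {A Q a q : ℕ → ℝ}
    (hw : ∀ A Q, TailFeasible α β δ M A Q → ∀ t, A t + Q t ≤ w t)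
    (h₀ : Summable fun t => w t * |F₀ t|) (h₁ : Summable fun t => w t * |F₁ t|)
    (hp : TailFeasible α β δ M (A + a) (Q + q))
    (hm : TailFeasible α β δ M (A - a) (Q - q)) :
    tailPayoff F₀ F₁ (A + a) (Q + q) + tailPayoff F₀ F₁ (A - a) (Q - q)
      = 2 * tailPayoff F₀ F₁ A Q := by
  unfold tailPayoff
  rw [← (hp.summable_term (hw _ _ hp) h₀ h₁).tsum_add (hm.summable_term (hw _ _ hm) h₀ h₁),
    ← tsum_mul_left]
  exact tsum_congr fun t => by simp only [Pi.add_apply, Pi.sub_apply]; ring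

end Payoff

/-! ### Perturbations of feasible tails -/

lemma eventually_nonneg_add_mul {a : ℝ} (ha : 0 < a) (b : ℝ) :
    ∀ᶠ ε in 𝓝 (0 : ℝ), 0 ≤ a + ε * b := by
  have : Tendsto (fun ε : ℝ => a + ε * b) (𝓝 0) (𝓝 (a + 0 * b)) :=
    Continuous.tendsto (by fun_prop) 0
  rw [zero_mul, add_zero] at this
  exact (this.eventually_const_lt ha).mono fun _ h => h.le

/-- A point that is not the midpoint of a segment in `K` cannot be moved both ways along a line. -/
lemma eq_zero_of_eventually_mem {E : Type*} [AddCommGroup E] [Module ℝ E] {K : Set E} {p v : E}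
    (hext : ∀ v, p + v ∈ K → p - v ∈ K → v = 0) (h : ∀ᶠ ε in 𝓝 (0 : ℝ), p + ε • v ∈ K) : v = 0 := by
  have hneg : ∀ᶠ ε in 𝓝 (0 : ℝ), p + (-ε) • v ∈ K := by
    have : Tendsto (fun ε : ℝ => -ε) (𝓝 0) (𝓝 0) := by simpa using (continuous_neg (G := ℝ)).tendsto 0
    exact this.eventually h
  obtain ⟨ε, ⟨h1, h2⟩, hε⟩ := (((h.and hneg).filter_mono nhdsWithin_le_nhds).and
    (eventually_mem_nhdsWithin : ∀ᶠ ε in 𝓝[≠] (0 : ℝ), ε ∈ ({0}ᶜ : Set ℝ))).exists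
  have := hext (ε • v) h1 (by rwa [neg_smul, ← sub_eq_add_neg] at h2)
  exact (smul_eq_zero.1 this).resolve_left hε

section Shift

variable {α β δ M : ℝ} {A Q R : ℕ → ℝ}

/-- Probability `ε` of stopping with the lower kind is moved from time `s + 1` to time `r + 1`,
and the same probability of stopping with the upper kind is moved back. -/
lemma TailFeasible.shift (h : TailFeasible α β δ M A Q) (hR : IsTail A Q R)
    (hRA : ∀ t, R t ≤ α * A t) (hRQ : ∀ t, R t ≤ β * Q t) (hR0 : R 0 ≤ α * A 0 + δ) (hα : 0 < α)
    (hβ : 0 < β) {r s : ℕ} (hconst : ∀ t, r < t → t ≤ s → A t = A (r + 1)) {ε : ℝ} (hε : 0 ≤ ε)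
    (h1 : ε ≤ Q r - Q (r + 1)) (h2 : ε ≤ A s - A (s + 1)) (h3 : α * ε ≤ α * A (r + 1) - R (r + 1)) :
    TailFeasible α β δ M (fun t => A t - if r < t ∧ t ≤ s then ε else 0)
      (fun t => Q t + if r < t ∧ t ≤ s then ε else 0) := by
  have hRn := hR.nonneg h.nonneg_fst h.nonneg_snd
  have hRanti := hR.antitone h.nonneg_fst h.nonneg_snd
  have hb : ∀ t, 0 ≤ (if r < t ∧ t ≤ s then ε else 0) := fun t => by split_ifs <;> simp [hε]
  -- Between `r` and `s` the tail `A` is constant and `R` decreases, so the slack is smallest at `r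
  -- + 1`, where `h3` bounds `ε`.
  have hkey : ∀ t, R t ≤ α * (A t - if r < t ∧ t ≤ s then ε else 0) := fun t => by
    split_ifs with ht
    · have := hRanti (show r + 1 ≤ t from ht.1)
      rw [hconst t ht.1 ht.2]; linarith
    · simpa using hRA t
  -- The exchange leaves `A + Q` unchanged at every time, hence `R` too.
  refine TailFeasible.of_tail (R := R) (antitone_nat_of_succ_le fun t => ?_)
    (antitone_nat_of_succ_le fun t => ?_) (fun t => ?_) (fun t => ?_) ?_ ?_ (fun t => ?_) hRn hkey
    (fun t => ?_) ?_
  · have := h.antitone_fst t.le_succ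
    simp only [Nat.succ_eq_add_one] at this
    by_cases ht : t = s
    · subst ht; have := hb t; split_ifs at * <;> first | omega | linarith
    · split_ifs <;> first | omega | linarith
  · have := h.antitone_snd t.le_succ
    simp only [Nat.succ_eq_add_one] at this
    by_cases ht : t = r
    · subst ht; split_ifs at * <;> first | omega | linarith
    · split_ifs <;> first | omega | linarith
  · have h1 := hkey t
    exact nonneg_of_mul_nonneg_right ((hRn t).trans h1) hα
  · exact add_nonneg (h.nonneg_snd t) (hb t)
  · simpa using h.total
  · simpa using h.le
  · rw [hR.rec_eq t]; ring
  · exact (hRQ t).trans (mul_le_mul_of_nonneg_left (by linarith [hb t]) hβ.le)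
  · simpa using hR0

lemma tailPayoff_shift {F₀ F₁ : ℕ → ℝ} {r s : ℕ} (hrs : r < s) (ε : ℝ)
    (hs : Summable fun t => (A t - A (t + 1)) * F₀ t + (Q t - Q (t + 1)) * F₁ t) :
    tailPayoff F₀ F₁ (fun t => A t - if r < t ∧ t ≤ s then ε else 0)
      (fun t => Q t + if r < t ∧ t ≤ s then ε else 0)
      = tailPayoff F₀ F₁ A Q + ε * ((F₁ s - F₀ s) - (F₁ r - F₀ r)) := by
  have e1 := hasSum_ite_eq s (ε * (F₁ s - F₀ s))
  have e2 := hasSum_ite_eq r (ε * (F₁ r - F₀ r))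
  have e := (hs.hasSum.add (e1.sub e2)).tsum_eq
  unfold tailPayoff
  rw [show ε * ((F₁ s - F₀ s) - (F₁ r - F₀ r)) = ε * (F₁ s - F₀ s) - ε * (F₁ r - F₀ r) by ring, ← e]
  refine tsum_congr fun t => ?_
  by_cases h1 : t = s
  · subst h1
    simp [hrs, hrs.ne']
    ring
  · by_cases h2 : t = r
    · subst h2
      have : t + 1 ≤ s := hrs
      simp [h1, this]
      ring
    · have : (r < t ∧ t ≤ s) ↔ (r < t + 1 ∧ t + 1 ≤ s) := by omega
      simp only [this, h1, h2, if_false]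
      ring

end Shift

section Perturb

variable {α β δ M : ℝ} {A Q R : ℕ → ℝ}

/-- At a time `r + 1` with a binding constraint, the tail can be scaled up or down. -/
lemma TailFeasible.eventually_scale (h : TailFeasible α β δ M A Q) (hR : IsTail A Q R)
    (hRA : ∀ t, R t ≤ α * A t) (hRQ : ∀ t, R t ≤ β * Q t) (hR0 : R 0 ≤ α * A 0 + δ)
    (hAM : A 0 < M) (hslack : R 0 < β * Q 0) {r : ℕ} (hconst : ∀ t ≤ r, Q t = Q 0)
    (hdrop : Q (r + 1) < Q r) (hbind : R (r + 1) = α * A (r + 1)) :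
    ∀ᶠ ε in 𝓝 (0 : ℝ), TailFeasible α β δ M (A + ε • fun t => A (max t (r + 1)))
      (Q + ε • fun t => if t ≤ r then -A (r + 1) else Q t) := by
  have hRn := hR.nonneg h.nonneg_fst h.nonneg_snd
  have hRanti := hR.antitone h.nonneg_fst h.nonneg_snd
  filter_upwards [eventually_nonneg_add_mul one_pos 1, eventually_nonneg_add_mul (sub_pos.2 hdrop) (-A (r + 1) - Q (r + 1)),
    eventually_nonneg_add_mul (sub_pos.2 hslack) (-(β * A (r + 1)) - R (r + 1)),
    eventually_nonneg_add_mul (sub_pos.2 hAM) (-A (r + 1))] with ε h1 h2 h3 h4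
  rw [mul_one] at h1
  have hQanti : Antitone (Q + ε • fun t => if t ≤ r then -A (r + 1) else Q t) := by
    refine antitone_nat_of_succ_le fun t => ?_
    have hq := h.antitone_snd t.le_succ
    simp only [Nat.succ_eq_add_one] at hq
    simp only [Pi.add_apply, Pi.smul_apply, smul_eq_mul]
    rcases lt_trichotomy t r with ht | ht | ht
    · rw [if_pos (by omega), if_pos (by omega)]; linarith
    · subst ht; rw [if_neg (by omega), if_pos (by omega)]; linarith
    · rw [if_neg (by omega), if_neg (by omega)]
      nlinarith
  have hmax : ∀ t, r < t → max t (r + 1) = t := fun t ht => max_eq_left (by omega)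
  have hmax' : ∀ t, t ≤ r → max t (r + 1) = r + 1 := fun t ht => max_eq_right (by omega)
  -- Up to time `r` the sum `A + Q` is unchanged, so `R` moves by the constant `ε * R (r + 1)`. By
  -- `hbind` this is `α` times the change of `A`, so the lower constraints survive for either sign
  -- of `ε`. From `r + 1` on everything is multiplied by `1 + ε`.
  refine TailFeasible.of_tail (R := R + ε • fun t => R (max t (r + 1)))
    (antitone_nat_of_succ_le fun t => ?_) hQanti (fun t => ?_) (fun t => ?_) ?_ ?_ (fun t => ?_)
    (fun t => ?_) (fun t => ?_) (fun t => ?_) ?_ <;>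
    simp only [Pi.add_apply, Pi.smul_apply, smul_eq_mul]
  · have hq := h.antitone_fst t.le_succ
    simp only [Nat.succ_eq_add_one] at hq
    rcases le_or_gt (t + 1) (r + 1) with ht | ht
    · rw [hmax' t (by omega), max_eq_right ht]; linarith
    · rw [hmax t (by omega), hmax (t + 1) (by omega)]; nlinarith
  · have hq := h.antitone_fst (le_max_left t (r + 1))
    nlinarith [h.nonneg_fst (max t (r + 1))]
  · have hlarge : ∀ t, r < t → 0 ≤ (Q + ε • fun t => if t ≤ r then -A (r + 1) else Q t) t := by
      intro t ht
      simp only [Pi.add_apply, Pi.smul_apply, smul_eq_mul]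
      rw [if_neg (by omega)]
      nlinarith [h.nonneg_snd t]
    exact (hlarge (max t (r + 1)) (by omega)).trans (hQanti (le_max_left _ _))
  · rw [hmax' 0 (by omega), if_pos (by omega)]; linarith [h.total]
  · rw [hmax' 0 (by omega)]; linarith
  · have hrec := hR.rec_eq t
    rcases lt_trichotomy t r with ht | ht | ht
    · rw [hmax' t (by omega), hmax' (t + 1) (by omega), if_pos (by omega)]; linarith
    · subst ht; rw [hmax' t le_rfl, max_self, if_pos le_rfl]; linarith
    · rw [hmax t (by omega), hmax (t + 1) (by omega), if_neg (by omega)]; linear_combination (1 + ε) * hrec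
  · have hq := hRanti (le_max_left t (r + 1))
    nlinarith [hRn (max t (r + 1))]
  · have := hRA t
    rcases le_or_gt t r with ht | ht
    · rw [hmax' t ht, hbind]; linarith
    · rw [hmax t ht]; nlinarith
  · have := hRQ t
    rcases le_or_gt t r with ht | ht
    · rw [hmax' t ht, if_pos ht, hconst t ht]; linarith [hRanti t.zero_le]
    · rw [hmax t ht, if_neg (by omega)]; nlinarith
  · rw [hmax' 0 (by omega), hbind]; linarith

/-- If stopping with the upper kind happens at time `T` only, and the lower kind occurs at a time
`t` with a slack constraint, then the tails can be moved both ways; here `s` is the first time after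
`t` at which the constraint binds. -/
lemma TailFeasible.eventually_move (h : TailFeasible α β δ M A Q) (hR : IsTail A Q R)
    (hα : 0 < α) (hRA : ∀ t, R t ≤ α * A t) (hRQ : ∀ t, R t ≤ β * Q t) (hR0 : R 0 ≤ α * A 0 + δ)
    (hAM : A 0 < M) (hslack : R 0 < β * Q 0) {T t s : ℕ} (hQT : ∀ r < T, Q r = Q 0)
    (hts : t < s) (hsT : s < T) (hdrop : A (t + 1) < A t)
    (hbind : R (s + 1) = α * A (s + 1)) (hnb : ∀ r, t < r → r ≤ s → R r < α * A r)
    {e : ℝ} (he : e * (s - t : ℝ) = α * Q 0 + R (s + 1)) :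
    ∀ᶠ ε in 𝓝 (0 : ℝ), TailFeasible α β δ M
      (A + ε • fun r => if r ≤ t then Q 0 else if r ≤ s then Q 0 + e else -A r)
      (Q + ε • -Q) := by
  have hRn := hR.nonneg h.nonneg_fst h.nonneg_snd
  have hAn := h.nonneg_fst
  have hRanti := hR.antitone h.nonneg_fst h.nonneg_snd
  -- The upper tail, and after `s` also the lower one, is scaled by `1 - ε`. Up to `t` the lower
  -- tail gains what the upper one loses, so the total stays `1`. The extra `e` between `t` and `s`
  -- is such that `R` changes by `ε * (α * Q 0)` up to `t`, exactly `α` times the change of `A`.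
  set vA : ℕ → ℝ := fun r => if r ≤ t then Q 0 else if r ≤ s then Q 0 + e else -A r with hvA
  set vR : ℕ → ℝ := fun r => if r ≤ t then α * Q 0 else
    if r ≤ s then e * (s + 1 - r : ℝ) - R (s + 1) else -R r with hvR
  have hts' : (t : ℝ) < s := by exact_mod_cast hts
  -- The constraint is slack at `s` and binds at `s + 1` while `R` decreases, so `A` drops there;
  -- this leaves room for the jump of `vA`.
  have hsdrop : A (s + 1) < A s := by
    have h1 := hnb s hts le_rfl
    have h2 := hRanti s.le_succ
    simp only [Nat.succ_eq_add_one] at h2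
    exact lt_of_mul_lt_mul_left (by linarith) hα.le
  have hev1 : ∀ᶠ ε in 𝓝 (0 : ℝ), ∀ r ∈ Finset.Ioc t s, 0 ≤ (α * A r - R r) + ε * (α * vA r - vR r) :=
    (Filter.eventually_all_finset _).2 fun r hr =>
      eventually_nonneg_add_mul (sub_pos.2 (hnb r (Finset.mem_Ioc.1 hr).1 (Finset.mem_Ioc.1 hr).2)) _
  have hev2 : ∀ᶠ ε in 𝓝 (0 : ℝ), ∀ r ∈ Finset.range (s + 1), 0 ≤ (β * Q 0 - R 0) + ε * (-(β * Q 0) - vR r) :=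
    (Filter.eventually_all_finset _).2 fun r hr => eventually_nonneg_add_mul (sub_pos.2 hslack) _
  filter_upwards [eventually_nonneg_add_mul one_pos (-1), hev1, hev2,
    eventually_nonneg_add_mul (sub_pos.2 hdrop) (-e),
    eventually_nonneg_add_mul (sub_pos.2 hsdrop) (Q 0 + e + A (s + 1)),
    eventually_nonneg_add_mul (sub_pos.2 hAM) (-Q 0)] with ε h1 h2 h3 h4 h5 h6
  have hAanti : Antitone (A + ε • vA) := by
    refine antitone_nat_of_succ_le fun r => ?_
    have hq := h.antitone_fst r.le_succ
    simp only [Nat.succ_eq_add_one] at hq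
    simp only [Pi.add_apply, Pi.smul_apply, smul_eq_mul, hvA]
    by_cases hr1 : r = t
    · subst hr1
      rw [if_neg (by omega), if_pos (by omega), if_pos le_rfl]; linarith
    by_cases hr2 : r = s
    · subst hr2
      rw [if_neg (by omega), if_neg (by omega), if_neg (by omega), if_pos le_rfl]; linarith
    split_ifs <;> first | omega | nlinarith
  have hlargeA : ∀ r, s < r → 0 ≤ (A + ε • vA) r := by
    intro r hr
    simp only [Pi.add_apply, Pi.smul_apply, smul_eq_mul, hvA]
    rw [if_neg (by omega), if_neg (by omega)]; nlinarith [hAn r]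
  have hrecR : ∀ r, (R + ε • vR) r = (A + ε • vA) r + (Q + ε • -Q) r + (R + ε • vR) (r + 1) := by
    intro r
    have hrec := hR.rec_eq r
    simp only [Pi.add_apply, Pi.smul_apply, Pi.neg_apply, smul_eq_mul, hvA, hvR]
    rcases lt_trichotomy r t with hr | hr | hr
    · rw [if_pos (by omega), if_pos (by omega), if_pos (by omega), hQT r (by omega)]; rw [hQT r (by omega)] at hrec; linarith
    · subst hr
      rw [if_pos le_rfl, if_pos le_rfl, if_neg (by omega), if_pos (by omega), hQT r (by omega)]
      rw [hQT r (by omega)] at hrec; push_cast; linear_combination hrec - ε * he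
    · rcases lt_trichotomy r s with hr' | hr' | hr'
      · rw [if_neg (by omega), if_pos (by omega), if_neg (by omega), if_pos (by omega), if_neg (by omega),
          if_pos (by omega), hQT r (by omega)]
        rw [hQT r (by omega)] at hrec; push_cast; linear_combination hrec
      · subst hr'
        rw [if_neg (by omega), if_pos (by omega), if_neg (by omega), if_pos (by omega), if_neg (by omega),
          if_neg (by omega), hQT r (by omega)]
        rw [hQT r (by omega)] at hrec; linear_combination hrec
      · rw [if_neg (by omega), if_neg (by omega), if_neg (by omega), if_neg (by omega), if_neg (by omega),
          if_neg (by omega)]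
        linear_combination (1 - ε) * hrec
  have hQn : ∀ r, 0 ≤ (Q + ε • -Q) r := fun r => by
    simp only [Pi.add_apply, Pi.smul_apply, Pi.neg_apply, smul_eq_mul]
    nlinarith [h.nonneg_snd r]
  have hAn' : ∀ r, 0 ≤ (A + ε • vA) r := fun r =>
    (hlargeA (max r (s + 1)) (by omega)).trans (hAanti (le_max_left _ _))
  have hRanti' : Antitone (R + ε • vR) :=
    antitone_nat_of_succ_le fun r => by linarith [hrecR r, hAn' r, hQn r]
  have hRlarge : ∀ r, s < r → 0 ≤ (R + ε • vR) r := by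
    intro r hr
    simp only [Pi.add_apply, Pi.smul_apply, smul_eq_mul, hvR]
    rw [if_neg (by omega), if_neg (by omega)]; nlinarith [hRn r]
  have hsmall : ∀ r, r ≤ s → (R + ε • vR) r ≤ β * (Q + ε • -Q) r := by
    intro r hr
    have := h3 r (Finset.mem_range.2 (by omega))
    simp only [Pi.add_apply, Pi.smul_apply, Pi.neg_apply, smul_eq_mul]
    rw [hQT r (by omega)]
    linarith [hRanti r.zero_le]
  refine TailFeasible.of_tail (R := R + ε • vR) hAanti (antitone_nat_of_succ_le fun r => ?_)
    hAn' hQn ?_ ?_ hrecR (fun r => (hRlarge (max r (s + 1)) (by omega)).trans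
      (hRanti' (le_max_left _ _))) (fun r => ?_) (fun r => ?_) ?_
  · have hq := h.antitone_snd r.le_succ
    simp only [Nat.succ_eq_add_one] at hq
    simp only [Pi.add_apply, Pi.smul_apply, Pi.neg_apply, smul_eq_mul]
    nlinarith
  · simp only [Pi.add_apply, Pi.smul_apply, Pi.neg_apply, smul_eq_mul, hvA, zero_le, if_true]
    linarith [h.total]
  · simp only [Pi.add_apply, Pi.smul_apply, smul_eq_mul, hvA, zero_le, if_true]
    linarith
  · have hra := hRA r
    rcases le_or_gt r t with hr | hr
    · simp only [Pi.add_apply, Pi.smul_apply, smul_eq_mul, hvA, hvR, hr, if_true]; linarith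
    · rcases le_or_gt r s with hr' | hr'
      · have := h2 r (Finset.mem_Ioc.2 ⟨hr, hr'⟩)
        simp only [Pi.add_apply, Pi.smul_apply, smul_eq_mul]; linarith
      · simp only [Pi.add_apply, Pi.smul_apply, smul_eq_mul, hvA, hvR]
        rw [if_neg (by omega), if_neg (by omega), if_neg (by omega), if_neg (by omega)]; nlinarith
  · rcases le_or_gt r s with hr' | hr'
    · exact hsmall r hr'
    · have := hRQ r
      simp only [Pi.add_apply, Pi.smul_apply, Pi.neg_apply, smul_eq_mul, hvR]
      rw [if_neg (by omega), if_neg (by omega)]; nlinarith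
  · simp only [Pi.add_apply, Pi.smul_apply, smul_eq_mul, hvA, hvR, zero_le, if_true]; linarith

end Perturb

/-! ### The optimal pair of tails -/

/-- There is a payoff-maximizing pair of tails at which either the bound `M` binds, or stopping with
the upper kind happens at one final time only, and the lower kind occurs before that time only when
its constraint binds. -/
theorem exists_optimal_tailFeasible {α β δ M : ℝ} (hα : 0 < α) (hβ : 0 < β)
    (hM : (α + β) * M = β - δ) {F₀ F₁ w : ℕ → ℝ}
    (hsup : ∀ s t, s ≤ t → F₁ s - F₀ s ≤ F₁ t - F₀ t)
    (hw : ∀ A Q, TailFeasible α β δ M A Q → ∀ t, A t + Q t ≤ w t)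
    (h₀ : Summable fun t => w t * |F₀ t|) (h₁ : Summable fun t => w t * |F₁ t|)
    (hne : ∃ A Q, TailFeasible α β δ M A Q) :
    ∃ A Q, TailFeasible α β δ M A Q ∧
      (∀ A' Q', TailFeasible α β δ M A' Q' → tailPayoff F₀ F₁ A' Q' ≤ tailPayoff F₀ F₁ A Q) ∧
      (A 0 = M ∨ ∃ T, 1 ≤ T ∧ 0 < Q 0 ∧ (∀ t < T, Q t = Q 0) ∧ A T = 0 ∧ Q T = 0 ∧
        ∀ R, IsTail A Q R → ∀ t, t + 1 < T → A (t + 1) < A t → R (t + 1) = α * A (t + 1)) := by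
  -- Secondary objective, with `F₀ = 0` and `F₁ = G`: it strictly rewards late upper stopping, and
  -- `G` is summable, so the constant `1` can serve as dominating sequence.
  let G : ℕ → ℝ := fun t => -(1 / 2) ^ t
  have hGs : Summable fun t => (1 : ℝ) * |G t| := by
    simp only [G, one_mul, abs_neg, abs_pow]
    exact summable_geometric_of_lt_one (by norm_num) (by norm_num [abs_of_pos])
  have hZs : Summable fun t : ℕ => (1 : ℝ) * |(fun _ : ℕ => (0 : ℝ)) t| := by simp [summable_zero]
  have hone : ∀ A Q, TailFeasible α β δ M A Q → ∀ t, A t + Q t ≤ (fun _ : ℕ => (1 : ℝ)) t :=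
    fun A Q h t => by linarith [h.total, h.antitone_fst t.zero_le, h.antitone_snd t.zero_le]
  obtain ⟨A₁, Q₁, hne⟩ := hne
  obtain ⟨⟨A, Q⟩, hmem, hmax₁, hmax₂, hext⟩ := exists_lexMax_extreme
    (TailFeasible.isCompact_set (α := α) (β := β) (δ := δ) (M := M)) ⟨(A₁, Q₁), hne⟩
    (continuousOn_tailPayoff hw h₀ h₁) (continuousOn_tailPayoff hone hZs hGs)
    (fun p v _ h h' => tailPayoff_add_sub hw h₀ h₁ h h')
    (fun p v _ h h' => tailPayoff_add_sub hone hZs hGs h h')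
  have h : TailFeasible α β δ M A Q := hmem
  refine ⟨A, Q, h, fun A' Q' h' => hmax₁ (A', Q') h', ?_⟩
  by_cases hAM : A 0 = M
  · exact Or.inl hAM
  replace hAM : A 0 < M := lt_of_le_of_ne h.le hAM
  right
  obtain ⟨R, hR, hRA, hRQ, hR0⟩ := h.exists_tail
  have hRn := hR.nonneg h.nonneg_fst h.nonneg_snd
  have hRanti := hR.antitone h.nonneg_fst h.nonneg_snd
  -- By `hM`, `A 0 < M` says that `α * A 0 + δ < β * Q 0`.
  have hslack : R 0 < β * Q 0 := by
    have := h.total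
    have h1 : (α + β) * A 0 < (α + β) * M := mul_lt_mul_of_pos_left hAM (by linarith)
    rw [show Q 0 = 1 - A 0 by linarith]
    linarith
  have hQ0 : 0 < Q 0 := by
    have := (hRn 0).trans_lt hslack
    exact pos_of_mul_pos_right this hβ.le
  have hext' : ∀ a q : ℕ → ℝ,
      (∀ᶠ ε in 𝓝 (0 : ℝ), TailFeasible α β δ M (A + ε • a) (Q + ε • q)) → a = 0 ∧ q = 0 := by
    intro a q hev
    have := eq_zero_of_eventually_mem (v := (a, q)) hext hev
    exact ⟨congrArg Prod.fst this, congrArg Prod.snd this⟩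
  have hS : ∀ t, A t + Q t ≤ R t := fun t => by linarith [hR.rec_eq t, hRn (t + 1)]
  have hQlim : Tendsto Q atTop (𝓝 0) := squeeze_zero h.nonneg_snd
    (fun t => by linarith [hS t, h.nonneg_fst t]) hR.tendsto
  have hAlim : Tendsto A atTop (𝓝 0) := squeeze_zero h.nonneg_fst
    (fun t => by linarith [hS t, h.nonneg_snd t]) hR.tendsto
  -- Otherwise some upper stopping at `r + 1` is exchanged with the next lower stopping, at `s + 1`.
  -- The payoff does not fall, by supermodularity, and the secondary objective rises strictly.
  have hlater : ∀ r, Q (r + 1) < Q r → 0 < A (r + 1) → R (r + 1) = α * A (r + 1) := by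
    intro r hr hpos
    by_contra hnb
    have hnb' : R (r + 1) < α * A (r + 1) := lt_of_le_of_ne (hRA _) hnb
    have hex : ∃ s, A (s + 1) < A (r + 1) :=
      ((hAlim.comp (tendsto_add_atTop_nat 1)).eventually_lt_const hpos).exists
    classical
    let s := Nat.find hex
    have hs : A (s + 1) < A (r + 1) := Nat.find_spec hex
    have hmin : ∀ t, t < s → A (r + 1) ≤ A (t + 1) := fun t ht => not_lt.1 (Nat.find_min hex ht)
    have hrs : r < s := by
      by_contra hc
      exact absurd hs (not_lt.2 (h.antitone_fst (by omega)))
    have hconst : ∀ t, r < t → t ≤ s → A t = A (r + 1) := fun t h1 h2 => by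
      refine le_antisymm (h.antitone_fst h1) ?_
      have := hmin (t - 1) (by omega)
      rwa [show t - 1 + 1 = t by omega] at this
    have hAs := hconst s hrs le_rfl
    obtain ⟨ε, hε, e1, e2, e3⟩ : ∃ ε, 0 < ε ∧ ε ≤ Q r - Q (r + 1) ∧ ε ≤ A s - A (s + 1) ∧
        α * ε ≤ α * A (r + 1) - R (r + 1) := by
      refine ⟨min (min (Q r - Q (r + 1)) (A s - A (s + 1))) ((α * A (r + 1) - R (r + 1)) / α),
        lt_min (lt_min (by linarith) (by linarith)) (div_pos (by linarith) hα),
        (min_le_left _ _).trans (min_le_left _ _), (min_le_left _ _).trans (min_le_right _ _), ?_⟩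
      have := min_le_right (min (Q r - Q (r + 1)) (A s - A (s + 1))) ((α * A (r + 1) - R (r + 1)) / α)
      rw [le_div_iff₀ hα] at this
      linarith
    have hnew := h.shift hR hRA hRQ hR0 hα hβ hconst hε.le e1 e2 e3
    have p1 := tailPayoff_shift hrs ε (h.summable_term (hw _ _ h) h₀ h₁)
    have p2 := tailPayoff_shift hrs ε (h.summable_term (hone _ _ h) hZs hGs)
    have m1 := hmax₁ (_, _) hnew
    have hmono := mul_nonneg hε.le (sub_nonneg.2 (hsup r s hrs.le))
    have m2 := hmax₂ (_, _) hnew (by dsimp only at m1 ⊢; linarith)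
    have hG : G r < G s := by
      simp only [G]
      have : (1 / 2 : ℝ) ^ s < (1 / 2) ^ r := pow_lt_pow_right_of_lt_one₀ (by norm_num) (by norm_num) hrs
      linarith
    have : 0 < ε * ((G s - 0) - (G r - 0)) := mul_pos hε (by linarith)
    dsimp only at m2
    linarith
  classical
  have hex : ∃ r, Q (r + 1) < Q 0 :=
    ((hQlim.comp (tendsto_add_atTop_nat 1)).eventually_lt_const hQ0).exists
  -- The first upper stopping is at time `r + 1`.
  let r := Nat.find hex
  have hr : Q (r + 1) < Q 0 := Nat.find_spec hex
  have hmin : ∀ t, t < r → Q 0 ≤ Q (t + 1) := fun t ht => not_lt.1 (Nat.find_min hex ht)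
  have hconst : ∀ t ≤ r, Q t = Q 0 := fun t ht => by
    rcases Nat.eq_zero_or_pos t with rfl | hpos
    · rfl
    · refine le_antisymm (h.antitone_snd t.zero_le) ?_
      have := hmin (t - 1) (by omega)
      rwa [show t - 1 + 1 = t by omega] at this
  have hdrop : Q (r + 1) < Q r := by rwa [hconst r le_rfl]
  -- Otherwise `hlater` makes the constraint bind, and scaling is a two-sided move whose lower
  -- component at `0` is `A (r + 1)`.
  have hAr : A (r + 1) = 0 := by
    by_contra hc
    have hpos := lt_of_le_of_ne (h.nonneg_fst (r + 1)) (Ne.symm hc)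
    have := (hext' _ _ (h.eventually_scale hR hRA hRQ hR0 hAM hslack hconst hdrop
      (hlater r hdrop hpos))).1
    have := congrFun this 0
    simp at this
    exact hc this
  have hRr : R (r + 1) = 0 := le_antisymm (by simpa [hAr] using hRA (r + 1)) (hRn _)
  have hQr : Q (r + 1) = 0 := le_antisymm (by linarith [hS (r + 1)]) (h.nonneg_snd _)
  refine ⟨r + 1, by omega, hQ0, fun t ht => hconst t (by omega), hAr, hQr, fun R' hR' t ht hd => ?_⟩
  have hRR : R' = R := funext fun k =>
    (hR'.hasSum h.nonneg_fst h.nonneg_snd k).unique (hR.hasSum h.nonneg_fst h.nonneg_snd k)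
  subst hRR
  by_contra hnb
  -- The constraint will first bind after `t` at `s + 1`: time `t + 1` is excluded by `hnb`, and at
  -- `r + 1` both sides are `0`.
  have hexs : ∃ s, t < s ∧ R' (s + 1) = α * A (s + 1) := ⟨r, by omega, by rw [hRr, hAr, mul_zero]⟩
  let s := Nat.find hexs
  have hs : t < s ∧ R' (s + 1) = α * A (s + 1) := Nat.find_spec hexs
  have hsr : s ≤ r := Nat.find_min' hexs ⟨by omega, by rw [hRr, hAr, mul_zero]⟩
  have hslackA : ∀ k, t < k → k ≤ s → R' k < α * A k := by
    intro k h1 h2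
    refine lt_of_le_of_ne (hRA k) fun hk => ?_
    by_cases hk1 : k = t + 1
    · subst hk1; exact hnb hk
    · exact Nat.find_min hexs (show k - 1 < s by omega)
        ⟨by omega, by rwa [show k - 1 + 1 = k by omega]⟩
  have hts' : (0 : ℝ) < s - t := by
    have : (t : ℝ) < s := by exact_mod_cast hs.1
    linarith
  have := (hext' _ _ (h.eventually_move hR hα hRA hRQ hR0 hAM hslack (T := r + 1)
    (fun k hk => hconst k (by omega)) hs.1 (by omega) hd hs.2 hslackA
    (div_mul_cancel₀ (α * Q 0 + R' (s + 1)) hts'.ne'))).2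
  have := congrFun this 0
  simp at this
  exact hQ0.ne' this

/-! ### Measurability with respect to the history -/

section History

/-- What is known at time `t` depends on the first `t` pairs only. -/
lemma mem_iff_of_agree {t : ℕ} {E : Set Path} (hE : MeasurableSet[history t] E) {ω ω' : Path}
    (h : ∀ k < t, ω k = ω' k) : ω ∈ E ↔ ω' ∈ E := by
  let m' : MeasurableSpace Path :=
    { MeasurableSet' := fun E => ∀ ω ω' : Path, (∀ k < t, ω k = ω' k) → (ω ∈ E ↔ ω' ∈ E)
      measurableSet_empty := fun _ _ _ => Iff.rfl
      measurableSet_compl := fun _ hs ω ω' h => not_congr (hs ω ω' h)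
      measurableSet_iUnion := fun f hf ω ω' h => by
        simp only [mem_iUnion]; exact exists_congr fun i => hf i ω ω' h }
  have hle : (history t : MeasurableSpace Path) ≤ m' := by
    refine iSup_le fun k => iSup_le fun hk => ?_
    rintro _ ⟨s, -, rfl⟩ ω ω' h
    simp only [mem_preimage, h k hk]
  exact hle E hE ω ω' h

lemma measurable_coord {k t : ℕ} (hk : k < t) :
    Measurable[history t] (fun ω : Path => ω k) :=
  (comap_measurable _).mono (le_iSup_of_le k (le_iSup_of_le hk le_rfl)) le_rfl

lemma measurable_belief_history (μ₀ : unitInterval) (t : ℕ) :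
    Measurable[history t] (fun ω => (belief μ₀ t ω : ℝ)) := by
  cases t with
  | zero => exact @measurable_const ℝ Path _ (history 0) (μ₀ : ℝ)
  | succ t =>
    exact measurable_subtype_coe.comp (measurable_fst.comp (measurable_coord t.lt_succ_self))

lemma measurable_belief (μ₀ : unitInterval) (t : ℕ) : Measurable (fun ω => (belief μ₀ t ω : ℝ)) :=
  (measurable_belief_history μ₀ t).mono (history.le t) le_rfl

lemma belief_mem (μ₀ : unitInterval) (t : ℕ) (ω : Path) : (belief μ₀ t ω : ℝ) ∈ Icc (0 : ℝ) 1 :=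
  (belief μ₀ t ω).2

lemma stopBelief_mem (μ₀ : unitInterval) (τ : Path → WithTop ℕ) (ω : Path) :
    stopBelief μ₀ τ ω ∈ Icc (0 : ℝ) 1 := (belief μ₀ _ ω).2

variable {τ : Path → WithTop ℕ}

lemma measurable_time (hτ : IsStoppingTime history τ) : Measurable (time τ) :=
  hτ.measurable'.untopD 0

lemma measurable_stopBelief (μ₀ : unitInterval) (hτ : IsStoppingTime history τ) :
    Measurable (stopBelief μ₀ τ) :=
  (measurable_from_prod_countable_right (f := fun q : ℕ × Path => (belief μ₀ q.1 q.2 : ℝ))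
    fun t => measurable_belief μ₀ t).comp ((measurable_time hτ).prodMk measurable_id)

lemma continuous_indirectUtility (u : Fin 2 → Fin 2 → ℝ) : Continuous (indirectUtility u) := by
  unfold indirectUtility expPayoff
  fun_prop

lemma exists_indirectUtility_bound (u : Fin 2 → Fin 2 → ℝ) :
    ∃ C, ∀ z ∈ Icc (0 : ℝ) 1, |indirectUtility u z| ≤ C := by
  obtain ⟨C, hC⟩ := isCompact_Icc.exists_bound_of_continuousOn (s := Icc (0 : ℝ) 1)
    (continuous_indirectUtility u).continuousOn
  exact ⟨C, fun z hz => hC z hz⟩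

lemma IsStrategyFrom.integrable_dmPayoff {μ₀ : unitInterval} {I : InfoStructure μ₀} {s : ℕ}
    (h : IsStrategyFrom I s τ) (u : Fin 2 → Fin 2 → ℝ) (c : ℝ) :
    Integrable (dmPayoff u c μ₀ τ) I.law := by
  have := I.isProb
  obtain ⟨C, hC⟩ := exists_indirectUtility_bound u
  refine Integrable.sub ?_ (h.integrable.const_mul c)
  exact Integrable.of_bound ((continuous_indirectUtility u).measurable.comp
    (measurable_stopBelief μ₀ h.stopping)).aestronglyMeasurable C
    (ae_of_all _ fun ω => hC _ (stopBelief_mem μ₀ τ ω))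

end History

/-! ### Stopping plans and the DM's best response to them -/

/-- The first time at which the message `S` comes. -/
noncomputable def firstStop (ω : Path) : WithTop ℕ :=
  open Classical in if h : ∃ k, (ω k).2 = msgS then ((Nat.find h + 1 : ℕ) : WithTop ℕ) else ⊤

lemma firstStop_le_iff (ω : Path) (n : ℕ) :
    firstStop ω ≤ n ↔ ∃ k < n, (ω k).2 = msgS := by
  classical
  unfold firstStop
  split_ifs with h
  · rw [Nat.cast_le, Nat.succ_le_iff, Nat.find_lt_iff]
  · simp only [top_le_iff, WithTop.natCast_ne_top, false_iff]
    rintro ⟨k, -, hk⟩; exact h ⟨k, hk⟩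

lemma isStoppingTime_firstStop : IsStoppingTime history firstStop := by
  intro n
  have : {ω : Path | firstStop ω ≤ (n : WithTop ℕ)} = ⋃ k, ⋃ _ : k < n, {ω | (ω k).2 = msgS} := by
    ext ω
    simp only [mem_ofPred_eq, mem_iUnion, exists_prop]
    exact firstStop_le_iff ω n
  change MeasurableSet[history n] {ω : Path | firstStop ω ≤ (n : WithTop ℕ)}
  rw [this]
  refine MeasurableSet.iUnion fun k => MeasurableSet.iUnion fun hk => ?_
  exact measurableSet_eq_fun (measurable_snd.comp (measurable_coord hk)) measurable_const

/-- Stop at the first message `S` from time `s` on, the message being repeated forever. -/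
noncomputable def stopFrom (s : ℕ) (ω : Path) : WithTop ℕ := max (firstStop ω) s

lemma isStoppingTime_stopFrom (s : ℕ) : IsStoppingTime history (stopFrom s) :=
  isStoppingTime_firstStop.max_const s

/-- With probability `weight i` the DM gets the message `S` and the belief `signal i.2` from time
`i.1 + 1` on; until then she gets the message `C` and the beliefs `path t`. -/
structure StoppingPlan (μ₀ : unitInterval) where
  weight : ℕ × Fin 3 → ℝ
  signal : Fin 3 → unitInterval
  path : ℕ → unitInterval
  nonneg : ∀ i, 0 ≤ weight i
  hasSum_weight : HasSum weight 1
  summable_time : Summable fun i => weight i * (i.1 : ℝ)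
  path_zero : path 0 = μ₀
  mean : ∀ t, HasSum (fun i => if t ≤ i.1 then weight i * ((signal i.2 : ℝ) - path t) else 0) 0

namespace StoppingPlan

variable {μ₀ : unitInterval} (P : StoppingPlan μ₀)

/-- The path on which the message `S` comes at time `i.1 + 1`. -/
def stopPath (i : ℕ × Fin 3) : Path := fun k =>
  if k < i.1 then (P.path (k + 1), msgC) else (P.signal i.2, msgS)

/-- The path on which the message `S` never comes. -/
def neverPath : Path := fun k => (P.path (k + 1), msgC)

lemma msgC_ne_msgS : msgC ≠ msgS := by simp [msgC, msgS]

lemma belief_stopPath (t : ℕ) (i : ℕ × Fin 3) :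
    belief μ₀ t (P.stopPath i) = if t ≤ i.1 then P.path t else P.signal i.2 := by
  cases t with
  | zero => simp [belief, P.path_zero]
  | succ t =>
    simp only [belief, stopPath, Nat.succ_le_iff]
    split_ifs <;> rfl

lemma message_stopPath {t : ℕ} (ht : 1 ≤ t) (i : ℕ × Fin 3) :
    message t (P.stopPath i) = if t ≤ i.1 then msgC else msgS := by
  obtain ⟨t, rfl⟩ := Nat.exists_eq_add_of_le' ht
  simp only [message, stopPath, Nat.succ_le_iff]
  split_ifs <;> rfl

/-- As long as `S` has not come all paths look alike: those without `S` up to time `t` form a single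
information set. -/
lemma agree {t : ℕ} {i : ℕ × Fin 3} (h : t ≤ i.1) (k : ℕ) (hk : k < t) :
    P.stopPath i k = P.neverPath k := by
  simp [stopPath, neverPath, hk.trans_le h]

lemma firstStop_stopPath (i : ℕ × Fin 3) : firstStop (P.stopPath i) = ((i.1 + 1 : ℕ) : WithTop ℕ) := by
  have key : ∀ n : ℕ, firstStop (P.stopPath i) ≤ n ↔ i.1 + 1 ≤ n := by
    intro n
    rw [firstStop_le_iff]
    constructor
    · rintro ⟨k, hk, h⟩
      by_contra hc
      have : k < i.1 := by omega
      simp [stopPath, this, msgC_ne_msgS] at h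
    · intro h
      exact ⟨i.1, by omega, by simp [stopPath]⟩
  refine le_antisymm ((key _).2 le_rfl) ?_
  cases h : firstStop (P.stopPath i) with
  | top => exact le_top
  | coe n => exact WithTop.coe_le_coe.2 ((key n).1 h.le)

lemma stopFrom_stopPath (s : ℕ) (i : ℕ × Fin 3) :
    stopFrom s (P.stopPath i) = ((max (i.1 + 1) s : ℕ) : WithTop ℕ) := by
  rw [stopFrom, firstStop_stopPath]; exact (WithTop.coe_max (i.1 + 1) s).symm

lemma time_stopFrom (s : ℕ) (i : ℕ × Fin 3) : time (stopFrom s) (P.stopPath i) = max (i.1 + 1) s := by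
  rw [time, stopFrom_stopPath]; rfl

/-- The law of the paths. -/
noncomputable def law : Measure Path :=
  Measure.sum fun i => ENNReal.ofReal (P.weight i) • Measure.dirac (P.stopPath i)

lemma toReal_weight (i : ℕ × Fin 3) : (ENNReal.ofReal (P.weight i)).toReal = P.weight i :=
  ENNReal.toReal_ofReal (P.nonneg i)

lemma integrable_iff {g : Path → ℝ} :
    Integrable g P.law ↔ Summable fun i => P.weight i * |g (P.stopPath i)| := by
  unfold law
  rw [integrable_sum_dirac_iff fun i => ENNReal.ofReal_ne_top]
  simp only [toReal_weight, Real.norm_eq_abs]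

lemma hasSum_integral {g : Path → ℝ} (hg : Integrable g P.law) :
    HasSum (fun i => P.weight i * g (P.stopPath i)) (∫ ω, g ω ∂P.law) := by
  have := hasSum_integral_sum_dirac (x := P.stopPath) (f := g) (c := fun i => ENNReal.ofReal (P.weight i))
    (fun i => ENNReal.ofReal_ne_top) (by simpa only [toReal_weight, Real.norm_eq_abs] using P.integrable_iff.1 hg)
  simp only [toReal_weight, smul_eq_mul] at this
  exact this

lemma ae_iff {p : Path → Prop} :
    (∀ᵐ ω ∂P.law, p ω) ↔ ∀ i, 0 < P.weight i → p (P.stopPath i) := by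
  unfold law
  rw [Measure.ae_sum_iff]
  refine forall_congr' fun i => ?_
  rcases (P.nonneg i).eq_or_lt with h | h
  · simp [← h]
  · rw [Measure.ae_ennreal_smul_measure_iff (ENNReal.ofReal_pos.2 h).ne', ae_dirac_eq]
    simp [h]

instance isProbabilityMeasure : IsProbabilityMeasure P.law := by
  constructor
  unfold law
  rw [Measure.sum_apply _ MeasurableSet.univ]
  simp only [Measure.smul_apply, measure_univ, smul_eq_mul, mul_one]
  rw [← ENNReal.ofReal_tsum_of_nonneg P.nonneg P.hasSum_weight.summable, P.hasSum_weight.tsum_eq,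
    ENNReal.ofReal_one]

/-- An event known at time `t` contains all or none of the paths on which `S` comes after `t`, and
on the other paths `g` vanishes. So the integral is the whole sum or nothing. -/
lemma setIntegral_eq_zero {t : ℕ} {E : Set Path} (hE : MeasurableSet[history t] E) {g : Path → ℝ}
    (hg : Integrable g P.law) (hzero : ∀ i, i.1 < t → g (P.stopPath i) = 0)
    (hsum : HasSum (fun i => P.weight i * g (P.stopPath i)) 0) : ∫ ω in E, g ω ∂P.law = 0 := by
  classical
  have hE' := history.le t E hE
  rw [← integral_indicator hE']
  refine (P.hasSum_integral (hg.indicator hE')).unique ?_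
  have := hsum.mul_left (if P.neverPath ∈ E then (1 : ℝ) else 0)
  rw [mul_zero] at this
  refine this.congr_fun fun i => ?_
  rcases lt_or_ge i.1 t with h | h
  · simp [indicator, hzero i h]
  · simp only [indicator, mem_iff_of_agree hE (P.agree h)]
    split_ifs <;> simp

lemma integrable_belief (t : ℕ) : Integrable (fun ω => (belief μ₀ t ω : ℝ)) P.law :=
  Integrable.of_bound (measurable_belief μ₀ t).aestronglyMeasurable 1
    (ae_of_all _ fun ω => by
      rw [Real.norm_eq_abs, abs_of_nonneg (belief_mem μ₀ t ω).1]; exact (belief_mem μ₀ t ω).2)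

lemma martingale : Martingale (fun t ω => (belief μ₀ t ω : ℝ)) history P.law := by
  refine martingale_of_setIntegral_eq_succ
    (fun t => (measurable_belief_history μ₀ t).stronglyMeasurable) P.integrable_belief
    fun t E hE => ?_
  have h := P.setIntegral_eq_zero hE ((P.integrable_belief (t + 1)).sub (P.integrable_belief t))
    (fun i hi => by
      simp only [Pi.sub_apply, belief_stopPath]
      rw [if_neg (by omega), if_neg (by omega), sub_self])
    (by
      have := (P.mean t).sub (P.mean (t + 1))
      rw [sub_zero] at this
      refine this.congr_fun fun i => ?_
      simp only [Pi.sub_apply, belief_stopPath]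
      split_ifs <;> first | omega | ring)
  rw [integral_sub' (P.integrable_belief _).integrableOn (P.integrable_belief _).integrableOn] at h
  linarith

/-- The dynamic information structure of the plan. -/
noncomputable def toInfo : InfoStructure μ₀ := ⟨P.law, P.isProbabilityMeasure, P.martingale⟩

lemma toInfo_law : P.toInfo.law = P.law := rfl

variable (u : Fin 2 → Fin 2 → ℝ) (c : ℝ)

lemma strategy_stopFrom (s : ℕ) : IsStrategyFrom P.toInfo s (stopFrom s) where
  stopping := isStoppingTime_stopFrom s
  ge ω := le_max_right _ _
  finite := P.ae_iff.2 fun i _ => by rw [stopFrom_stopPath]; exact WithTop.natCast_ne_top _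
  integrable := P.integrable_iff.2 (by
    simp only [time_stopFrom]
    have := P.summable_time.add (P.hasSum_weight.summable.mul_right ((1 : ℝ) + s))
    refine Summable.of_nonneg_of_le (fun i => mul_nonneg (P.nonneg i) (abs_nonneg _)) (fun i => ?_) this
    rw [← mul_add, Nat.abs_cast]
    refine mul_le_mul_of_nonneg_left ?_ (P.nonneg i)
    rw [Nat.cast_max]
    push_cast
    exact max_le (by linarith [(Nat.cast_nonneg s : (0 : ℝ) ≤ s)])
      (by linarith [(Nat.cast_nonneg i.1 : (0 : ℝ) ≤ i.1)]))

lemma dmPayoff_stopFrom (s : ℕ) (i : ℕ × Fin 3) : dmPayoff u c μ₀ (stopFrom s) (P.stopPath i)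
    = indirectUtility u (P.signal i.2) - c * ((max (i.1 + 1) s : ℕ) : ℝ) := by
  rw [dmPayoff, stopBelief, time_stopFrom, belief_stopPath, if_neg (by omega)]

/-- The gain from waiting for the message `S` over stopping at time `n`, on the path `i`. -/
noncomputable def waitingGain (n : ℕ) (i : ℕ × Fin 3) : ℝ :=
  if n ≤ i.1 then P.weight i * ((indirectUtility u (P.signal i.2) - c * (i.1 + 1))
    - (indirectUtility u (P.path n) - c * n)) else 0

/-- Comparison of waiting for `S` with a strategy that stops later on the paths outside `H`. -/
lemma value_compare {s : ℕ} {σ : Path → WithTop ℕ} (hσ : IsStrategyFrom P.toInfo s σ) (hc : 0 < c)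
    (H : ℕ × Fin 3 → Prop)
    (hH : ∀ i, 0 < P.weight i → H i → σ (P.stopPath i) ≤ stopFrom s (P.stopPath i))
    (hH' : ∀ i, 0 < P.weight i → ¬ H i → i.1 < time σ (P.stopPath i))
    (hgain : ∀ _ : DecidablePred H, 0 ≤ ∑' i, if H i then
      P.weight i * (dmPayoff u c μ₀ (stopFrom s) (P.stopPath i) - dmPayoff u c μ₀ σ (P.stopPath i)) else 0) :
    dmValue u c P.toInfo σ ≤ dmValue u c P.toInfo (stopFrom s) ∧
      (dmValue u c P.toInfo σ = dmValue u c P.toInfo (stopFrom s) → σ ≤ᵐ[P.toInfo.law] stopFrom s) := by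
  classical
  have i1 := P.hasSum_integral ((P.strategy_stopFrom s).integrable_dmPayoff u c)
  have i2 := P.hasSum_integral (hσ.integrable_dmPayoff u c)
  have hd := i1.sub i2
  have hge : ∀ i, 0 < P.weight i → ¬ H i → max (i.1 + 1) s ≤ time σ (P.stopPath i) := by
    intro i hi hHi
    have h1 := hH' i hi hHi
    have h2 := hσ.ge (P.stopPath i)
    refine max_le h1 ?_
    unfold time at *
    cases hv : σ (P.stopPath i) with
    -- The default value `0` of `time` at `⊤` contradicts `h1`.
    | top => rw [hv] at h1; simp at h1
    | coe k => rw [hv] at h2; exact WithTop.coe_le_coe.1 h2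
  -- Outside `H` both strategies stop after `S` has come, with the same belief, so only the waiting
  -- costs differ.
  have hterm : ∀ i, 0 < P.weight i → ¬ H i →
      dmPayoff u c μ₀ (stopFrom s) (P.stopPath i) - dmPayoff u c μ₀ σ (P.stopPath i) =
        c * ((time σ (P.stopPath i) : ℝ) - (max (i.1 + 1) s : ℕ)) := by
    intro i hi hHi
    rw [dmPayoff_stopFrom, dmPayoff, stopBelief, belief_stopPath, if_neg (by have := hH' i hi hHi; omega)]
    ring
  set D : ℕ × Fin 3 → ℝ := fun i => P.weight i *
    (dmPayoff u c μ₀ (stopFrom s) (P.stopPath i) - dmPayoff u c μ₀ σ (P.stopPath i)) with hD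
  have hDs : HasSum D (dmValue u c P.toInfo (stopFrom s) - dmValue u c P.toInfo σ) :=
    hd.congr_fun fun i => by simp only [hD]; ring
  have hD1 : Summable fun i => if H i then D i else 0 := by
    have := hDs.summable.indicator {i | H i}
    refine this.congr fun i => by simp [indicator]
  have hD2 : Summable fun i => if H i then 0 else D i := by
    have := hDs.summable.sub hD1
    refine this.congr fun i => by split_ifs <;> simp
  have hsplit : dmValue u c P.toInfo (stopFrom s) - dmValue u c P.toInfo σ =
      (∑' i, if H i then D i else 0) + ∑' i, if H i then 0 else D i := by
    rw [← hD1.tsum_add hD2, ← hDs.tsum_eq]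
    exact tsum_congr fun i => by split_ifs <;> simp
  have hD2n : ∀ i, 0 ≤ if H i then 0 else D i := by
    intro i
    split_ifs with hHi
    · exact le_rfl
    · rcases (P.nonneg i).eq_or_lt with h | h
      · simp [hD, ← h]
      · simp only [hD, hterm i h hHi]
        have : ((max (i.1 + 1) s : ℕ) : ℝ) ≤ time σ (P.stopPath i) := by exact_mod_cast hge i h hHi
        exact mul_nonneg h.le (mul_nonneg hc.le (by linarith))
  have hg := hgain inferInstance
  have h2 : 0 ≤ ∑' i, if H i then 0 else D i := tsum_nonneg hD2n
  refine ⟨by linarith, fun heq => P.ae_iff.2 fun i hi => ?_⟩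
  by_cases hHi : H i
  · exact hH i hi hHi
  · have h0 : (∑' i, if H i then 0 else D i) = 0 := by linarith
    have h3 := congrFun ((hD2.hasSum_iff.2 h0 |> (hasSum_zero_iff_of_nonneg hD2n).1)) i
    simp only [if_neg hHi, Pi.zero_apply, hD, hterm i hi hHi] at h3
    have h4 : (time σ (P.stopPath i) : ℝ) = (max (i.1 + 1) s : ℕ) := by
      have := (mul_eq_zero.1 ((mul_eq_zero.1 h3).resolve_left hi.ne')).resolve_left hc.ne'
      linarith
    have h5 : time σ (P.stopPath i) = max (i.1 + 1) s := by exact_mod_cast h4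
    have h6 := hH' i hi hHi
    rw [stopFrom_stopPath, ← h5]
    unfold time at *
    cases hv : σ (P.stopPath i) with
    | top => rw [hv] at h6; simp at h6
    | coe k => rfl

/-- Before `S` a strategy cannot distinguish the paths, so it is governed by its value `n` on
`neverPath`. Where `S` comes after `n`, it forgoes the nonnegative gain from waiting at `n`;
elsewhere it stops no sooner than `stopFrom s` and only pays more. -/
lemma isBestResponseFrom_stopFrom (hc : 0 < c) {s : ℕ}
    (hobey : ∀ n, s ≤ n → 0 ≤ ∑' i, P.waitingGain u c n i) :
    IsBestResponseFrom u c P.toInfo s (stopFrom s) := by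
  suffices h : ∀ σ, IsStrategyFrom P.toInfo s σ →
      dmValue u c P.toInfo σ ≤ dmValue u c P.toInfo (stopFrom s) ∧
      (dmValue u c P.toInfo σ = dmValue u c P.toInfo (stopFrom s) → σ ≤ᵐ[P.toInfo.law] stopFrom s) from
    ⟨P.strategy_stopFrom s, fun σ hσ => (h σ hσ).1, fun σ hσ => (h σ hσ).2⟩
  intro σ hσ
  have hfin : ∀ i, 0 < P.weight i → σ (P.stopPath i) ≠ ⊤ := P.ae_iff.1 hσ.finite
  have hto : ∀ (i : ℕ × Fin 3) (k : ℕ), k ≤ i.1 → (σ (P.stopPath i) = k ↔ σ P.neverPath = k) :=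
    fun i k hk => mem_iff_of_agree (E := {ω | σ ω = k}) (hσ.stopping.measurableSet_eq k) (P.agree hk)
  cases hn : σ P.neverPath with
  | top =>
    refine P.value_compare u c hσ hc (fun _ => False) (fun i _ h => h.elim) (fun i hi _ => ?_) (by simp)
    by_contra hle
    have := hfin i hi
    unfold time at hle
    cases hv : σ (P.stopPath i) with
    | top => exact this hv
    | coe k =>
      rw [hv] at hle
      have := (hto i k (not_lt.1 hle)).1 hv
      rw [hn] at this; exact WithTop.top_ne_coe this
  | coe n =>
    have hsn : s ≤ n := by
      have := hσ.ge P.neverPath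
      rw [hn] at this; exact WithTop.coe_le_coe.1 this
    have hval : ∀ i : ℕ × Fin 3, n ≤ i.1 → σ (P.stopPath i) = n := fun i hi => (hto i n hi).2 hn
    refine P.value_compare u c hσ hc (fun i => n ≤ i.1) (fun i _ h => ?_) (fun i hi h => ?_) (fun _ => ?_)
    · rw [hval i h, stopFrom_stopPath]
      exact_mod_cast le_max_of_le_left (h.trans i.1.le_succ)
    · by_contra hle
      unfold time at hle
      cases hv : σ (P.stopPath i) with
      | top => exact hfin i hi hv
      | coe k =>
        rw [hv] at hle
        have := (hto i k (not_lt.1 hle)).1 hv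
        rw [hn] at this
        have h' : n = k := WithTop.coe_inj.1 this
        have hle' : k ≤ i.1 := not_lt.1 hle
        omega
    · convert hobey n hsn using 3 with i
      unfold waitingGain
      split_ifs with h
      · rw [dmPayoff_stopFrom, dmPayoff, stopBelief, time, hval i h]
        change P.weight i * (_ - (indirectUtility u (belief μ₀ n (P.stopPath i)) - c * (n : ℝ))) = _
        rw [belief_stopPath, if_pos h, max_eq_left (by omega)]
        push_cast; ring
      · rfl

end StoppingPlan

/-! ### Telescoping sums and summation by parts -/

section Series

variable {b : ℕ → ℝ} {B : ℝ}

lemma hasSum_if_le {g : ℕ → ℝ} {s : ℝ} (n : ℕ) (h : HasSum (fun k => g (k + n)) s) :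
    HasSum (fun r => if n ≤ r then g r else 0) s := by
  have := (hasSum_nat_add_iff (f := fun r => if n ≤ r then g r else 0) n (g := s)).1
    (h.congr_fun fun k => by simp)
  rwa [Finset.sum_eq_zero fun i hi => if_neg (not_le.2 (Finset.mem_range.1 hi)), add_zero] at this

lemma hasSum_telescope (hb : Antitone b) (hlim : Tendsto b atTop (𝓝 0)) (n : ℕ) :
    HasSum (fun r => if n ≤ r then b r - b (r + 1) else 0) (b n) := by
  refine hasSum_if_le n ?_
  rw [hasSum_iff_tendsto_nat_of_nonneg fun k => sub_nonneg.2 (hb (Nat.le_succ _))]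
  have h : ∀ N, ∑ k ∈ Finset.range N, (b (k + n) - b (k + n + 1)) = b n - b (N + n) := fun N => by
    have := Finset.sum_range_sub' (fun k => b (k + n)) N
    simpa [add_right_comm] using this
  simp_rw [h]
  simpa using tendsto_const_nhds (x := b n).sub (hlim.comp (tendsto_add_atTop_nat n))

/-- The terms with indices from `n / 2` to `n - 1` are all at least `b n`, so `n * b n` is at most
twice the tail of the series from `n / 2`. -/
lemma tendsto_nat_mul_of_antitone (hb : Antitone b) (h0 : ∀ n, 0 ≤ b n) (hs : Summable b) :
    Tendsto (fun n : ℕ => (n : ℝ) * b n) atTop (𝓝 0) := by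
  have ht : Tendsto (fun n : ℕ => 2 * ∑' k, b (k + n / 2)) atTop (𝓝 0) := by
    have := ((tendsto_sum_nat_add b).comp (Nat.tendsto_div_const_atTop two_ne_zero)).const_mul 2
    simpa [Function.comp_def] using this
  refine squeeze_zero (fun n => mul_nonneg n.cast_nonneg (h0 n)) (fun n => ?_) ht
  have h1 : ((n - n / 2 : ℕ) : ℝ) * b n ≤ ∑ k ∈ Finset.range (n - n / 2), b (k + n / 2) := by
    rw [← nsmul_eq_mul]
    have := Finset.card_nsmul_le_sum (Finset.range (n - n / 2)) (fun k => b (k + n / 2)) (b n)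
      fun k hk => hb (by have := Finset.mem_range.1 hk; omega)
    rwa [Finset.card_range] at this
  have h2 := ((summable_nat_add_iff (n / 2)).2 hs).sum_le_tsum (Finset.range (n - n / 2))
    (fun k _ => h0 _)
  have h3 : (n : ℝ) ≤ 2 * (n - n / 2 : ℕ) := by exact_mod_cast (by omega : n ≤ 2 * (n - n / 2))
  nlinarith [h0 n, mul_le_mul_of_nonneg_right h3 (h0 n)]

lemma hasSum_abel (hb : Antitone b) (h0 : ∀ n, 0 ≤ b n) (hs : HasSum b B) :
    HasSum (fun k : ℕ => ((k : ℝ) + 1) * (b k - b (k + 1))) B := by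
  rw [hasSum_iff_tendsto_nat_of_nonneg fun k =>
    mul_nonneg (by positivity) (sub_nonneg.2 (hb (Nat.le_succ _)))]
  have h : ∀ N : ℕ, ∑ k ∈ Finset.range N, ((k : ℝ) + 1) * (b k - b (k + 1)) =
      ∑ k ∈ Finset.range N, b k - N * b N := fun N => by
    induction N with
    | zero => simp
    | succ N ih => rw [Finset.sum_range_succ, Finset.sum_range_succ, ih]; push_cast; ring
  simp_rw [h]
  simpa using hs.tendsto_sum_nat.sub (tendsto_nat_mul_of_antitone hb h0 hs.summable)

/-- The expected remaining waiting time as a sum of survival probabilities. -/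
lemma hasSum_abel_from (hb : Antitone b) (h0 : ∀ n, 0 ≤ b n) (n : ℕ)
    (hs : HasSum (fun k => b (k + n)) B) :
    HasSum (fun r => if n ≤ r then ((r : ℝ) + 1 - n) * (b r - b (r + 1)) else 0) B := by
  refine hasSum_if_le (g := fun r : ℕ => ((r : ℝ) + 1 - n) * (b r - b (r + 1))) n ?_
  refine (hasSum_abel (b := fun k => b (k + n)) (fun i j h => hb (by omega)) (fun k => h0 _) hs).congr_fun
    fun k => ?_
  rw [show k + n + 1 = k + 1 + n by ring]
  push_cast; ring

lemma hasSum_prod_fin {m : ℕ} {g : ℕ × Fin m → ℝ} {s : Fin m → ℝ}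
    (h : ∀ j, HasSum (fun t => g (t, j)) (s j)) : HasSum g (∑ j, s j) := by
  have h' : ∀ j, HasSum (fun i : ℕ × Fin m => if i.2 = j then g i else 0) (s j) := fun j => by
    have hinj : Function.Injective (fun t : ℕ => ((t, j) : ℕ × Fin m)) := fun a b hab => congrArg Prod.fst hab
    refine (hinj.hasSum_iff ?_).1 ((h j).congr_fun fun t => by simp)
    rintro ⟨t, k⟩ hk
    refine if_neg fun hkj => hk ⟨t, ?_⟩
    rw [← show k = j from hkj]
  refine (hasSum_sum fun j _ => h' j).congr_fun fun i => ?_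
  simp

end Series

/-! ### Obedience, indifference and the two forms for stopping plans -/

namespace StoppingPlan

variable {μ₀ : unitInterval} (P : StoppingPlan μ₀) (u : Fin 2 → Fin 2 → ℝ) (c : ℝ)

lemma isExtremalObedient (hc : 0 < c) (hsig : ∀ j, (P.signal j : ℝ) ∈ extremalBeliefs u)
    (hobey : ∀ n, 1 ≤ n → 0 ≤ ∑' i, P.waitingGain u c n i) : IsExtremalObedient u c P.toInfo where
  extremal := ⟨P.path, P.ae_iff.2 fun i _ t ht => by
    rw [P.message_stopPath ht, belief_stopPath]
    split_ifs
    · exact Or.inr ⟨rfl, rfl⟩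
    · exact Or.inl ⟨rfl, hsig _⟩⟩
  obedient s hs := ⟨stopFrom s, P.isBestResponseFrom_stopFrom u c hc fun n hn => hobey n (hs.trans hn),
    P.ae_iff.2 fun i _ => by
      rw [P.message_stopPath hs, stopFrom_stopPath]
      split_ifs with h
      · refine ⟨fun h => absurd h msgC_ne_msgS, fun _ => ?_⟩
        exact WithTop.coe_lt_coe.2 (show s < max (i.1 + 1) s by omega)
      · refine ⟨fun _ => ?_, fun h => absurd h.symm msgC_ne_msgS⟩
        exact WithTop.coe_inj.2 (show max (i.1 + 1) s = s by omega)⟩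

lemma lt_stopFrom_iff (t : ℕ) (i : ℕ × Fin 3) :
    (t : WithTop ℕ) < stopFrom 0 (P.stopPath i) ↔ t ≤ i.1 := by
  rw [stopFrom_stopPath]
  exact WithTop.coe_lt_coe.trans (show t < max (i.1 + 1) 0 ↔ t ≤ i.1 by omega)

lemma stopFrom_eq_iff (t : ℕ) (i : ℕ × Fin 3) :
    stopFrom 0 (P.stopPath i) = t ↔ i.1 + 1 = t := by
  rw [stopFrom_stopPath]
  exact WithTop.coe_inj.trans (show max (i.1 + 1) 0 = t ↔ i.1 + 1 = t by omega)

lemma paysAttention : PaysAttention P.toInfo (stopFrom 0) :=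
  P.ae_iff.2 fun i _ h => by
    have := (P.stopFrom_eq_iff 0 i).1 h
    omega

/-- The paths not stopped by `t` form one information set, on which the gains from continuing sum to
zero; hence the payoff from stopping is there the conditional expectation. -/
lemma indifferentAt {t : ℕ} (h : ∑' i, P.waitingGain u c t i = 0) :
    IndifferentAt u c P.toInfo (stopFrom 0) t := by
  have hint := (P.strategy_stopFrom 0).integrable_dmPayoff u c
  rw [toInfo_law] at hint
  set g := dmPayoff u c μ₀ (stopFrom 0) with hg
  set v : ℝ := indirectUtility u (P.path t) - c * t with hv
  set B : Set Path := {ω | (t : WithTop ℕ) < stopFrom 0 ω} with hB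
  have hBm : MeasurableSet[history t] B := (isStoppingTime_stopFrom 0).measurableSet_gt t
  have hBm' := history.le t B hBm
  have hconst : Integrable (B.indicator fun _ => v) P.law := (integrable_const v).indicator hBm'
  have hkey : (B.indicator fun _ => v) =ᵐ[P.law] P.law[B.indicator g | history t] := by
    refine ae_eq_condExp_of_forall_setIntegral_eq (history.le t) (hint.indicator hBm')
      (fun _ _ _ => hconst.integrableOn) (fun E hE _ => ?_)
      (StronglyMeasurable.aestronglyMeasurable (stronglyMeasurable_const.indicator hBm))
    have hi := (hint.indicator hBm').sub hconst
    have hterm : ∀ i, P.weight i * (B.indicator g - B.indicator fun _ => v) (P.stopPath i) =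
        P.waitingGain u c t i := fun i => by
      simp only [waitingGain, Pi.sub_apply, indicator, hB, mem_ofPred_eq, P.lt_stopFrom_iff]
      split_ifs
      · rw [hg, dmPayoff_stopFrom, hv, max_eq_left (by omega)]; push_cast; ring
      · ring
    have hsum := (P.hasSum_integral hi).summable.hasSum
    simp_rw [hterm] at hsum
    rw [h] at hsum
    have := P.setIntegral_eq_zero hE hi (fun i hit => by
      simp only [Pi.sub_apply, indicator, hB, mem_ofPred_eq, P.lt_stopFrom_iff]
      rw [if_neg (by omega), if_neg (by omega), sub_self]) (by simp_rw [hterm]; exact hsum)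
    rw [integral_sub' (hint.indicator hBm').integrableOn hconst.integrableOn] at this
    linarith
  have hae := hkey.trans (condExp_indicator hint hBm)
  have hpath : ∀ᵐ ω ∂P.law, ω ∈ B → belief μ₀ t ω = P.path t := P.ae_iff.2 fun i _ hi => by
    rw [belief_stopPath, if_pos ((P.lt_stopFrom_iff t i).1 hi)]
  rw [IndifferentAt, toInfo_law]
  filter_upwards [hae, hpath] with ω h1 h2 hω
  have hω' : ω ∈ B := hω
  rw [indicator_of_mem hω', indicator_of_mem hω'] at h1
  rw [h2 hω', ← h1]

lemma stopProb_eq_zero {z : ℝ} {t : ℕ}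
    (h : ∀ i, 0 < P.weight i → i.1 + 1 = t → (P.signal i.2 : ℝ) ≠ z) :
    stopProb P.toInfo (stopFrom 0) z t = 0 := by
  have : ∀ᵐ ω ∂P.law, ¬ (stopFrom 0 ω = t ∧ (belief μ₀ t ω : ℝ) = z) := P.ae_iff.2 fun i hi hc => by
    have h1 := (P.stopFrom_eq_iff t i).1 hc.1
    refine h i hi h1 ?_
    have h2 := hc.2
    rwa [belief_stopPath, if_neg (by omega)] at h2
  rw [stopProb, toInfo_law, measureReal_def]
  rw [MeasureTheory.ae_iff] at this
  simp only [not_not] at this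
  rw [this, ENNReal.toReal_zero]

lemma exists_of_stopProb_pos {z : ℝ} {t : ℕ} (h : 0 < stopProb P.toInfo (stopFrom 0) z t) :
    ∃ i, 0 < P.weight i ∧ i.1 + 1 = t ∧ (P.signal i.2 : ℝ) = z := by
  by_contra hc
  push Not at hc
  exact h.ne' (P.stopProb_eq_zero hc)

lemma pureBadNews {x : ℝ} {T : ℕ} (hle : ∀ i, 0 < P.weight i → i.1 + 1 ≤ T)
    (hT : ∃ i, 0 < P.weight i ∧ i.1 + 1 = T)
    (hbefore : ∀ i, 0 < P.weight i → i.1 + 1 < T → (P.signal i.2 : ℝ) ≠ x ∧ (P.signal i.2 : ℝ) ≠ 1)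
    (hind : ∀ i, 0 < P.weight i → i.1 + 1 < T → (P.signal i.2 : ℝ) = 0 →
      ∑' k, P.waitingGain u c (i.1 + 1) k = 0) :
    PureBadNews u c P.toInfo (stopFrom 0) x := by
  have hterm : IsTerminalTime P.toInfo (stopFrom 0) T := by
    have hmem : ∀ S : ℕ, P.law {ω | (S : WithTop ℕ) < stopFrom 0 ω} = 0 ↔
        ∀ i, 0 < P.weight i → i.1 + 1 ≤ S := by
      intro S
      have : P.law {ω | (S : WithTop ℕ) < stopFrom 0 ω} = 0 ↔
          ∀ᵐ ω ∂P.law, ¬ (S : WithTop ℕ) < stopFrom 0 ω := by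
        rw [MeasureTheory.ae_iff]; simp only [not_not]
      rw [this, P.ae_iff]
      refine forall_congr' fun i => forall_congr' fun _ => ?_
      rw [P.lt_stopFrom_iff]; omega
    refine ⟨(hmem T).2 hle, fun S hS => ?_⟩
    obtain ⟨i, hi, rfl⟩ := hT
    exact (hmem S).1 hS i hi
  refine ⟨T, ⟨hterm, fun t ht => ⟨?_, ?_⟩, fun t ht hpos => ?_⟩, fun S hS => hS.1.unique hterm⟩
  · exact P.stopProb_eq_zero fun i hi h => (hbefore i hi (by omega)).1
  · exact P.stopProb_eq_zero fun i hi h => (hbefore i hi (by omega)).2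
  · obtain ⟨i, hi, rfl, hz⟩ := P.exists_of_stopProb_pos hpos
    exact P.indifferentAt u c (hind i hi ht hz)

lemma fullyRevealing {x : ℝ} (h : ∀ i, 0 < P.weight i → (P.signal i.2 : ℝ) ≠ x) :
    FullyRevealing P.toInfo (stopFrom 0) x :=
  fun _ => P.stopProb_eq_zero fun i hi _ => h i hi

lemma designerPayoff_stopPath (f : Fin 2 → ℕ → ℝ) (i : ℕ × Fin 3) :
    designerPayoff u f μ₀ (stopFrom 0) (P.stopPath i) =
      f (bestAction u (P.signal i.2)) (i.1 + 1) := by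
  rw [designerPayoff, stopBelief, time_stopFrom, belief_stopPath, if_neg (by omega),
    max_eq_left (by omega)]

lemma hasSum_designerValue {f : Fin 2 → ℕ → ℝ}
    (h : Integrable (designerPayoff u f μ₀ (stopFrom 0)) P.law) :
    HasSum (fun i => P.weight i * f (bestAction u (P.signal i.2)) (i.1 + 1))
      (designerValue u f P.toInfo (stopFrom 0)) := by
  have := P.hasSum_integral h
  simp only [designerPayoff_stopPath] at this
  exact this

lemma summable_designerPayoff {f : Fin 2 → ℕ → ℝ}
    (h : Integrable (designerPayoff u f μ₀ (stopFrom 0)) P.law) :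
    Summable fun i => P.weight i * |f (bestAction u (P.signal i.2)) (i.1 + 1)| := by
  simpa only [designerPayoff_stopPath] using P.integrable_iff.1 h

/-- If all messages `S` come at time `1` and are worth no more than the prior, the DM stops at
once. -/
lemma isBestResponseFrom_zero (hc : 0 < c) (h1 : ∀ i, 0 < P.weight i → i.1 = 0)
    (hU : HasSum (fun i => P.weight i * indirectUtility u (P.signal i.2)) (indirectUtility u μ₀)) :
    IsBestResponseFrom u c P.toInfo 0 (fun _ => 0) := by
  have hstrat : IsStrategyFrom P.toInfo 0 (fun _ => (0 : WithTop ℕ)) :=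
    { stopping := isStoppingTime_const history 0
      ge := fun _ => le_rfl
      finite := ae_of_all _ fun _ => WithTop.coe_ne_top
      integrable := by
        have : (fun ω : Path => (time (fun _ => (0 : WithTop ℕ)) ω : ℝ)) = fun _ => 0 := by
          funext ω; exact Nat.cast_zero
        rw [this]; exact integrable_zero _ _ _ }
  have hval : dmValue u c P.toInfo (fun _ => 0) = indirectUtility u μ₀ := by
    have : ∀ ω, dmPayoff u c μ₀ (fun _ => (0 : WithTop ℕ)) ω = indirectUtility u μ₀ := fun ω => by
      have : time (fun _ => (0 : WithTop ℕ)) ω = 0 := rfl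
      simp [dmPayoff, stopBelief, this, belief]
    rw [dmValue]
    simp_rw [this]
    have := P.isProbabilityMeasure
    rw [toInfo_law]; simp
  suffices h : ∀ σ, IsStrategyFrom P.toInfo 0 σ → (∀ ω, σ ω = 0) ∨
      dmValue u c P.toInfo σ < dmValue u c P.toInfo (fun _ => 0) from
    ⟨hstrat, fun σ hσ => (h σ hσ).elim (fun h => by rw [funext h]) le_of_lt,
      fun σ hσ he => (h σ hσ).elim (fun h => by rw [funext h]) fun h => absurd he h.ne⟩
  intro σ hσ
  have hto : ∀ ω ω', σ ω = 0 ↔ σ ω' = 0 := fun ω ω' =>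
    mem_iff_of_agree (t := 0) (E := {ω | σ ω = 0}) (hσ.stopping.measurableSet_eq 0)
      fun k hk => absurd hk (Nat.not_lt_zero k)
  by_cases hz : σ P.neverPath = 0
  · exact Or.inl fun ω => (hto ω _).2 hz
  right
  rw [hval]
  have hsum := P.hasSum_integral (hσ.integrable_dmPayoff u c)
  have hb := hU.sub (P.hasSum_weight.mul_right c)
  rw [one_mul] at hb
  -- Waiting at all costs at least `c`, and by `hU` the signals, all received at time `1`, are worth
  -- nothing on average.
  have : dmValue u c P.toInfo σ ≤ indirectUtility u μ₀ - c := by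
    refine hasSum_le (fun i => ?_) hsum hb
    rcases (P.nonneg i).eq_or_lt with h | h
    · simp [← h]
    · rw [← mul_sub]
      refine mul_le_mul_of_nonneg_left ?_ h.le
      have hne : σ (P.stopPath i) ≠ 0 := fun h0 => hz ((hto _ _).1 h0)
      have hfin := P.ae_iff.1 hσ.finite i h
      have hpos : 1 ≤ time σ (P.stopPath i) := by
        unfold time
        cases hv : σ (P.stopPath i) with
        | top => exact absurd hv hfin
        | coe k =>
          rw [hv] at hne
          exact Nat.one_le_iff_ne_zero.2 fun hk => hne (WithTop.coe_inj.2 hk)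
      rw [dmPayoff, stopBelief, belief_stopPath, if_neg (by rw [h1 i h]; omega)]
      have : (1 : ℝ) ≤ time σ (P.stopPath i) := by exact_mod_cast hpos
      nlinarith
  linarith

end StoppingPlan

/-- With terminal time `0` the remaining requirements are vacuous. -/
lemma pureBadNews_of_zero {μ₀ : unitInterval} (I : InfoStructure μ₀) (u : Fin 2 → Fin 2 → ℝ) (c x : ℝ) :
    PureBadNews u c I (fun _ => 0) x := by
  have hterm : IsTerminalTime I (fun _ => 0) 0 :=
    ⟨by simp, fun S _ => S.zero_le⟩
  exact ⟨0, ⟨hterm, fun t ht => absurd ht t.not_lt_zero, fun t ht => absurd ht t.not_lt_zero⟩,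
    fun S hS => hS.1.unique hterm⟩

/-! ### The indifference belief and the extremal beliefs -/

section Utility

variable {u : Fin 2 → Fin 2 → ℝ} {x : ℝ}

lemma indirectUtility_zero (hu0 : u 1 0 < u 0 0) : indirectUtility u 0 = u 0 0 := by
  simp [indirectUtility, expPayoff, hu0.le]

lemma indirectUtility_one (hu1 : u 0 1 < u 1 1) : indirectUtility u 1 = u 1 1 := by
  simp [indirectUtility, expPayoff, hu1.le]

lemma expPayoff_sub (a b z : ℝ) (u : Fin 2 → Fin 2 → ℝ) (hxu : expPayoff u 0 x = expPayoff u 1 x)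
    (ha : a = u 0 0 - u 1 0) (hb : b = u 1 1 - u 0 1) :
    expPayoff u 1 z - expPayoff u 0 z = (z - x) * (a + b) := by
  subst ha hb
  unfold expPayoff at *
  linear_combination -hxu

lemma expPayoff_le_iff (hu0 : u 1 0 < u 0 0) (hu1 : u 0 1 < u 1 1)
    (hxu : expPayoff u 0 x = expPayoff u 1 x) (z : ℝ) :
    expPayoff u 0 z ≤ expPayoff u 1 z ↔ x ≤ z := by
  have h := expPayoff_sub _ _ z u hxu rfl rfl
  have hp : 0 < (u 0 0 - u 1 0) + (u 1 1 - u 0 1) := by linarith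
  constructor
  · intro hle
    have : 0 ≤ (z - x) * ((u 0 0 - u 1 0) + (u 1 1 - u 0 1)) := by linarith
    linarith [nonneg_of_mul_nonneg_left this hp]
  · intro hle
    have := mul_nonneg (sub_nonneg.2 hle) hp.le
    linarith

lemma expPayoff_ge_iff (hu0 : u 1 0 < u 0 0) (hu1 : u 0 1 < u 1 1)
    (hxu : expPayoff u 0 x = expPayoff u 1 x) (z : ℝ) :
    expPayoff u 1 z ≤ expPayoff u 0 z ↔ z ≤ x := by
  have h := expPayoff_sub _ _ z u hxu rfl rfl
  have hp : 0 < (u 0 0 - u 1 0) + (u 1 1 - u 0 1) := by linarith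
  constructor
  · intro hle
    have : 0 ≤ (x - z) * ((u 0 0 - u 1 0) + (u 1 1 - u 0 1)) := by linarith
    linarith [nonneg_of_mul_nonneg_left this hp]
  · intro hle
    have := mul_nonneg (sub_nonneg.2 hle) hp.le
    linarith

lemma bestAction_eq (hu0 : u 1 0 < u 0 0) (hu1 : u 0 1 < u 1 1)
    (hxu : expPayoff u 0 x = expPayoff u 1 x) (z : ℝ) :
    bestAction u z = if x ≤ z then 1 else 0 := by
  unfold bestAction
  simp only [expPayoff_le_iff hu0 hu1 hxu]

lemma zero_mem_extremalBeliefs : (0 : ℝ) ∈ extremalBeliefs u := by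
  refine mem_iUnion.2 ⟨∅, ?_⟩
  have : optimalRegion u ∅ = Icc 0 1 := by ext z; simp [optimalRegion]
  rw [this, extremePoints_Icc zero_le_one]; simp

lemma one_mem_extremalBeliefs : (1 : ℝ) ∈ extremalBeliefs u := by
  refine mem_iUnion.2 ⟨∅, ?_⟩
  have : optimalRegion u ∅ = Icc 0 1 := by ext z; simp [optimalRegion]
  rw [this, extremePoints_Icc zero_le_one]; simp

lemma indifference_mem_extremalBeliefs (hu0 : u 1 0 < u 0 0) (hu1 : u 0 1 < u 1 1)
    (hx : x ∈ Ioo (0 : ℝ) 1) (hxu : expPayoff u 0 x = expPayoff u 1 x) : x ∈ extremalBeliefs u := by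
  refine mem_iUnion.2 ⟨univ, ?_⟩
  have : optimalRegion u univ = {x} := by
    ext z
    simp only [optimalRegion, mem_ofPred_eq, mem_univ, true_implies, mem_singleton_iff]
    constructor
    · rintro ⟨-, h⟩
      exact le_antisymm ((expPayoff_ge_iff hu0 hu1 hxu z).1 (h 0 1))
        ((expPayoff_le_iff hu0 hu1 hxu z).1 (h 1 0))
    · rintro rfl
      refine ⟨⟨hx.1.le, hx.2.le⟩, fun a b => ?_⟩
      fin_cases a <;> fin_cases b <;> simp [hxu]
  rw [this, extremePoints_singleton]; rfl

end Utility

/-! ### Stopping plans with prescribed tails -/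

/-- `W 0`, `W 1`, `W 2` are the probabilities of stopping later with the beliefs `0`, `x`, `1`. -/
structure IsTailTriple (μ₀ : unitInterval) (x : unitInterval) (W : Fin 3 → ℕ → ℝ) : Prop where
  antitone : ∀ j, Antitone (W j)
  nonneg : ∀ j t, 0 ≤ W j t
  summable : ∀ j, Summable (W j)
  total : W 0 0 + W 1 0 + W 2 0 = 1
  mean : x * W 1 0 + W 2 0 = μ₀

namespace IsTailTriple

variable {μ₀ x : unitInterval} {W : Fin 3 → ℕ → ℝ} (h : IsTailTriple μ₀ x W)

/-- The belief of the DM who has not stopped. -/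
noncomputable def meanBelief (x : unitInterval) (W : Fin 3 → ℕ → ℝ) (t : ℕ) : unitInterval :=
  projIcc 0 1 zero_le_one ((x * W 1 t + W 2 t) / (W 0 t + W 1 t + W 2 t))

include h

lemma mul_meanBelief (t : ℕ) :
    (W 0 t + W 1 t + W 2 t) * (meanBelief x W t : ℝ) = x * W 1 t + W 2 t := by
  have h0 := h.nonneg 0 t
  have h1 := h.nonneg 1 t
  have h2 := h.nonneg 2 t
  have hx0 := x.2.1
  have hx1 := x.2.2
  rcases (show 0 ≤ W 0 t + W 1 t + W 2 t by positivity).eq_or_lt with hS | hS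
  · have e1 : W 1 t = 0 := by linarith
    have e2 : W 2 t = 0 := by linarith
    rw [← hS, e1, e2]; simp
  · have hm : (x * W 1 t + W 2 t) / (W 0 t + W 1 t + W 2 t) ∈ Icc (0 : ℝ) 1 := by
      refine ⟨by positivity, ?_⟩
      rw [div_le_one hS]
      nlinarith
    rw [meanBelief, projIcc_of_mem _ hm]
    field_simp

end IsTailTriple

open IsTailTriple in
/-- The plan with the given tails. -/
noncomputable def tailPlan {μ₀ x : unitInterval} {W : Fin 3 → ℕ → ℝ} (h : IsTailTriple μ₀ x W) :
    StoppingPlan μ₀ where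
  weight i := W i.2 i.1 - W i.2 (i.1 + 1)
  signal := ![0, x, 1]
  path := meanBelief x W
  nonneg i := sub_nonneg.2 (h.antitone _ i.1.le_succ)
  hasSum_weight := by
    have := hasSum_prod_fin (g := fun i => W i.2 i.1 - W i.2 (i.1 + 1)) (s := fun j => W j 0)
      fun j => by simpa using hasSum_telescope (h.antitone j) (h.summable j).tendsto_atTop_zero 0
    rwa [Fin.sum_univ_three, h.total] at this
  summable_time := by
    have := (hasSum_prod_fin (g := fun i => ((i.1 : ℝ) + 1) * (W i.2 i.1 - W i.2 (i.1 + 1)))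
      fun j => hasSum_abel (h.antitone j) (h.nonneg j) (h.summable j).hasSum).summable
    refine Summable.of_nonneg_of_le (fun i => mul_nonneg (sub_nonneg.2 (h.antitone _ i.1.le_succ))
      i.1.cast_nonneg) (fun i => ?_) this
    have := sub_nonneg.2 (h.antitone i.2 i.1.le_succ)
    simp only [Nat.succ_eq_add_one] at this
    nlinarith
  path_zero := by
    have := h.mul_meanBelief 0
    rw [h.total, h.mean, one_mul] at this
    exact Subtype.ext this
  mean n := by
    have := hasSum_prod_fin (g := fun i : ℕ × Fin 3 => if n ≤ i.1 then
      (W i.2 i.1 - W i.2 (i.1 + 1)) * (((![0, x, 1] : Fin 3 → unitInterval) i.2 : ℝ) - meanBelief x W n)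
      else 0) fun j => ((hasSum_telescope (h.antitone j) (h.summable j).tendsto_atTop_zero n).mul_right
        (((![0, x, 1] : Fin 3 → unitInterval) j : ℝ) - meanBelief x W n)).congr_fun
        fun r => by simp only [ite_mul, zero_mul]
    convert this using 1
    rw [Fin.sum_univ_three]
    have := h.mul_meanBelief n
    simp only [Matrix.cons_val_zero, Matrix.cons_val_one, Matrix.cons_val, Icc.coe_zero,
      Icc.coe_one]
    linarith

section TailPlan

variable {μ₀ x : unitInterval} {W : Fin 3 → ℕ → ℝ} (h : IsTailTriple μ₀ x W)
  {u : Fin 2 → Fin 2 → ℝ}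

lemma tailPlan_signal_mem (hu0 : u 1 0 < u 0 0) (hu1 : u 0 1 < u 1 1) (hx : (x : ℝ) ∈ Ioo (0 : ℝ) 1)
    (hxu : expPayoff u 0 x = expPayoff u 1 x) (j : Fin 3) :
    ((tailPlan h).signal j : ℝ) ∈ extremalBeliefs u := by
  fin_cases j
  · exact zero_mem_extremalBeliefs
  · exact indifference_mem_extremalBeliefs hu0 hu1 hx hxu
  · exact one_mem_extremalBeliefs

/-- Against taking action `1` at once, information helps only at belief `0`, as action `1` is
optimal at `x` and `1`; against action `0`, only at belief `1`. The DM would take the better of the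
two actions, which leaves the minimum of the two gains. -/
lemma tsum_waitingGain_tailPlan (hu0 : u 1 0 < u 0 0) (hu1 : u 0 1 < u 1 1)
    (hxu : expPayoff u 0 x = expPayoff u 1 x) (c : ℝ) (n : ℕ) {R : ℝ}
    (hR : HasSum (fun k => W 0 (n + k) + W 1 (n + k) + W 2 (n + k)) R) :
    ∑' i, (tailPlan h).waitingGain u c n i =
      min ((u 0 0 - u 1 0) * W 0 n) ((u 1 1 - u 0 1) * W 2 n) - c * R := by
  have hsj : ∀ j, Summable fun k => W j (k + n) := fun j => (summable_nat_add_iff n).2 (h.summable j)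
  have hR' : R = ∑ j, ∑' k, W j (k + n) := by
    rw [Fin.sum_univ_three, ← (hsj 0).tsum_add (hsj 1), ← ((hsj 0).add (hsj 1)).tsum_add (hsj 2),
      ← hR.tsum_eq]
    exact tsum_congr fun k => by simp only [add_comm]
  set m : ℝ := (IsTailTriple.meanBelief x W n : ℝ) with hm
  set y : Fin 3 → ℝ := fun j => indirectUtility u (((![0, x, 1] : Fin 3 → unitInterval) j : unitInterval) : ℝ) with hy
  have key := hasSum_prod_fin (g := (tailPlan h).waitingGain u c n)
    (s := fun j => W j n * (y j - indirectUtility u m) - c * ∑' k, W j (k + n)) fun j => by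
      refine (((hasSum_telescope (h.antitone j) (h.summable j).tendsto_atTop_zero n).mul_right
        (y j - indirectUtility u m)).sub ((hasSum_abel_from (h.antitone j) (h.nonneg j) n
          (hsj j).hasSum).mul_left c)).congr_fun fun r => ?_
      simp only [StoppingPlan.waitingGain, tailPlan, hy, hm]
      split_ifs
      · ring
      · ring
  rw [key.tsum_eq, Finset.sum_sub_distrib, ← Finset.mul_sum, ← hR', Fin.sum_univ_three]
  congr 1
  have e0 : y 0 = u 0 0 := by
    simp only [hy, Matrix.cons_val_zero, Icc.coe_zero]; exact indirectUtility_zero hu0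
  have e1 : y 1 = expPayoff u 1 x := by
    simp only [hy, Matrix.cons_val_one, Matrix.cons_val_zero]
    rw [indirectUtility, hxu, max_self]
  have e2 : y 2 = u 1 1 := by
    simp only [hy, Matrix.cons_val, Icc.coe_one]; exact indirectUtility_one hu1
  rw [e0, e1, e2]
  have hS : (W 0 n + W 1 n + W 2 n) * m = x * W 1 n + W 2 n := h.mul_meanBelief n
  have hSn : 0 ≤ W 0 n + W 1 n + W 2 n :=
    add_nonneg (add_nonneg (h.nonneg _ _) (h.nonneg _ _)) (h.nonneg _ _)
  have hmax : (W 0 n + W 1 n + W 2 n) * indirectUtility u m =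
      max ((W 0 n + W 1 n + W 2 n) * expPayoff u 0 m) ((W 0 n + W 1 n + W 2 n) * expPayoff u 1 m) :=
    mul_max_of_nonneg _ _ hSn
  have f0 : (u 1 1 - u 0 1) * W 2 n = W 0 n * u 0 0 + W 1 n * expPayoff u 1 x + W 2 n * u 1 1
      - (W 0 n + W 1 n + W 2 n) * expPayoff u 0 m := by
    rw [← hxu]; unfold expPayoff; linear_combination (u 0 1 - u 0 0) * hS
  have f1 : (u 0 0 - u 1 0) * W 0 n = W 0 n * u 0 0 + W 1 n * expPayoff u 1 x + W 2 n * u 1 1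
      - (W 0 n + W 1 n + W 2 n) * expPayoff u 1 m := by
    unfold expPayoff; linear_combination (u 1 1 - u 1 0) * hS
  rw [f0, f1, min_comm, min_sub_sub_left, ← hmax]
  ring

/-- Beliefs `x` and `1` both lead to action `1`, at `x` by the tie-breaking rule, so their tails
enter through their sum only. -/
lemma designerValue_tailPlan (hu0 : u 1 0 < u 0 0) (hu1 : u 0 1 < u 1 1) (hx : (x : ℝ) ∈ Ioo (0 : ℝ) 1)
    (hxu : expPayoff u 0 x = expPayoff u 1 x) {f : Fin 2 → ℕ → ℝ}
    (hint : Integrable (designerPayoff u f μ₀ (stopFrom 0)) (tailPlan h).law) :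
    designerValue u f (tailPlan h).toInfo (stopFrom 0) =
      tailPayoff (fun t => f 0 (t + 1)) (fun t => f 1 (t + 1)) (W 0) (fun t => W 1 t + W 2 t) := by
  have hs := (tailPlan h).hasSum_designerValue u hint
  have b0 : bestAction u 0 = 0 := by rw [bestAction_eq hu0 hu1 hxu, if_neg (not_le.2 hx.1)]
  have b1 : bestAction u x = 1 := by rw [bestAction_eq hu0 hu1 hxu, if_pos le_rfl]
  have b2 : bestAction u 1 = 1 := by rw [bestAction_eq hu0 hu1 hxu, if_pos hx.2.le]
  let φ : Fin 3 → Fin 2 := ![0, 1, 1]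
  have hφ : ∀ j, bestAction u ((tailPlan h).signal j) = φ j := fun j => by
    fin_cases j
    · exact b0
    · exact b1
    · exact b2
  replace hs : HasSum (fun i : ℕ × Fin 3 => (W i.2 i.1 - W i.2 (i.1 + 1)) * f (φ i.2) (i.1 + 1))
      (designerValue u f (tailPlan h).toInfo (stopFrom 0)) :=
    hs.congr_fun fun i => by rw [hφ]; rfl
  have hj : ∀ j, Summable fun t : ℕ => (W j t - W j (t + 1)) * f (φ j) (t + 1) := fun j =>
    hs.summable.comp_injective (i := fun t : ℕ => ((t, j) : ℕ × Fin 3))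
      fun a b hab => congrArg Prod.fst hab
  have hsum := hasSum_prod_fin (g := fun i : ℕ × Fin 3 => (W i.2 i.1 - W i.2 (i.1 + 1)) * f (φ i.2) (i.1 + 1))
    fun j => (hj j).hasSum
  rw [hs.unique hsum, Fin.sum_univ_three, ← (hj 0).tsum_add (hj 1),
    ← ((hj 0).add (hj 1)).tsum_add (hj 2)]
  refine tsum_congr fun t => ?_
  simp only [φ, Matrix.cons_val_zero, Matrix.cons_val_one, Matrix.cons_val]
  ring

end TailPlan

/-! ### From feasible tails to information structures -/

/-- The tails of stopping with the beliefs `0`, `x`, `1`, when stopping with `x` precedes stopping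
with `1`. -/
noncomputable def tailTriple (α β δ : ℝ) (A Q : ℕ → ℝ) : Fin 3 → ℕ → ℝ :=
  ![A, fun t => Q t - min ((α * A 0 + δ) / β) (Q t), fun t => min ((α * A 0 + δ) / β) (Q t)]

section Construction

variable {μ₀ x : unitInterval} {α β δ : ℝ} {A Q : ℕ → ℝ} {u : Fin 2 → Fin 2 → ℝ} {c : ℝ}

/-- The quotient is the probability of stopping with belief `1`, pinned down by the prior; it fits
into `Q 0` because `A 0 ≤ 1 - μ₀`. -/
lemma TailFeasible.div_le (hβ : 0 < β) (hxα : (1 - x) * α = x * β) (hδ : x * δ = (μ₀ - x) * α)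
    (hx : (x : ℝ) ∈ Ioo (0 : ℝ) 1) (h : TailFeasible α β δ (1 - μ₀) A Q) :
    (α * A 0 + δ) / β ≤ Q 0 := by
  rw [div_le_iff₀ hβ]
  have h1 := h.total
  have h2 := h.le
  have hx1 : 0 < 1 - (x : ℝ) := by linarith [hx.2]
  have hα : α = x * β / (1 - x) := by field_simp; linarith
  have key : (x : ℝ) * (1 - x) * (Q 0 * β - (α * A 0 + δ)) = x * β * (1 - μ₀ - A 0) := by
    rw [show Q 0 = 1 - A 0 by linarith]
    linear_combination (-(1 - (x : ℝ))) * hδ + (-(x : ℝ) * A 0 - (μ₀ - x)) * hxα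
  have : 0 ≤ (x : ℝ) * (1 - x) * (Q 0 * β - (α * A 0 + δ)) := by
    rw [key]; exact mul_nonneg (mul_pos hx.1 hβ).le (by linarith)
  have := nonneg_of_mul_nonneg_right this (mul_pos hx.1 hx1)
  linarith

lemma TailFeasible.nonneg_div (hβ : 0 < β) {M : ℝ} (h : TailFeasible α β δ M A Q) :
    0 ≤ (α * A 0 + δ) / β :=
  div_nonneg (by simpa using h.sum_le_prior 0) hβ.le

lemma TailFeasible.isTailTriple (hβ : 0 < β) (hxα : (1 - x) * α = x * β)
    (hδ : x * δ = (μ₀ - x) * α) (hx : (x : ℝ) ∈ Ioo (0 : ℝ) 1)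
    (h : TailFeasible α β δ (1 - μ₀) A Q) : IsTailTriple μ₀ x (tailTriple α β δ A Q) := by
  have hle := h.div_le hβ hxα hδ hx
  have h0 := h.nonneg_div hβ
  set d := (α * A 0 + δ) / β with hd
  have hdβ : d * β = α * A 0 + δ := by rw [hd]; field_simp
  obtain ⟨R, hR, -⟩ := h.exists_tail
  have hS := (hR.hasSum h.nonneg_fst h.nonneg_snd 0).summable
  simp only [zero_add] at hS
  have hsA : Summable A := Summable.of_nonneg_of_le h.nonneg_fst (fun t => by linarith [h.nonneg_snd t]) hS
  have hsQ : Summable Q := Summable.of_nonneg_of_le h.nonneg_snd (fun t => by linarith [h.nonneg_fst t]) hS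
  have hdn : ∀ t, 0 ≤ min d (Q t) := fun t => le_min h0 (h.nonneg_snd t)
  have hsD : Summable fun t => min d (Q t) :=
    Summable.of_nonneg_of_le hdn (fun t => min_le_right _ _) hsQ
  refine ⟨fun j => ?_, fun j t => ?_, fun j => ?_, ?_, ?_⟩
  · fin_cases j
    · exact h.antitone_fst
    -- The tail for belief `x` is the positive part of `Q t - d`.
    · intro s t hst
      have := h.antitone_snd hst
      change Q t - min d (Q t) ≤ Q s - min d (Q s)
      rcases le_total d (Q t) with h1 | h1
      · rw [min_eq_left h1, min_eq_left (h1.trans this)]; linarith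
      · rw [min_eq_right h1, sub_self]; linarith [min_le_right d (Q s)]
    · exact fun s t hst => min_le_min le_rfl (h.antitone_snd hst)
  · fin_cases j
    · exact h.nonneg_fst t
    · exact sub_nonneg.2 (min_le_right _ _)
    · exact hdn t
  · fin_cases j
    · exact hsA
    · exact hsQ.sub hsD
    · exact hsD
  · simp only [tailTriple, Matrix.cons_val_zero, Matrix.cons_val_one, Matrix.cons_val]
    linarith [h.total]
  · simp only [tailTriple, Matrix.cons_val_one, Matrix.cons_val_zero, Matrix.cons_val]
    rw [← hd, min_eq_left hle, show Q 0 = 1 - A 0 by linarith [h.total]]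
    have key : (x * β) * ((x : ℝ) * (1 - A 0 - d) + d - μ₀) = 0 := by
      linear_combination ((x : ℝ) - (x : ℝ) ^ 2) * hdβ + (1 - (x : ℝ)) * hδ + (x * A 0 + (μ₀ - x)) * hxα
    have := (mul_eq_zero.1 key).resolve_left (mul_pos hx.1 hβ).ne'
    linarith

lemma TailFeasible.tsum_waitingGain (hu0 : u 1 0 < u 0 0) (hu1 : u 0 1 < u 1 1)
    (hxu : expPayoff u 0 x = expPayoff u 1 x)
    (hαc : α * c = u 0 0 - u 1 0) (hβc : β * c = u 1 1 - u 0 1) (hc : 0 < c)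
    (h : TailFeasible α β δ (1 - μ₀) A Q) (ht : IsTailTriple μ₀ x (tailTriple α β δ A Q))
    {R : ℕ → ℝ} (hR : IsTail A Q R) (n : ℕ) :
    ∑' i, (tailPlan ht).waitingGain u c n i =
      c * (min (α * A n) (β * min ((α * A 0 + δ) / β) (Q n)) - R n) := by
  rw [tsum_waitingGain_tailPlan ht hu0 hu1 hxu c n (R := R n), ← hαc, ← hβc]
  · simp only [tailTriple, Matrix.cons_val_zero, Matrix.cons_val]
    rw [mul_sub, mul_min_of_nonneg _ _ hc.le]
    congr 2 <;> ring
  · refine (hR.hasSum h.nonneg_fst h.nonneg_snd n).congr_fun fun k => ?_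
    simp only [tailTriple, Matrix.cons_val_zero, Matrix.cons_val_one, Matrix.cons_val]
    ring

/-- Every feasible pair of tails comes from an extremal and obedient structure. -/
theorem TailFeasible.exists_infoStructure (hu0 : u 1 0 < u 0 0) (hu1 : u 0 1 < u 1 1)
    (hx : (x : ℝ) ∈ Ioo (0 : ℝ) 1) (hxu : expPayoff u 0 x = expPayoff u 1 x) (hc : 0 < c)
    (hαc : α * c = u 0 0 - u 1 0) (hβc : β * c = u 1 1 - u 0 1) (hβ : 0 < β)
    (hxα : (1 - x) * α = x * β) (hδ : x * δ = (μ₀ - x) * α)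
    (h : TailFeasible α β δ (1 - μ₀) A Q) :
    ∃ (I : InfoStructure μ₀) (τ : Path → WithTop ℕ), Induces u c I τ ∧ IsExtremalObedient u c I ∧
      PaysAttention I τ ∧
      (∀ f : Fin 2 → ℕ → ℝ, Integrable (designerPayoff u f μ₀ τ) I.law →
        designerValue u f I τ = tailPayoff (fun t => f 0 (t + 1)) (fun t => f 1 (t + 1)) A Q ∧
        (Summable fun t => (A t - A (t + 1)) * |f 0 (t + 1)|) ∧
        (Summable fun t => (Q t - Q (t + 1)) * |f 1 (t + 1)|)) ∧
      (A 0 = 1 - μ₀ → FullyRevealing I τ x) ∧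
      ((∃ T, 1 ≤ T ∧ 0 < Q 0 ∧ (∀ t < T, Q t = Q 0) ∧ A T = 0 ∧ Q T = 0 ∧
        ∀ R, IsTail A Q R → ∀ t, t + 1 < T → A (t + 1) < A t → R (t + 1) = α * A (t + 1)) →
        PureBadNews u c I τ x) := by
  have ht := h.isTailTriple hβ hxα hδ hx
  obtain ⟨R, hR, hRA, hRQ, hR0⟩ := h.exists_tail
  have hRanti := hR.antitone h.nonneg_fst h.nonneg_snd
  have hdβ : β * ((α * A 0 + δ) / β) = α * A 0 + δ := by field_simp
  -- The relaxed bounds suffice because belief `1` comes last: its tail is the minimum of its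
  -- initial value and `Q n`, and `R n` is bounded through `R 0` and through `Q n`.
  have hRD : ∀ n, R n ≤ β * min ((α * A 0 + δ) / β) (Q n) := fun n => by
    rw [mul_min_of_nonneg _ _ hβ.le, hdβ]
    exact le_min ((hRanti n.zero_le).trans hR0) (hRQ n)
  have hgain := h.tsum_waitingGain hu0 hu1 hxu hαc hβc hc ht hR
  have hobey : ∀ n, 0 ≤ ∑' i, (tailPlan ht).waitingGain u c n i := fun n => by
    rw [hgain]
    exact mul_nonneg hc.le (sub_nonneg.2 (le_min (hRA n) (hRD n)))
  have hx0 : (x : ℝ) ≠ 0 := hx.1.ne'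
  have hx1 : (x : ℝ) ≠ 1 := hx.2.ne
  refine ⟨(tailPlan ht).toInfo, stopFrom 0,
    (tailPlan ht).isBestResponseFrom_stopFrom u c hc fun n _ => hobey n,
    (tailPlan ht).isExtremalObedient u c hc (tailPlan_signal_mem ht hu0 hu1 hx hxu) fun n _ => hobey n,
    (tailPlan ht).paysAttention, fun f hf => ⟨?_, ?_⟩, fun hfull => ?_, ?_⟩
  · rw [designerValue_tailPlan ht hu0 hu1 hx hxu hf]
    simp [tailTriple]
  · have hs := (tailPlan ht).summable_designerPayoff u hf
    have hj : ∀ j, Summable fun t : ℕ => (tailPlan ht).weight (t, j) *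
        |f (bestAction u ((tailPlan ht).signal j)) (t + 1)| := fun j =>
      hs.comp_injective (i := fun t : ℕ => ((t, j) : ℕ × Fin 3)) fun a b hab => congrArg Prod.fst hab
    have b0 : bestAction u ((tailPlan ht).signal 0) = 0 := by
      rw [bestAction_eq hu0 hu1 hxu]; exact if_neg (not_le.2 hx.1)
    have b1 : bestAction u ((tailPlan ht).signal 1) = 1 := by
      rw [bestAction_eq hu0 hu1 hxu]; exact if_pos le_rfl
    have b2 : bestAction u ((tailPlan ht).signal 2) = 1 := by
      rw [bestAction_eq hu0 hu1 hxu]; exact if_pos hx.2.le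
    have j0 := hj 0
    have j1 := hj 1
    have j2 := hj 2
    rw [b0] at j0
    rw [b1] at j1
    rw [b2] at j2
    refine ⟨j0, (j1.add j2).congr fun t => ?_⟩
    simp only [tailPlan, tailTriple, Matrix.cons_val_one, Matrix.cons_val_zero, Matrix.cons_val]
    ring
  -- At `A 0 = 1 - μ₀` belief `1` takes up all of the upper stopping, and nothing is left for `x`.
  · have hd : (α * A 0 + δ) / β = Q 0 := by
      refine le_antisymm (h.div_le hβ hxα hδ hx) ?_
      rw [le_div_iff₀ hβ, show Q 0 = 1 - A 0 by linarith [h.total], hfull]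
      have : (x : ℝ) * (((1 - (1 - μ₀)) * β) - (α * (1 - μ₀) + δ)) = 0 := by
        linear_combination (-1 : ℝ) * hδ - (μ₀ : ℝ) * hxα
      have := (mul_eq_zero.1 this).resolve_left hx0
      linarith
    refine (tailPlan ht).fullyRevealing fun i hi => ?_
    obtain ⟨t, j⟩ := i
    fin_cases j
    · exact hx0.symm
    · exfalso
      have hz : ∀ t, min ((α * A 0 + δ) / β) (Q t) = Q t := fun t => by
        rw [hd]; exact min_eq_right (h.antitone_snd t.zero_le)
      change 0 < (Q t - min ((α * A 0 + δ) / β) (Q t)) - (Q (t + 1) - min ((α * A 0 + δ) / β) (Q (t + 1))) at hi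
      rw [hz, hz, sub_self, sub_self, sub_self] at hi
      exact lt_irrefl _ hi
    · exact hx1.symm
  · rintro ⟨T, hT1, hQ0, hconst, hAT, hQT, hind⟩
    have hAz : ∀ t, T ≤ t → A t = 0 := fun t htT =>
      le_antisymm (hAT ▸ h.antitone_fst htT) (h.nonneg_fst t)
    have hQz : ∀ t, T ≤ t → Q t = 0 := fun t htT =>
      le_antisymm (hQT ▸ h.antitone_snd htT) (h.nonneg_snd t)
    have hw1 : ∀ t, (tailPlan ht).weight (t, 1) =
      (Q t - min ((α * A 0 + δ) / β) (Q t)) - (Q (t + 1) - min ((α * A 0 + δ) / β) (Q (t + 1))) :=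
      fun _ => rfl
    have hw2 : ∀ t, (tailPlan ht).weight (t, 2) =
      min ((α * A 0 + δ) / β) (Q t) - min ((α * A 0 + δ) / β) (Q (t + 1)) := fun _ => rfl
    have hw0 : ∀ t, (tailPlan ht).weight (t, 0) = A t - A (t + 1) := fun _ => rfl
    have hbefore : ∀ t j, j ≠ 0 → t + 1 < T → (tailPlan ht).weight (t, j) = 0 := by
      intro t j hj htT
      have e1 := hconst t (by omega)
      have e2 := hconst (t + 1) htT
      fin_cases j
      · exact absurd rfl hj
      · change (tailPlan ht).weight (t, 1) = 0; rw [hw1, e1, e2, sub_self]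
      · change (tailPlan ht).weight (t, 2) = 0; rw [hw2, e1, e2, sub_self]
    refine (tailPlan ht).pureBadNews u c (T := T) (fun i hi => ?_) ?_ (fun i hi hlt => ?_)
      (fun i hi hlt _ => ?_)
    · obtain ⟨t, j⟩ := i
      by_contra hc'
      have hle : T ≤ t := by simp only at hc'; omega
      have e1 := hQz t hle
      have e2 := hQz (t + 1) (by omega)
      have e3 := hAz t hle
      have e4 := hAz (t + 1) (by omega)
      fin_cases j
      · change 0 < (tailPlan ht).weight (t, 0) at hi; rw [hw0, e3, e4, sub_self] at hi; exact lt_irrefl _ hi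
      · change 0 < (tailPlan ht).weight (t, 1) at hi; rw [hw1, e1, e2, sub_self] at hi; exact lt_irrefl _ hi
      · change 0 < (tailPlan ht).weight (t, 2) at hi; rw [hw2, e1, e2, sub_self] at hi; exact lt_irrefl _ hi
    -- All upper stopping occurs at time `T`, so one of its two beliefs has positive weight there.
    · have hsum : (tailPlan ht).weight (T - 1, 1) + (tailPlan ht).weight (T - 1, 2) = Q 0 := by
        rw [hw1, hw2, show T - 1 + 1 = T by omega, hconst (T - 1) (by omega), hQT]; ring
      rcases ((tailPlan ht).nonneg (T - 1, 1)).eq_or_lt with h1 | h1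
      · exact ⟨(T - 1, 2), by linarith, by simp only; omega⟩
      · exact ⟨(T - 1, 1), h1, by simp only; omega⟩
    · obtain ⟨t, j⟩ := i
      by_cases hj : j = 0
      · subst hj; exact ⟨hx0.symm, (zero_ne_one : (0 : ℝ) ≠ 1)⟩
      · exact absurd (hbefore t j hj hlt) hi.ne'
    · obtain ⟨t, j⟩ := i
      by_cases hj : j = 0
      · subst hj
        have hbind := hind R hR t hlt (by rw [hw0] at hi; linarith)
        rw [hgain]
        simp only
        rw [min_eq_left (hbind ▸ hRD (t + 1)), hbind, sub_self, mul_zero]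
      · exact absurd (hbefore t j hj hlt) hi.ne'

/-- There is an extremal and obedient structure under which the DM stops at once. -/
theorem exists_infoStructure_zero (hu0 : u 1 0 < u 0 0) (hu1 : u 0 1 < u 1 1)
    (hx : (x : ℝ) ∈ Ioo (0 : ℝ) 1) (hxu : expPayoff u 0 x = expPayoff u 1 x) (hc : 0 < c) :
    ∃ I : InfoStructure μ₀, Induces u c I (fun _ => 0) ∧ IsExtremalObedient u c I := by
  -- The prior is split between `x` and the extreme belief on its own side of `x`. There
  -- `indirectUtility` is affine, so the information has no value.
  obtain ⟨q, hq0, hqs, hqm, hqU⟩ : ∃ q : Fin 3 → ℝ, (∀ j, 0 ≤ q j) ∧ q 0 + q 1 + q 2 = 1 ∧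
      x * q 1 + q 2 = μ₀ ∧ q 0 * indirectUtility u 0 + q 1 * indirectUtility u x +
        q 2 * indirectUtility u 1 = indirectUtility u μ₀ := by
    have hm0 := μ₀.2.1
    have hm1 := μ₀.2.2
    have hx0 := hx.1
    have hx1 : 0 < 1 - (x : ℝ) := by linarith [hx.2]
    rcases le_total (x : ℝ) μ₀ with hle | hle
    · refine ⟨![0, (1 - μ₀) / (1 - x), (μ₀ - x) / (1 - x)], fun j => ?_, ?_, ?_, ?_⟩
      · fin_cases j
        · exact le_rfl
        · exact div_nonneg (by linarith) hx1.le
        · exact div_nonneg (by linarith) hx1.le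
      · simp only [Matrix.cons_val_zero, Matrix.cons_val_one, Matrix.cons_val]; field_simp; ring
      · simp only [Matrix.cons_val_zero, Matrix.cons_val_one, Matrix.cons_val]; field_simp; ring
      · simp only [Matrix.cons_val_zero, Matrix.cons_val_one, Matrix.cons_val]
        rw [indirectUtility_one hu1]
        unfold indirectUtility
        rw [max_eq_right ((expPayoff_le_iff hu0 hu1 hxu _).2 hle), hxu, max_self]
        unfold expPayoff; field_simp; ring
    · refine ⟨![1 - μ₀ / x, μ₀ / x, 0], fun j => ?_, ?_, ?_, ?_⟩
      · fin_cases j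
        · exact sub_nonneg.2 ((div_le_one hx0).2 hle)
        · exact div_nonneg hm0 hx0.le
        · exact le_rfl
      · simp only [Matrix.cons_val_zero, Matrix.cons_val_one, Matrix.cons_val]; ring
      · simp only [Matrix.cons_val_one, Matrix.cons_val_zero, Matrix.cons_val]; field_simp; ring
      · simp only [Matrix.cons_val_zero, Matrix.cons_val_one, Matrix.cons_val]
        rw [indirectUtility_zero hu0]
        unfold indirectUtility
        rw [max_eq_left ((expPayoff_ge_iff hu0 hu1 hxu _).2 hle), ← hxu, max_self]
        unfold expPayoff; field_simp; ring
  let W : Fin 3 → ℕ → ℝ := fun j t => if t = 0 then q j else 0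
  have hW1 : ∀ j t, 1 ≤ t → W j t = 0 := fun j t ht => if_neg (by omega)
  have ht : IsTailTriple μ₀ x W := by
    refine ⟨fun j => antitone_nat_of_succ_le fun t => ?_, fun j t => ?_, fun j => ?_, hqs, hqm⟩
    · rw [hW1 j (t + 1) (by omega)]
      simp only [W]; split_ifs <;> simp [hq0]
    · simp only [W]; split_ifs <;> simp [hq0]
    · exact summable_of_ne_finset_zero (s := {0}) fun t ht => if_neg (by simpa using ht)
  have hpos : ∀ i, 0 < (tailPlan ht).weight i → i.1 = 0 := by
    rintro ⟨t, j⟩ hi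
    by_contra hne
    change 0 < W j t - W j (t + 1) at hi
    rw [hW1 j t (Nat.one_le_iff_ne_zero.2 hne), hW1 j (t + 1) (by omega), sub_self] at hi
    exact lt_irrefl _ hi
  have hobey : ∀ n, 1 ≤ n → 0 ≤ ∑' i, (tailPlan ht).waitingGain u c n i := by
    intro n hn
    rw [tsum_waitingGain_tailPlan ht hu0 hu1 hxu c n (R := 0), hW1 0 n hn, hW1 2 n hn]
    · simp
    · simp only [hW1 _ (n + _) (hn.trans (Nat.le_add_right n _)), add_zero]
      exact hasSum_zero
  refine ⟨(tailPlan ht).toInfo, (tailPlan ht).isBestResponseFrom_zero u c hc hpos ?_,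
    (tailPlan ht).isExtremalObedient u c hc (tailPlan_signal_mem ht hu0 hu1 hx hxu) hobey⟩
  rw [← hqU]
  have := hasSum_prod_fin (g := fun i => (tailPlan ht).weight i *
    indirectUtility u ((tailPlan ht).signal i.2)) (s := fun j => q j *
    indirectUtility u ((tailPlan ht).signal j)) fun j => by
      have := (hasSum_telescope (ht.antitone j) (ht.summable j).tendsto_atTop_zero 0).mul_right
        (indirectUtility u ((tailPlan ht).signal j))
      exact this.congr_fun fun t => by simp [tailPlan]
  rw [Fin.sum_univ_three] at this
  exact this

end Construction

/-! ### Uniform decay of the survival probabilities -/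

section Domination

variable {α β δ M x : ℝ} {F₀ F₁ : ℕ → ℝ}

/-- The two constraints, weighted by `1 - x` and `x`, give `R t ≤ G * (A t + Q t)`. Since `A t + Q
t` is the decrease of `R`, each period shrinks `R` at least by the factor `1 - 1 / G`. -/
lemma TailFeasible.tail_bound {G : ℝ} {A Q R : ℕ → ℝ} (hG : 0 < G) (hx0 : 0 ≤ x) (hx1 : x ≤ 1)
    (hGα : G = (1 - x) * α) (hGβ : G = x * β) (h : TailFeasible α β δ M A Q) (hR : IsTail A Q R)
    (hRA : ∀ t, R t ≤ α * A t) (hRQ : ∀ t, R t ≤ β * Q t) (hρ : 0 ≤ 1 - 1 / G) (t : ℕ) :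
    A t + Q t ≤ G * (1 - 1 / G) ^ t := by
  have hRS : ∀ t, R t ≤ G * (A t + Q t) := fun t => by
    have h1 := mul_le_mul_of_nonneg_left (hRA t) (sub_nonneg.2 hx1)
    have h2 := mul_le_mul_of_nonneg_left (hRQ t) hx0
    have e1 : (1 - x) * (α * A t) = G * A t := by rw [hGα]; ring
    have e2 : x * (β * Q t) = G * Q t := by rw [hGβ]; ring
    linarith
  have hstep : ∀ t, R (t + 1) ≤ (1 - 1 / G) * R t := fun t => by
    have h1 : R t / G ≤ A t + Q t := by rw [div_le_iff₀ hG]; linarith [hRS t]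
    have h2 := hR.rec_eq t
    have h3 : (1 - 1 / G) * R t = R t - R t / G := by ring
    linarith
  have hR0 : R 0 ≤ G := by simpa [h.total] using hRS 0
  have hpow : R t ≤ G * (1 - 1 / G) ^ t := by
    induction t with
    | zero => simpa using hR0
    | succ t ih =>
      calc R (t + 1) ≤ (1 - 1 / G) * R t := hstep t
        _ ≤ (1 - 1 / G) * (G * (1 - 1 / G) ^ t) := mul_le_mul_of_nonneg_left ih hρ
        _ = G * (1 - 1 / G) ^ (t + 1) := by ring
  linarith [hR.rec_eq t, hR.nonneg h.nonneg_fst h.nonneg_snd (t + 1)]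

/-- If waiting is strictly worthwhile at the prior, there is a structure whose survival
probabilities decay as slowly as possible. -/
lemma exists_slow_tailFeasible {G : ℝ} (hx : x ∈ Ioo (0 : ℝ) 1)
    (hM : M ∈ Ioo (0 : ℝ) 1) (hG : 1 < G) (hGα : G = (1 - x) * α) (hGβ : G = x * β)
    (hMβ : β * (1 - M) = α * M + δ) (h1 : 1 < α * M) (h2 : 1 < α * M + δ) :
    ∃ (A Q : ℕ → ℝ) (a q : ℝ), 0 < a ∧ 0 < q ∧ TailFeasible α β δ M A Q ∧
      (∀ t, A (t + 1) = a * (1 - 1 / G) ^ t) ∧ ∀ t, Q (t + 1) = q * (1 - 1 / G) ^ t := by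
  have hG0 : 0 < G := by linarith
  have hx1 : 0 < 1 - x := by linarith [hx.2]
  have hρ0 : 0 ≤ 1 - 1 / G := by rw [sub_nonneg, div_le_one hG0]; exact hG.le
  have hρ1 : 1 - 1 / G ≤ 1 := by linarith [one_div_pos.2 hG0]
  have hGρ : G * (1 - 1 / G) = G - 1 := by field_simp
  set ρ := 1 - 1 / G with hρ
  -- `ε` will be the probability of waiting beyond time `1`; `h1` and `h2` leave room for it.
  obtain ⟨ε, hε, hε1, hε2, hε3, hε4⟩ : ∃ ε, 0 < ε ∧ G * ε ≤ α * M - 1 ∧ G * ε ≤ α * M + δ - 1 ∧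
      ε ≤ M ∧ ε ≤ 1 - M := by
    refine ⟨min (min ((α * M - 1) / G) ((α * M + δ - 1) / G)) (min M (1 - M)), ?_, ?_, ?_, ?_, ?_⟩
    · exact lt_min (lt_min (div_pos (by linarith) hG0) (div_pos (by linarith) hG0))
        (lt_min hM.1 (by linarith [hM.2]))
    · rw [← le_div_iff₀' hG0]; exact (min_le_left _ _).trans (min_le_left _ _)
    · rw [← le_div_iff₀' hG0]; exact (min_le_left _ _).trans (min_le_right _ _)
    · exact (min_le_right _ _).trans (min_le_left _ _)
    · exact (min_le_right _ _).trans (min_le_right _ _)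
  have hpow : ∀ t : ℕ, 0 ≤ ρ ^ t := fun t => pow_nonneg hρ0 t
  have hpow1 : ∀ t : ℕ, ρ ^ (t + 1) ≤ ρ ^ t := fun t => pow_le_pow_of_le_one hρ0 hρ1 t.le_succ
  have ha : 0 < ε * (1 - x) := mul_pos hε hx1
  have hq : 0 < ε * x := mul_pos hε hx.1
  -- From time `1` on the tails are in the proportion `1 - x` to `x`, so both constraints bind and
  -- the decay is the slowest possible.
  refine ⟨fun t => Nat.casesOn t M fun s => ε * (1 - x) * ρ ^ s,
    fun t => Nat.casesOn t (1 - M) fun s => ε * x * ρ ^ s, ε * (1 - x), ε * x, ha, hq, ?_,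
    fun _ => rfl, fun _ => rfl⟩
  refine TailFeasible.of_tail (R := fun t => Nat.casesOn t (1 + G * ε) fun s => G * ε * ρ ^ s)
    (antitone_nat_of_succ_le fun t => ?_) (antitone_nat_of_succ_le fun t => ?_) (fun t => ?_)
    (fun t => ?_) ?_ le_rfl (fun t => ?_) (fun t => ?_) (fun t => ?_) (fun t => ?_) ?_
  · cases t with
    | zero => change ε * (1 - x) * ρ ^ 0 ≤ M; rw [pow_zero, mul_one]; nlinarith [hx.1]
    | succ t => exact mul_le_mul_of_nonneg_left (hpow1 t) ha.le
  · cases t with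
    | zero => change ε * x * ρ ^ 0 ≤ 1 - M; rw [pow_zero, mul_one]; nlinarith [hx.2]
    | succ t => exact mul_le_mul_of_nonneg_left (hpow1 t) hq.le
  · cases t with
    | zero => exact hM.1.le
    | succ t => exact mul_nonneg ha.le (hpow t)
  · cases t with
    | zero => exact sub_nonneg.2 hM.2.le
    | succ t => exact mul_nonneg hq.le (hpow t)
  · simp
  · cases t with
    | zero => simp
    | succ t => simp only [pow_succ]; linear_combination (-(ε * ρ ^ t)) * hGρ
  · cases t with
    | zero => change 0 ≤ 1 + G * ε; positivity
    | succ t => exact mul_nonneg (mul_pos hG0 hε).le (hpow t)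
  · cases t with
    | zero => change 1 + G * ε ≤ α * M; linarith
    | succ t => simp only; rw [hGα]; exact le_of_eq (by ring)
  · cases t with
    | zero => change 1 + G * ε ≤ β * (1 - M); linarith
    | succ t => simp only; rw [hGβ]; exact le_of_eq (by ring)
  · change 1 + G * ε ≤ α * M + δ; linarith

/-- The survival probabilities of all feasible pairs of tails are dominated by a sequence that makes
the payoff summable. -/
theorem exists_dominating (hα : 0 < α) (hβ : 0 < β) (hx : x ∈ Ioo (0 : ℝ) 1)
    (hM : M ∈ Ioo (0 : ℝ) 1) (hxα : (1 - x) * α = x * β) (hMβ : (α + β) * M = β - δ)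
    (hs : ∀ A Q, TailFeasible α β δ M A Q → (Summable fun t => (A t - A (t + 1)) * |F₀ t|) ∧
      Summable fun t => (Q t - Q (t + 1)) * |F₁ t|) :
    ∃ w : ℕ → ℝ, (∀ A Q, TailFeasible α β δ M A Q → ∀ t, A t + Q t ≤ w t) ∧
      (Summable fun t => w t * |F₀ t|) ∧ Summable fun t => w t * |F₁ t| := by
  by_cases hcase : 1 < α * M ∧ 1 < α * M + δ
  · obtain ⟨h1, h2⟩ := hcase
    set G := x * β with hG
    have hG0 : 0 < G := mul_pos hx.1 hβ
    have hMβ' : β * (1 - M) = α * M + δ := by linarith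
    have hG1 : 1 < G := by
      have e1 : (1 - x) * 1 < (1 - x) * (α * M) := mul_lt_mul_of_pos_left h1 (by linarith [hx.2])
      have e2 : x * 1 < x * (β * (1 - M)) := mul_lt_mul_of_pos_left (by linarith) hx.1
      have e3 : (1 - x) * (α * M) = G * M := by rw [← hxα]; ring
      have e4 : x * (β * (1 - M)) = G * (1 - M) := by rw [hG]; ring
      linarith
    have hρ0 : 0 ≤ 1 - 1 / G := by rw [sub_nonneg, div_le_one hG0]; exact hG1.le
    obtain ⟨A, Q, a, q, ha, hq, hAQ, eA, eQ⟩ :=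
      exists_slow_tailFeasible hx hM hG1 hxα.symm hG hMβ' h1 h2
    obtain ⟨s0, s1⟩ := hs A Q hAQ
    -- The drops of a geometric sequence are a fixed multiple of it, so summability for the slow
    -- pair is summability for the dominating sequence.
    have hfin : ∀ {B F : ℕ → ℝ} {b : ℝ}, 0 < b → (∀ t, B (t + 1) = b * (1 - 1 / G) ^ t) →
        (Summable fun t => (B t - B (t + 1)) * |F t|) →
        Summable fun t => (G * (1 - 1 / G) ^ t) * |F t| := by
      intro B F b hb eB s
      rw [← summable_nat_add_iff 1] at s ⊢
      refine (s.mul_left (G * (1 - 1 / G) / (b * (1 / G)))).congr fun t => ?_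
      have e : b * (1 - 1 / G) ^ t - b * (1 - 1 / G) ^ (t + 1) = b * (1 / G) * (1 - 1 / G) ^ t := by
        rw [pow_succ]; ring
      rw [eB t, eB (t + 1), e, pow_succ]
      generalize (1 - 1 / G) ^ t = p
      generalize 1 - 1 / G = ρ
      field_simp
    refine ⟨fun t => G * (1 - 1 / G) ^ t, fun A Q h t => ?_, hfin ha eA s0, hfin hq eQ s1⟩
    obtain ⟨R, hR, hRA, hRQ, -⟩ := h.exists_tail
    exact h.tail_bound hG0 hx.1.le hx.2.le hxα.symm hG hR hRA hRQ hρ0 t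
  -- Here `R 0 ≤ 1 = A 0 + Q 0` for every feasible pair, so `R 1 = 0` and all stopping occurs at
  -- time `1`.
  · refine ⟨fun t => if t = 0 then 1 else 0, fun A Q h t => ?_, ?_, ?_⟩
    · obtain ⟨R, hR, hRA, hRQ, hR0⟩ := h.exists_tail
      have hRn := hR.nonneg h.nonneg_fst h.nonneg_snd
      by_cases ht : t = 0
      · subst ht; simpa using h.total.le
      · simp only [if_neg ht]
        have hle := h.le
        have h1 : R 0 ≤ 1 := by
          have e1 : α * A 0 ≤ α * M := mul_le_mul_of_nonneg_left hle hα.le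
          by_contra hc
          exact hcase ⟨by linarith [hRA 0], by linarith⟩
        have h2 : R 1 ≤ 0 := by linarith [hR.rec_eq 0, h.total]
        have h3 := hR.antitone h.nonneg_fst h.nonneg_snd (Nat.one_le_iff_ne_zero.2 ht)
        linarith [hR.rec_eq t, hRn (t + 1)]
    · exact summable_of_ne_finset_zero (s := {0}) fun t ht => by
        simp only [if_neg (show t ≠ 0 by simpa using ht), zero_mul]
    · exact summable_of_ne_finset_zero (s := {0}) fun t ht => by
        simp only [if_neg (show t ≠ 0 by simpa using ht), zero_mul]

end Domination

/-! ### Optional stopping and the splitting of stopping beliefs -/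

section Reduction

variable {μ₀ : unitInterval} {I : InfoStructure μ₀} {τ : Path → WithTop ℕ}

lemma measurable_belief_comp (μ₀ : unitInterval) {N : Path → ℕ} (hN : Measurable N) :
    Measurable fun ω => (belief μ₀ (N ω) ω : ℝ) :=
  (measurable_from_prod_countable_right (f := fun q : ℕ × Path => (belief μ₀ q.1 q.2 : ℝ))
    fun t => measurable_belief μ₀ t).comp (hN.prodMk measurable_id)

lemma integrable_belief_comp (I : InfoStructure μ₀) {N : Path → ℕ} (hN : Measurable N) :
    Integrable (fun ω => (belief μ₀ (N ω) ω : ℝ)) I.law := by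
  have := I.isProb
  exact Integrable.of_bound (measurable_belief_comp μ₀ hN).aestronglyMeasurable 1
    (ae_of_all _ fun ω => by
      rw [Real.norm_eq_abs, abs_of_nonneg (belief_mem μ₀ _ ω).1]; exact (belief_mem μ₀ _ ω).2)

lemma measurableSet_lt_time (hτ : IsStoppingTime history τ) (t : ℕ) :
    MeasurableSet {ω | t < time τ ω} :=
  measurable_time hτ (measurableSet_Ioi (a := t))

lemma lt_time_ae_eq (hfin : ∀ᵐ ω ∂I.law, τ ω ≠ ⊤) (t : ℕ) :
    ({ω | t < time τ ω} : Set Path) =ᵐ[I.law] {ω | (t : WithTop ℕ) < τ ω} := by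
  refine Filter.eventuallyEq_set.2 ?_
  filter_upwards [hfin] with ω hω
  simp only [time]
  cases h : τ ω with
  | top => exact absurd h hω
  | coe k => exact WithTop.coe_lt_coe.symm

/-- Optional stopping for the beliefs. -/
lemma setIntegral_stopBelief (hτ : IsStoppingTime history τ) (hfin : ∀ᵐ ω ∂I.law, τ ω ≠ ⊤) (t : ℕ) :
    ∫ ω in {ω | t < time τ ω}, stopBelief μ₀ τ ω ∂I.law =
      ∫ ω in {ω | t < time τ ω}, (belief μ₀ t ω : ℝ) ∂I.law := by
  have := I.isProb
  have hN := measurable_time hτ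
  have hNm : ∀ m, Measurable fun ω => min (time τ ω) m := fun m => hN.min measurable_const
  -- Each further increment is a martingale difference on an event known at time `t + k`; beliefs
  -- are bounded, so the limit in `k` can be taken.
  have hconst : ∀ k, ∫ ω in {ω | t < time τ ω}, (belief μ₀ (min (time τ ω) (t + k)) ω : ℝ) ∂I.law =
      ∫ ω in {ω | t < time τ ω}, (belief μ₀ t ω : ℝ) ∂I.law := by
    intro k
    induction k with
    | zero =>
      refine setIntegral_congr_fun (measurableSet_lt_time hτ t) fun ω hω => ?_
      simp only [add_zero]
      rw [min_eq_right (le_of_lt hω)]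
    | succ k ih =>
      rw [← ih, ← sub_eq_zero,
        ← integral_sub (integrable_belief_comp I (hNm _)).integrableOn
          (integrable_belief_comp I (hNm _)).integrableOn]
      have h1 : ∀ ω, (belief μ₀ (min (time τ ω) (t + (k + 1))) ω : ℝ)
          - belief μ₀ (min (time τ ω) (t + k)) ω =
          ({ω | t + k < time τ ω}).indicator
            (fun ω => (belief μ₀ (t + k + 1) ω : ℝ) - belief μ₀ (t + k) ω) ω := by
        intro ω
        simp only [indicator, mem_ofPred_eq]
        split_ifs with h
        · rw [min_eq_right (by omega), min_eq_right (by omega)]; rfl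
        · rw [min_eq_left (by omega), min_eq_left (by omega), sub_self]
      have hsub : {ω | t + k < time τ ω} ⊆ {ω | t < time τ ω} := fun ω (hω : t + k < time τ ω) =>
        show t < time τ ω by omega
      simp_rw [h1]
      rw [setIntegral_indicator (measurableSet_lt_time hτ _),
        inter_eq_right.2 hsub,
        setIntegral_congr_set (lt_time_ae_eq hfin _),
        integral_sub (I.martingale.integrable _).integrableOn (I.martingale.integrable _).integrableOn,
        sub_eq_zero]
      exact (I.martingale.setIntegral_eq (Nat.le_succ (t + k)) (hτ.measurableSet_gt (t + k))).symm
  have hlim : Tendsto (fun k => ∫ ω in {ω | t < time τ ω},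
      (belief μ₀ (min (time τ ω) (t + k)) ω : ℝ) ∂I.law) atTop
      (𝓝 (∫ ω in {ω | t < time τ ω}, stopBelief μ₀ τ ω ∂I.law)) := by
    refine tendsto_integral_of_dominated_convergence (fun _ => (1 : ℝ))
      (fun k => (measurable_belief_comp μ₀ (hNm _)).aestronglyMeasurable)
      (integrable_const _) (fun k => ae_of_all _ fun ω => ?_) (ae_of_all _ fun ω => ?_)
    · rw [Real.norm_eq_abs, abs_of_nonneg (belief_mem μ₀ _ ω).1]; exact (belief_mem μ₀ _ ω).2
    · refine tendsto_const_nhds.congr' ?_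
      filter_upwards [eventually_ge_atTop (time τ ω)] with k hk
      rw [min_eq_left (by omega)]; rfl
  simp_rw [hconst] at hlim
  exact tendsto_nhds_unique hlim tendsto_const_nhds |>.symm ▸ rfl

variable {u : Fin 2 → Fin 2 → ℝ} {c : ℝ}

/-- Continuing beyond time `t` is worthwhile on average. -/
lemma Induces.setIntegral_nonneg (h : Induces u c I τ) (t : ℕ) :
    0 ≤ ∫ ω in {ω | t < time τ ω}, (dmPayoff u c μ₀ τ ω
      - (indirectUtility u (belief μ₀ t ω) - c * t)) ∂I.law := by
  have := I.isProb
  have hτ := h.strategy.stopping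
  have hσt : ∀ ω, τ ω ≠ ⊤ → time (fun ω => min (τ ω) (t : WithTop ℕ)) ω = min (time τ ω) t := by
    intro ω hω
    simp only [time]
    cases hk : τ ω with
    | top => exact absurd hk hω
    | coe k =>
      change (min (WithTop.some k) (WithTop.some t)).untopD 0 = min k t
      rw [← WithTop.coe_min]
      rfl
  -- The deviation of stopping at `t` at the latest differs from `τ` only where `τ` exceeds `t`.
  have hσ : IsStrategyFrom I 0 (fun ω => min (τ ω) (t : WithTop ℕ)) :=
    { stopping := hτ.min_const t
      ge := fun ω => bot_le
      finite := ae_of_all _ fun ω => ne_of_lt ((min_le_right _ _).trans_lt (WithTop.coe_lt_top t))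
      integrable := by
        refine Integrable.mono' h.strategy.integrable
          ((measurable_from_top (f := fun n : ℕ => (n : ℝ))).comp
            (measurable_time (hτ.min_const t))).aestronglyMeasurable ?_
        filter_upwards [h.strategy.finite] with ω hω
        rw [hσt ω hω, Real.norm_eq_abs, Nat.abs_cast]
        exact_mod_cast min_le_left _ _ }
  have hle := h.optimal _ hσ
  rw [← integral_indicator (measurableSet_lt_time hτ t)]
  have hdiff : 0 ≤ ∫ ω, (dmPayoff u c μ₀ τ ω - dmPayoff u c μ₀ (fun ω => min (τ ω) (t : WithTop ℕ)) ω) ∂I.law := by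
    rw [integral_sub (h.strategy.integrable_dmPayoff u c) (hσ.integrable_dmPayoff u c)]
    exact sub_nonneg.2 hle
  refine hdiff.trans_eq (integral_congr_ae ?_)
  filter_upwards [h.strategy.finite] with ω hω
  simp only [indicator, mem_ofPred_eq]
  split_ifs with hlt
  · congr 1
    rw [dmPayoff, stopBelief, hσt ω hω, min_eq_right hlt.le]
  · rw [dmPayoff, dmPayoff, stopBelief, stopBelief, hσt ω hω, min_eq_left (not_lt.1 hlt), sub_self]

/-- The weight of the belief `0` when a belief below `x` is split into `0` and `x`. -/
noncomputable def lowWeight (x b : ℝ) : ℝ := max 0 (1 - b / x)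

/-- The weight of the belief `1` when a belief above `x` is split into `x` and `1`. -/
noncomputable def highWeight (x b : ℝ) : ℝ := max 0 ((b - x) / (1 - x))

lemma continuous_lowWeight (x : ℝ) : Continuous (lowWeight x) := by
  unfold lowWeight; fun_prop

lemma continuous_highWeight (x : ℝ) : Continuous (highWeight x) := by
  unfold highWeight; fun_prop

section Weights

variable {x b : ℝ} (hx : x ∈ Ioo (0 : ℝ) 1)

include hx

lemma lowWeight_of_le (h : b ≤ x) : lowWeight x b = 1 - b / x :=
  max_eq_right (sub_nonneg.2 ((div_le_one hx.1).2 h))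

lemma lowWeight_of_ge (h : x ≤ b) : lowWeight x b = 0 :=
  max_eq_left (sub_nonpos.2 ((one_le_div hx.1).2 h))

lemma highWeight_of_le (h : b ≤ x) : highWeight x b = 0 :=
  max_eq_left (div_nonpos_of_nonpos_of_nonneg (by linarith) (by linarith [hx.2]))

lemma highWeight_of_ge (h : x ≤ b) : highWeight x b = (b - x) / (1 - x) :=
  max_eq_right (div_nonneg (by linarith) (by linarith [hx.2]))

lemma weights_mean : (1 - x) * highWeight x b - x * lowWeight x b = b - x := by
  have h0 := hx.1.ne'
  have h1 : 1 - x ≠ 0 := by linarith [hx.2]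
  rcases le_total b x with h | h
  · rw [highWeight_of_le hx h, lowWeight_of_le hx h]; field_simp; ring
  · rw [highWeight_of_ge hx h, lowWeight_of_ge hx h]; field_simp; ring

lemma weights_le (hb : b ∈ Icc (0 : ℝ) 1) : highWeight x b ≤ 1 - lowWeight x b := by
  have h1 : 0 < 1 - x := by linarith [hx.2]
  rcases le_total b x with h | h
  · rw [highWeight_of_le hx h, lowWeight_of_le hx h]
    linarith [div_nonneg hb.1 hx.1.le]
  · rw [highWeight_of_ge hx h, lowWeight_of_ge hx h, sub_zero, div_le_one h1]
    linarith [hb.2]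

/-- The split preserves `indirectUtility`, which is affine on either side of `x`. Subtracting the
affine payoff of action `1`, optimal at `x` and `1`, leaves the contribution of belief `0`. -/
lemma indirectUtility_sub_one (hu0 : u 1 0 < u 0 0) (hu1 : u 0 1 < u 1 1)
    (hxu : expPayoff u 0 x = expPayoff u 1 x) :
    indirectUtility u b - expPayoff u 1 b = (u 0 0 - u 1 0) * lowWeight x b := by
  have h0 := hx.1.ne'
  unfold indirectUtility
  rcases le_total b x with h | h
  · rw [max_eq_left ((expPayoff_ge_iff hu0 hu1 hxu b).2 h), lowWeight_of_le hx h]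
    unfold expPayoff at *
    field_simp
    linear_combination b * hxu
  · rw [max_eq_right ((expPayoff_le_iff hu0 hu1 hxu b).2 h), lowWeight_of_ge hx h]; ring

lemma indirectUtility_sub_zero (hu0 : u 1 0 < u 0 0) (hu1 : u 0 1 < u 1 1)
    (hxu : expPayoff u 0 x = expPayoff u 1 x) :
    indirectUtility u b - expPayoff u 0 b = (u 1 1 - u 0 1) * highWeight x b := by
  have h1 : 1 - x ≠ 0 := by linarith [hx.2]
  unfold indirectUtility
  rcases le_total b x with h | h
  · rw [max_eq_left ((expPayoff_ge_iff hu0 hu1 hxu b).2 h), highWeight_of_le hx h]; ring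
  · rw [max_eq_right ((expPayoff_le_iff hu0 hu1 hxu b).2 h), highWeight_of_ge hx h]
    unfold expPayoff at *
    field_simp
    linear_combination (b - 1) * hxu

end Weights

lemma lowWeight_nonneg (x b : ℝ) : 0 ≤ lowWeight x b := le_max_left _ _

lemma highWeight_nonneg (x b : ℝ) : 0 ≤ highWeight x b := le_max_left _ _

end Reduction

/-! ### From information structures to feasible tails -/

section Feasibility

variable {μ₀ x : unitInterval} {I : InfoStructure μ₀} {τ : Path → WithTop ℕ}
  {u : Fin 2 → Fin 2 → ℝ} {c α β δ : ℝ}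

/-- The probability of stopping after time `t` with the belief `0`, once the stopping beliefs are
split into `0`, `x`, `1`. -/
noncomputable def lowTail (I : InfoStructure μ₀) (τ : Path → WithTop ℕ) (x : ℝ) (t : ℕ) : ℝ :=
  ∫ ω in {ω | t < time τ ω}, lowWeight x (stopBelief μ₀ τ ω) ∂I.law

/-- The probability of stopping after time `t` with the belief `x` or `1`, once the stopping beliefs
are split into `0`, `x`, `1`. -/
noncomputable def highTail (I : InfoStructure μ₀) (τ : Path → WithTop ℕ) (x : ℝ) (t : ℕ) : ℝ :=
  ∫ ω in {ω | t < time τ ω}, (1 - lowWeight x (stopBelief μ₀ τ ω)) ∂I.law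

lemma integrable_comp_stopBelief (hτ : IsStoppingTime history τ) {g : ℝ → ℝ} (hg : Continuous g) :
    Integrable (fun ω => g (stopBelief μ₀ τ ω)) I.law := by
  have := I.isProb
  obtain ⟨C, hC⟩ := isCompact_Icc.exists_bound_of_continuousOn (s := Icc (0 : ℝ) 1) hg.continuousOn
  exact Integrable.of_bound (hg.measurable.comp (measurable_stopBelief μ₀ hτ)).aestronglyMeasurable C
    (ae_of_all _ fun ω => hC _ (stopBelief_mem μ₀ τ ω))

lemma lowWeight_le_one (hx : (x : ℝ) ∈ Ioo (0 : ℝ) 1) {b : ℝ} (hb : b ∈ Icc (0 : ℝ) 1) :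
    lowWeight x b ≤ 1 := by
  linarith [weights_le hx hb, highWeight_nonneg x b]

lemma antitone_setIntegral {g : Path → ℝ} (hg : Integrable g I.law)
    (h0 : ∀ ω, 0 ≤ g ω) : Antitone fun t => ∫ ω in {ω | t < time τ ω}, g ω ∂I.law :=
  fun s t hst => setIntegral_mono_set hg.integrableOn (ae_of_all _ h0)
    (LE.le.eventuallyLE fun ω (hω : t < time τ ω) => show s < time τ ω by omega)

lemma setIntegral_sub_succ {g : Path → ℝ} (hτ : IsStoppingTime history τ) (hg : Integrable g I.law)
    (t : ℕ) : ∫ ω in {ω | t < time τ ω}, g ω ∂I.law - ∫ ω in {ω | t + 1 < time τ ω}, g ω ∂I.law =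
      ∫ ω in time τ ⁻¹' {t + 1}, g ω ∂I.law := by
  have hE : {ω | t < time τ ω} = {ω | t + 1 < time τ ω} ∪ time τ ⁻¹' {t + 1} := by
    ext ω
    simp only [mem_ofPred_eq, mem_union, mem_preimage, mem_singleton_iff]
    omega
  rw [hE, setIntegral_union ?_ (measurable_time hτ (measurableSet_singleton _)) hg.integrableOn
    hg.integrableOn]
  · ring
  · rw [Set.disjoint_left]
    intro ω (h1 : t + 1 < time τ ω) (h2 : time τ ω = t + 1)
    omega

/-- The expected waiting time beyond `t` is at most what either action is worth. -/
lemma Induces.waiting_le (hu0 : u 1 0 < u 0 0) (hu1 : u 0 1 < u 1 1) (hx : (x : ℝ) ∈ Ioo (0 : ℝ) 1)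
    (hxu : expPayoff u 0 x = expPayoff u 1 x) (h : Induces u c I τ) (t : ℕ) :
    c * ∫ ω in {ω | t < time τ ω}, ((time τ ω : ℝ) - t) ∂I.law ≤
        (u 0 0 - u 1 0) * ∫ ω in {ω | t < time τ ω}, lowWeight x (stopBelief μ₀ τ ω) ∂I.law ∧
    c * ∫ ω in {ω | t < time τ ω}, ((time τ ω : ℝ) - t) ∂I.law ≤
        (u 1 1 - u 0 1) * ∫ ω in {ω | t < time τ ω}, highWeight x (stopBelief μ₀ τ ω) ∂I.law := by
  have := I.isProb
  have hτ := h.strategy.stopping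
  have h_eq := setIntegral_stopBelief (μ₀ := μ₀) hτ h.strategy.finite t
  have hb : Integrable (stopBelief μ₀ τ) I.law := integrable_comp_stopBelief hτ continuous_id
  have hbt := I.martingale.integrable t
  have hT : Integrable (fun ω => (time τ ω : ℝ) - t) I.law := h.strategy.integrable.sub (integrable_const _)
  -- The payoff of a fixed action is affine in the belief, so by optional stopping it has the same
  -- mean at `t` and at `τ` and cancels.
  have main : ∀ (a : Fin 2) (g : ℝ → ℝ) (k : ℝ), Continuous g →
      (∀ b, indirectUtility u b - expPayoff u a b = k * g b) →
      c * ∫ ω in {ω | t < time τ ω}, ((time τ ω : ℝ) - t) ∂I.law ≤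
        k * ∫ ω in {ω | t < time τ ω}, g (stopBelief μ₀ τ ω) ∂I.law := by
    intro a g k hg hgk
    have hgi : Integrable (fun ω => g (stopBelief μ₀ τ ω)) I.law := integrable_comp_stopBelief hτ hg
    have haff : ∀ z, expPayoff u a z = u a 0 + (u a 1 - u a 0) * z := fun z => by
      unfold expPayoff; ring
    have hI1 : Integrable (fun ω => k * g (stopBelief μ₀ τ ω)) I.law := hgi.const_mul k
    have hI2 : Integrable (fun ω => c * ((time τ ω : ℝ) - t)) I.law := hT.const_mul c
    have hI3 : Integrable (fun ω => (u a 1 - u a 0) * (stopBelief μ₀ τ ω - (belief μ₀ t ω : ℝ))) I.law :=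
      (hb.sub hbt).const_mul _
    have hI12 : Integrable (fun ω => k * g (stopBelief μ₀ τ ω) - c * ((time τ ω : ℝ) - t)) I.law :=
      hI1.sub hI2
    have hle : ∫ ω in {ω | t < time τ ω}, (dmPayoff u c μ₀ τ ω
        - (indirectUtility u (belief μ₀ t ω) - c * t)) ∂I.law ≤
        ∫ ω in {ω | t < time τ ω}, (k * g (stopBelief μ₀ τ ω) - c * ((time τ ω : ℝ) - t)
          + (u a 1 - u a 0) * (stopBelief μ₀ τ ω - (belief μ₀ t ω : ℝ))) ∂I.law := by
      refine integral_mono ?_ (hI12.add hI3).integrableOn fun ω => ?_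
      · refine ((h.strategy.integrable_dmPayoff u c).sub (Integrable.sub ?_ (integrable_const _))).integrableOn
        obtain ⟨C, hC⟩ := exists_indirectUtility_bound u
        exact Integrable.of_bound ((continuous_indirectUtility u).measurable.comp
          (measurable_belief μ₀ t)).aestronglyMeasurable C (ae_of_all _ fun ω => hC _ (belief_mem μ₀ t ω))
      · have h1 : expPayoff u a (belief μ₀ t ω) ≤ indirectUtility u (belief μ₀ t ω) := by
          fin_cases a
          · exact le_max_left _ _
          · exact le_max_right _ _
        have h2 := hgk (stopBelief μ₀ τ ω)
        rw [haff] at h1 h2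
        simp only [dmPayoff]
        linarith
    have h0 := (h.setIntegral_nonneg t).trans hle
    rw [integral_add hI12.integrableOn hI3.integrableOn,
      integral_sub hI1.integrableOn hI2.integrableOn, integral_const_mul, integral_const_mul,
      integral_const_mul, integral_sub hb.integrableOn hbt.integrableOn, h_eq, sub_self, mul_zero] at h0
    linarith
  exact ⟨main 1 _ _ (continuous_lowWeight x) fun b => indirectUtility_sub_one hx hu0 hu1 hxu,
    main 0 _ _ (continuous_highWeight x) fun b => indirectUtility_sub_zero hx hu0 hu1 hxu⟩

/-- On each path at most `time τ ω - t` of the events `t + s < time τ ω` occur. -/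
lemma sum_measureReal_le (hτ : IsStrategyFrom I 0 τ) (t n : ℕ) :
    ∑ s ∈ Finset.range n, I.law.real {ω | t + s < time τ ω} ≤
      ∫ ω in {ω | t < time τ ω}, ((time τ ω : ℝ) - t) ∂I.law := by
  have := I.isProb
  have hm := fun s => measurableSet_lt_time hτ.stopping s
  have h1 : ∀ s ∈ Finset.range n, I.law.real {ω | t + s < time τ ω} =
      ∫ ω, ({ω | t + s < time τ ω}).indicator (fun _ => (1 : ℝ)) ω ∂I.law := fun s _ => by
    rw [integral_indicator (hm _), setIntegral_const, smul_eq_mul, mul_one]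
  have hint : ∀ s ∈ Finset.range n,
      Integrable (({ω | t + s < time τ ω}).indicator (fun _ => (1 : ℝ))) I.law :=
    fun s _ => (integrable_const _).indicator (hm _)
  rw [Finset.sum_congr rfl h1, ← integral_finsetSum _ hint, ← integral_indicator (hm t)]
  refine integral_mono (integrable_finsetSum _ hint)
    ((hτ.integrable.sub (integrable_const _)).indicator (hm t)) fun ω => ?_
  have hcount : ∑ s ∈ Finset.range n, ({ω | t + s < time τ ω}).indicator (fun _ => (1 : ℝ)) ω =
      (((Finset.range n).filter fun s => t + s < time τ ω).card : ℝ) := by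
    simp [indicator]
  dsimp only
  rw [hcount]
  have hsub : ((Finset.range n).filter fun s => t + s < time τ ω) ⊆ Finset.range (time τ ω - t) := by
    intro s hs
    simp only [Finset.mem_filter, Finset.mem_range] at hs ⊢
    omega
  have hcard := Finset.card_le_card hsub
  rw [Finset.card_range] at hcard
  simp only [indicator, mem_ofPred_eq]
  split_ifs with hlt
  · rw [← Nat.cast_sub hlt.le]; exact_mod_cast hcard
  · have : time τ ω - t = 0 := by omega
    rw [this] at hcard
    exact_mod_cast hcard

/-- The structures under which the DM pays attention give rise to feasible tails. -/
theorem Induces.tailFeasible (hu0 : u 1 0 < u 0 0) (hu1 : u 0 1 < u 1 1)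
    (hx : (x : ℝ) ∈ Ioo (0 : ℝ) 1) (hxu : expPayoff u 0 x = expPayoff u 1 x) (hc : 0 < c)
    (hαc : α * c = u 0 0 - u 1 0) (hβc : β * c = u 1 1 - u 0 1) (hβ : 0 < β)
    (hxα : (1 - x) * α = x * β) (hδ : x * δ = (μ₀ - x) * α)
    (h : Induces u c I τ) (hatt : PaysAttention I τ) :
    TailFeasible α β δ (1 - μ₀) (lowTail I τ x) (highTail I τ x) := by
  have := I.isProb
  have hτ := h.strategy.stopping
  have hwi : Integrable (fun ω => lowWeight x (stopBelief μ₀ τ ω)) I.law :=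
    integrable_comp_stopBelief hτ (continuous_lowWeight x)
  have hvi : Integrable (fun ω => highWeight x (stopBelief μ₀ τ ω)) I.law :=
    integrable_comp_stopBelief hτ (continuous_highWeight x)
  have hw1i : Integrable (fun ω => 1 - lowWeight x (stopBelief μ₀ τ ω)) I.law :=
    (integrable_const (1 : ℝ)).sub hwi
  have hw1 : ∀ ω, 0 ≤ 1 - lowWeight x (stopBelief μ₀ τ ω) := fun ω =>
    sub_nonneg.2 (lowWeight_le_one hx (stopBelief_mem μ₀ τ ω))
  set V : ℕ → ℝ := fun t => ∫ ω in {ω | t < time τ ω}, highWeight x (stopBelief μ₀ τ ω) ∂I.law with hV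
  set L : ℕ → ℝ := fun t => ∫ ω in {ω | t < time τ ω}, ((time τ ω : ℝ) - t) ∂I.law with hL
  have hVQ : ∀ t, V t ≤ highTail I τ x t := fun t =>
    integral_mono hvi.integrableOn hw1i.integrableOn fun ω => weights_le hx (stopBelief_mem μ₀ τ ω)
  have hSum : ∀ t, lowTail I τ x t + highTail I τ x t = I.law.real {ω | t < time τ ω} := fun t => by
    rw [lowTail, highTail, ← integral_add hwi.integrableOn hw1i.integrableOn]
    simp
  have hsum : ∀ t n, ∑ s ∈ Finset.range n, (lowTail I τ x (t + s) + highTail I τ x (t + s)) ≤ L t :=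
    fun t n => by simp_rw [hSum]; exact sum_measureReal_le h.strategy t n
  have hLA : ∀ t, L t ≤ α * lowTail I τ x t := fun t => by
    have := (h.waiting_le hu0 hu1 hx hxu t).1
    rw [← hαc] at this
    refine le_of_mul_le_mul_left ?_ hc
    calc c * L t ≤ α * c * lowTail I τ x t := this
      _ = c * (α * lowTail I τ x t) := by ring
  have hLV : ∀ t, L t ≤ β * V t := fun t => by
    have := (h.waiting_le hu0 hu1 hx hxu t).2
    rw [← hβc] at this
    refine le_of_mul_le_mul_left ?_ hc
    calc c * L t ≤ β * c * V t := this
      _ = c * (β * V t) := by ring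
  have hfull : ∀ᵐ ω ∂I.law, 0 < time τ ω := by
    filter_upwards [hatt, h.strategy.finite] with ω h1 h2
    unfold time
    cases hk : τ ω with
    | top => exact absurd hk h2
    | coe k =>
      rw [hk] at h1
      exact Nat.pos_of_ne_zero fun h0 => h1 (WithTop.coe_inj.2 h0)
  have hset : ({ω | 0 < time τ ω} : Set Path) =ᵐ[I.law] univ := Filter.eventuallyEq_univ.2 hfull
  have hmean : (1 - x) * V 0 - x * lowTail I τ x 0 = μ₀ - x := by
    have e := setIntegral_stopBelief (μ₀ := μ₀) hτ h.strategy.finite 0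
    have hb : Integrable (stopBelief μ₀ τ) I.law := integrable_comp_stopBelief hτ continuous_id
    rw [hV, lowTail, ← integral_const_mul, ← integral_const_mul,
      ← integral_sub (hvi.const_mul _).integrableOn (hwi.const_mul _).integrableOn]
    simp_rw [weights_mean hx]
    rw [integral_sub hb.integrableOn (integrable_const _), e, setIntegral_congr_set hset,
      setIntegral_congr_set hset]
    simp [belief]
  have htot : lowTail I τ x 0 + highTail I τ x 0 = 1 := by
    rw [hSum, measureReal_congr hset, probReal_univ]
  have hx1 : 0 < 1 - (x : ℝ) := by linarith [hx.2]
  -- At time `0` the mean belief is the prior, which expresses the mass at belief `1` through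
  -- `lowTail I τ x 0`.
  have hβV : β * V 0 = α * lowTail I τ x 0 + δ := by
    have : (x : ℝ) * (β * V 0 - (α * lowTail I τ x 0 + δ)) = 0 := by
      linear_combination α * hmean - hδ - V 0 * hxα
    have := (mul_eq_zero.1 this).resolve_left hx.1.ne'
    linarith
  exact
    { antitone_fst := antitone_setIntegral hwi fun ω => lowWeight_nonneg _ _
      antitone_snd := antitone_setIntegral hw1i hw1
      nonneg_fst := fun t => integral_nonneg fun ω => lowWeight_nonneg _ _
      nonneg_snd := fun t => integral_nonneg hw1
      total := htot
      le := by
        have := mul_le_mul_of_nonneg_left (hVQ 0) hx1.le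
        rw [show highTail I τ x 0 = 1 - lowTail I τ x 0 by linarith] at this
        linarith
      sum_le_fst := fun t n => (hsum t n).trans (hLA t)
      sum_le_snd := fun t n => (hsum t n).trans ((hLV t).trans (mul_le_mul_of_nonneg_left (hVQ t) hβ.le))
      sum_le_prior := fun n => by
        have := (hsum 0 n).trans (hLV 0)
        rw [hβV] at this
        simpa using this }

/-- Splitting the stopping beliefs does not harm the designer. -/
theorem Induces.designerValue_le (hu0 : u 1 0 < u 0 0) (hu1 : u 0 1 < u 1 1)
    (hx : (x : ℝ) ∈ Ioo (0 : ℝ) 1) (hxu : expPayoff u 0 x = expPayoff u 1 x)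
    (h : Induces u c I τ) (hatt : PaysAttention I τ) {f : Fin 2 → ℕ → ℝ} (hf : ∀ t, f 0 t ≤ f 1 t)
    (hint : Integrable (designerPayoff u f μ₀ τ) I.law)
    (hsum : Summable fun t => (lowTail I τ x t - lowTail I τ x (t + 1)) * f 0 (t + 1) +
      (highTail I τ x t - highTail I τ x (t + 1)) * f 1 (t + 1)) :
    designerValue u f I τ ≤ tailPayoff (fun t => f 0 (t + 1)) (fun t => f 1 (t + 1))
      (lowTail I τ x) (highTail I τ x) := by
  have := I.isProb
  have hτ := h.strategy.stopping
  have hN := measurable_time hτ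
  have hwi : Integrable (fun ω => lowWeight x (stopBelief μ₀ τ ω)) I.law :=
    integrable_comp_stopBelief hτ (continuous_lowWeight x)
  have hw1i : Integrable (fun ω => 1 - lowWeight x (stopBelief μ₀ τ ω)) I.law :=
    (integrable_const (1 : ℝ)).sub hwi
  have hdec : HasSum (fun n => ∫ ω in time τ ⁻¹' {n}, designerPayoff u f μ₀ τ ω ∂I.law)
      (designerValue u f I τ) := by
    have := hasSum_integral_iUnion (μ := I.law) (f := designerPayoff u f μ₀ τ)
      (s := fun n : ℕ => time τ ⁻¹' {n}) (fun n => hN (measurableSet_singleton n))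
      (fun m n hmn => Set.disjoint_left.2 fun ω (h1 : time τ ω = m) (h2 : time τ ω = n) =>
        hmn (h1.symm.trans h2)) hint.integrableOn
    rwa [← preimage_iUnion, iUnion_singleton_eq_range, range_id', preimage_univ,
      setIntegral_univ] at this
  have hzero : ∫ ω in time τ ⁻¹' {0}, designerPayoff u f μ₀ τ ω ∂I.law = 0 := by
    refine setIntegral_measure_zero _ ?_
    have : ∀ᵐ ω ∂I.law, ¬ ω ∈ time τ ⁻¹' {0} := by
      filter_upwards [hatt, h.strategy.finite] with ω h1 h2 (h3 : time τ ω = 0)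
      unfold time at h3
      cases hk : τ ω with
      | top => exact h2 hk
      | coe k =>
        rw [hk] at h1 h3
        exact h1 (WithTop.coe_inj.2 h3)
    exact measure_eq_zero_iff_ae_notMem.2 this
  have hdec' : HasSum (fun n => ∫ ω in time τ ⁻¹' {n + 1}, designerPayoff u f μ₀ τ ω ∂I.law)
      (designerValue u f I τ) := by
    rw [hasSum_nat_add_iff 1 (f := fun n => ∫ ω in time τ ⁻¹' {n}, designerPayoff u f μ₀ τ ω ∂I.law)]
    simpa [hzero] using hdec
  refine hasSum_le (fun n => ?_) hdec' hsum.hasSum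
  rw [lowTail, lowTail, highTail, highTail, setIntegral_sub_succ hτ hwi, setIntegral_sub_succ hτ hw1i,
    ← integral_mul_const, ← integral_mul_const,
    ← integral_add (hwi.mul_const _).integrableOn (hw1i.mul_const _).integrableOn]
  refine setIntegral_mono_on hint.integrableOn
    ((hwi.mul_const _).add (hw1i.mul_const _)).integrableOn (hN (measurableSet_singleton _))
    fun ω (hω : time τ ω = n + 1) => ?_
  rw [designerPayoff, hω, bestAction_eq hu0 hu1 hxu]
  -- At or above `x` the split leaves action `1`; below, it replaces action `0` by action `1` with
  -- some probability, which `hf` makes harmless.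
  split_ifs with hb
  · rw [lowWeight_of_ge hx hb]; linarith
  · have h2 := lowWeight_le_one hx (stopBelief_mem μ₀ τ ω)
    nlinarith [hf (n + 1)]

/-- A DM who does not pay attention stops at once on every path. -/
lemma IsStrategyFrom.eq_zero_of_not_paysAttention (h : IsStrategyFrom I 0 τ)
    (hatt : ¬ PaysAttention I τ) (ω : Path) : τ ω = 0 := by
  have : ∃ ω', τ ω' = 0 := by
    by_contra hc
    push Not at hc
    exact hatt (ae_of_all _ hc)
  obtain ⟨ω', hω'⟩ := this
  -- Nothing is known at time `0`, so stopping then occurs on every path or on none.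
  exact (mem_iff_of_agree (t := 0) (E := {ω | τ ω = 0}) (h.stopping.measurableSet_eq 0)
    fun k hk => absurd hk k.not_lt_zero).2 hω'

lemma designerValue_of_eq_zero (I : InfoStructure μ₀) (h : ∀ ω, τ ω = 0) (f : Fin 2 → ℕ → ℝ) :
    designerValue u f I τ = f (bestAction u μ₀) 0 := by
  have := I.isProb
  have ht : ∀ ω, time τ ω = 0 := fun ω => by rw [time, h]; rfl
  have hp : designerPayoff u f μ₀ τ = fun _ => f (bestAction u μ₀) 0 := by
    funext ω
    rw [designerPayoff, stopBelief, ht]; rfl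
  rw [designerValue, hp]; simp

end Feasibility

end AttentionCapture

/-! ### The proposition -/

open AttentionCapture in
theorem proposition11
    (u : Fin 2 → Fin 2 → ℝ) (hu0 : u 1 0 < u 0 0) (hu1 : u 0 1 < u 1 1)
    (x : ℝ) (hx : x ∈ Set.Ioo (0 : ℝ) 1) (hxu : expPayoff u 0 x = expPayoff u 1 x)
    (c : ℝ) (hc : 0 < c)
    (μ₀ : unitInterval) (hμ₀ : (μ₀ : ℝ) ∈ Set.Ioo (0 : ℝ) 1)
    (f : Fin 2 → ℕ → ℝ) (hf : ∀ t, f 0 t ≤ f 1 t)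
    (hsuper : ∀ s t, s ≤ t → f 1 s + f 0 t ≤ f 1 t + f 0 s)
    (hint : ∀ (I : InfoStructure μ₀) (τ : Path → WithTop ℕ), Induces u c I τ →
      MeasureTheory.Integrable (designerPayoff u f μ₀ τ) I.law) :
    (∃ (I : InfoStructure μ₀) (τ : Path → WithTop ℕ), Induces u c I τ ∧ IsExtremalObedient u c I ∧
      (∀ (I' : InfoStructure μ₀) (τ' : Path → WithTop ℕ), Induces u c I' τ' →
        designerValue u f I' τ' ≤ designerValue u f I τ) ∧
      (FullyRevealing I τ x ∨ PureBadNews u c I τ x)) ∧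
    ((∃ (I : InfoStructure μ₀) (τ : Path → WithTop ℕ), Induces u c I τ ∧ PaysAttention I τ) →
      ∃ (I : InfoStructure μ₀) (τ : Path → WithTop ℕ), Induces u c I τ ∧ IsExtremalObedient u c I ∧
        PaysAttention I τ ∧
        (∀ (I' : InfoStructure μ₀) (τ' : Path → WithTop ℕ), Induces u c I' τ' →
          PaysAttention I' τ' → designerValue u f I' τ' ≤ designerValue u f I τ) ∧
        (FullyRevealing I τ x ∨ PureBadNews u c I τ x)) := by
  obtain ⟨x, rfl⟩ : ∃ y : unitInterval, (y : ℝ) = x := ⟨⟨x, hx.1.le, hx.2.le⟩, rfl⟩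
  have hx0 := hx.1.ne'
  -- `α` and `β` are the losses from a wrong action in units of waiting time. `δ` is such that `(α *
  -- A 0 + δ) / β` is the probability of belief `1` when `A 0` is that of belief `0`.
  obtain ⟨α, hα⟩ : ∃ α, α = (u 0 0 - u 1 0) / c := ⟨_, rfl⟩
  obtain ⟨β, hβ⟩ : ∃ β, β = (u 1 1 - u 0 1) / c := ⟨_, rfl⟩
  obtain ⟨δ, hδ'⟩ : ∃ δ, δ = ((μ₀ : ℝ) - x) * α / x := ⟨_, rfl⟩
  have hα0 : 0 < α := hα ▸ div_pos (sub_pos.2 hu0) hc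
  have hβ0 : 0 < β := hβ ▸ div_pos (sub_pos.2 hu1) hc
  have hαc : α * c = u 0 0 - u 1 0 := by rw [hα]; field_simp
  have hβc : β * c = u 1 1 - u 0 1 := by rw [hβ]; field_simp
  have hxα : (1 - (x : ℝ)) * α = x * β := by
    have : c * ((1 - (x : ℝ)) * α - x * β) = 0 := by
      unfold expPayoff at hxu
      linear_combination (1 - (x : ℝ)) * hαc - x * hβc + hxu
    linarith [(mul_eq_zero.1 this).resolve_left hc.ne']
  have hδ : (x : ℝ) * δ = (μ₀ - x) * α := by rw [hδ']; field_simp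
  have hM : (α + β) * (1 - (μ₀ : ℝ)) = β - δ := by
    have : (x : ℝ) * ((α + β) * (1 - (μ₀ : ℝ)) - (β - δ)) = 0 := by
      linear_combination hδ + (μ₀ : ℝ) * hxα
    linarith [(mul_eq_zero.1 this).resolve_left hx0]
  have second : (∃ (I : InfoStructure μ₀) (τ : Path → WithTop ℕ), Induces u c I τ ∧ PaysAttention I τ) →
      ∃ (I : InfoStructure μ₀) (τ : Path → WithTop ℕ), Induces u c I τ ∧ IsExtremalObedient u c I ∧
        PaysAttention I τ ∧
        (∀ (I' : InfoStructure μ₀) (τ' : Path → WithTop ℕ), Induces u c I' τ' →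
          PaysAttention I' τ' → designerValue u f I' τ' ≤ designerValue u f I τ) ∧
        (FullyRevealing I τ x ∨ PureBadNews u c I τ x) := by
    rintro ⟨I₀, τ₀, h₀, hatt₀⟩
    have hfeas : ∀ (I' : InfoStructure μ₀) (τ' : Path → WithTop ℕ), Induces u c I' τ' →
        PaysAttention I' τ' → TailFeasible α β δ (1 - μ₀) (lowTail I' τ' x) (highTail I' τ' x) :=
      fun I' τ' h hatt => h.tailFeasible hu0 hu1 hx hxu hc hαc hβc hβ0 hxα hδ hatt
    obtain ⟨w, hw, hw0, hw1⟩ := exists_dominating (F₀ := fun t => f 0 (t + 1))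
      (F₁ := fun t => f 1 (t + 1)) hα0 hβ0 hx
      (M := 1 - μ₀) ⟨by linarith [hμ₀.2], by linarith [hμ₀.1]⟩ hxα hM fun A Q h => by
        -- Integrability is assumed for structures; applied to one that realizes the pair, it yields
        -- the summability.
        obtain ⟨I, τ, hI, -, -, hval, -⟩ :=
          h.exists_infoStructure hu0 hu1 hx hxu hc hαc hβc hβ0 hxα hδ
        exact (hval f (hint I τ hI)).2
    obtain ⟨A, Q, h, hmax, hform⟩ := exists_optimal_tailFeasible hα0 hβ0 hM
      (F₀ := fun t => f 0 (t + 1)) (F₁ := fun t => f 1 (t + 1))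
      (fun s t hst => by linarith [hsuper (s + 1) (t + 1) (by omega)]) hw hw0 hw1
      ⟨_, _, hfeas I₀ τ₀ h₀ hatt₀⟩
    obtain ⟨I, τ, hI, hext, hatt, hval, hfull, hbad⟩ :=
      h.exists_infoStructure hu0 hu1 hx hxu hc hαc hβc hβ0 hxα hδ
    refine ⟨I, τ, hI, hext, hatt, fun I' τ' h' hatt' => ?_, hform.imp hfull hbad⟩
    have hfe := hfeas I' τ' h' hatt'
    rw [(hval f (hint I τ hI)).1]
    exact (h'.designerValue_le hu0 hu1 hx hxu hatt' hf (hint I' τ' h')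
      (hfe.summable_term (hw _ _ hfe) hw0 hw1)).trans (hmax _ _ hfe)
  refine ⟨?_, second⟩
  obtain ⟨Z, hZ, hZext⟩ := exists_infoStructure_zero (μ₀ := μ₀) hu0 hu1 hx hxu hc
  have hZval : designerValue u f Z (fun _ => 0) = f (bestAction u μ₀) 0 :=
    designerValue_of_eq_zero Z (fun _ => rfl) f
  have hnot : ∀ (I' : InfoStructure μ₀) (τ' : Path → WithTop ℕ), Induces u c I' τ' →
      ¬ PaysAttention I' τ' → designerValue u f I' τ' = f (bestAction u μ₀) 0 :=
    fun I' τ' h' hatt' =>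
      designerValue_of_eq_zero I' (h'.strategy.eq_zero_of_not_paysAttention hatt') f
  -- The optimum is the better of `Z` and the best structure with attention, if there is any.
  by_cases hex : ∃ (I : InfoStructure μ₀) (τ : Path → WithTop ℕ), Induces u c I τ ∧ PaysAttention I τ
  · obtain ⟨I, τ, hI, hext, hatt, hmax, hform⟩ := second hex
    rcases le_total (f (bestAction u μ₀) 0) (designerValue u f I τ) with hle | hle
    · refine ⟨I, τ, hI, hext, fun I' τ' h' => ?_, hform⟩
      by_cases hatt' : PaysAttention I' τ'
      · exact hmax I' τ' h' hatt'
      · rw [hnot I' τ' h' hatt']; exact hle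
    · refine ⟨Z, fun _ => 0, hZ, hZext, fun I' τ' h' => ?_, Or.inr (pureBadNews_of_zero Z u c x)⟩
      rw [hZval]
      by_cases hatt' : PaysAttention I' τ'
      · exact (hmax I' τ' h' hatt').trans hle
      · exact (hnot I' τ' h' hatt').le
  · refine ⟨Z, fun _ => 0, hZ, hZext, fun I' τ' h' => ?_, Or.inr (pureBadNews_of_zero Z u c x)⟩
    rw [hZval]
    exact (hnot I' τ' h' fun hatt' => hex ⟨I', τ', h', hatt'⟩).le
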